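/- **Setting.** Let $d\ge1$, $\mathcal X=[0,1]^d$, $\alpha>0$, $\beta\in(0,1]$ with $\alpha\beta\le1$, and fix constants $L,D_0,\underline c,\bar c>0$, $\delta_0\in(0,1)$. A two-arm nonparametric bandit with horizon $T$ is an i.i.d. sequence $(X_t,Y_t^{(1)},Y_t^{(-1)})$, $1\le t\le T$, with $X_t\in\mathcal X$ having a density between $\underline c$ and $\bar c$ (law $P_X$), $Y_t^{(k)}\in[0,1]$ and $\mathbb E[Y_t^{(k)}\mid X_t]=f^{(k)}(X_t)$, such that $|f^{(k)}(x)-f^{(k)}(x')|\le L\|x-x'\|_2^\beta$ on $\mathcal X$ for $k\in\{1,-1\}$, and $P_X(0<|f^{(1)}-f^{(-1)}|\le\delta)\le D_0\delta^\alpha$ for $0\le\delta\le\delta_0$. An $M$-batch policy has a grid $0=t_0<t_1<\dots<t_M=T$; the arm $A_t$ pulled at a time $t\in(t_{i-1},t_i]$ (batch $i$) may depend only on $X_1,\dots,X_t$ and on the rewards observed up to time $t_{i-1}$. With $f^\star=\max_k f^{(k)}$ its regret is $R_T=\mathbb E\sum_{t=1}^T\big(f^\star(X_t)-f^{(A_t)}(X_t)\big)$.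 **Policy (BaSEDB).** Given split factors $g_0,\dots,g_{M-1}$, put $w_0=1$, $w_i=(g_0\cdots g_{i-1})^{-1}$, and let $\mathcal B_i$ be the regular partition of $\mathcal X$ into cubes (bins) of width $w_i$. Start with all bins of $\mathcal B_1$ active, each with active arm set $\mathcal I_C=\{1,-1\}$. In each batch $i=1,\dots,M-1$, for every active bin $C$, pull the arms of $\mathcal I_C$ in a round-robin way at the times of the batch with $X_t\in C$. At the end of batch $i$, in every active bin $C$ with two active arms, remove from $\mathcal I_C$ each arm whose empirical mean reward over the visits to $C$ in batch $i$ is more than $U(m_{C,i},T,C)$ below the largest one, where $m_{C,i}$ is the number of visits to $C$ in batch $i$, $U(\tau,T,C)=4\sqrt{\log(2T|C|^d)/\tau}$ and $|C|$ is the width of $C$; if both arms remain, replace $C$ by its $g_i^d$ children, which inherit $\mathcal I_C$. In batch $M$ pull any active arm of the active bin containing $X_t$. **Parameters.** Let $\gamma=\frac{\beta(1+\alpha)}{2\beta+d}$ and $c_0=2Ld^{\beta/2}+1$. Fix constants $b_-,b_+,\ell_->0$ and let $$b_-\,\frac{T^{\frac{1-\gamma}{1-\gamma^M}}}{(\log T)^{2(1-\gamma)}}\le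 b\le b_+\,T^{\frac{1-\gamma}{1-\gamma^M}}$$ (in particular any $b=\Theta(T^{\frac{1-\gamma}{1-\gamma^M}})$ is allowed), $g_0=\lfloor b^{1/(2\beta+d)}\rfloor$, $g_i=\lfloor g_{i-1}^\gamma\rfloor$ for $1\le i\le M-2$, and $g_{M-1}=1$ (for $M\ge2$). Let the grid satisfy $$t_i-t_{i-1}=\big\lfloor l_i\,w_i^{-(2\beta+d)}\log(Tw_i^d)\big\rfloor,\qquad 1\le i\le M-1,$$ where $l_i\ge\ell_-$ are such that $U(2m^\star_{C,i},T,C)\ge2c_0|C|^\beta$ for all $1\le i\le M-1$ and $C\in\mathcal B_i$, with $m^\star_{C,i}=(t_i-t_{i-1})P_X(C)$. **Theorem.** For every $D_1>0$ there is a constant $\tilde C>0$, depending only on $d,\alpha,\beta,L,\delta_0,D_0,\underline c,\bar c,D_1,b_-,b_+,\ell_-$ (so not on $T$, $M$ or the bandit), such that for all $T$ and $1\le M\le D_1\log T$, for all parameters as above and every bandit as above, BaSEDB satisfies $$R_T\le\tilde C(\log T)^2\,T^{\frac{1-\gamma}{1-\gamma^M}}.$$ -/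

import Mathlib

open MeasureTheory ProbabilityTheory

noncomputable section

/-- The covariate space is contained in `ℝᵈ` with the Euclidean norm. -/
abbrev Cov (d : ℕ) : Type := EuclideanSpace ℝ (Fin d)

/-- The two arms `1` and `-1`: the units of `ℤ`. -/
abbrev Arm : Type := ℤˣ

/-- The unit cube `𝒳 = [0,1]ᵈ`. -/
def unitCube (d : ℕ) : Set (Cov d) := {x | ∀ j, x j ∈ Set.Icc (0 : ℝ) 1}

/-! ### Bandit instances -/

/-- The law `μ` of one vector `(X, (Y⁽¹⁾, Y⁽⁻¹⁾))`, with mean reward functions `f k`, belongs to the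
class of nonparametric two-arm bandits: `X` lives in the unit cube and has a density between `cLo`
and `cHi`, the rewards lie in `[0,1]`, `E[Y⁽ᵏ⁾ | X] = f⁽ᵏ⁾(X)`, the mean rewards are
`(β, L)`-smooth, and the margin condition holds with parameters `α`, `δ₀`, `D₀`. -/
structure IsBanditLaw {d : ℕ} (α β L δ₀ D₀ cLo cHi : ℝ)
    (μ : Measure (Cov d × (Arm → ℝ))) (f : Arm → Cov d → ℝ) : Prop where
  isProb : IsProbabilityMeasure μ
  density : ∃ p : Cov d → ℝ, Measurable p ∧
    (∀ᵐ x ∂(volume.restrict (unitCube d)), cLo ≤ p x ∧ p x ≤ cHi) ∧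
    μ.map Prod.fst = (volume.restrict (unitCube d)).withDensity (fun x => ENNReal.ofReal (p x))
  reward_mem : ∀ᵐ z ∂μ, ∀ k, z.2 k ∈ Set.Icc (0 : ℝ) 1
  mean_reward : ∀ k : Arm,
    μ[fun z : Cov d × (Arm → ℝ) => z.2 k | MeasurableSpace.comap Prod.fst inferInstance]
      =ᵐ[μ] fun z => f k z.1
  smooth : ∀ k : Arm, ∀ x ∈ unitCube d, ∀ x' ∈ unitCube d,
    |f k x - f k x'| ≤ L * ‖x - x'‖ ^ β
  margin : ∀ δ ∈ Set.Icc (0 : ℝ) δ₀,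
    μ.real {z | 0 < |f 1 z.1 - f (-1) z.1| ∧ |f 1 z.1 - f (-1) z.1| ≤ δ} ≤ D₀ * δ ^ α

/-- `(X_t, Y_t)`, `t = 1, …, T`, are independent with common law `μ`. Time `t ∈ {1, …, T}` is
represented by the element `t - 1` of `Fin T`. -/
structure IsSample {d T : ℕ} {Ω : Type*} [MeasurableSpace Ω] (P : Measure Ω)
    (μ : Measure (Cov d × (Arm → ℝ))) (X : Fin T → Ω → Cov d) (Y : Fin T → Ω → Arm → ℝ) :
    Prop where
  measurable_X : ∀ t, Measurable (X t)
  measurable_Y : ∀ t, Measurable (Y t)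
  indep : iIndepFun (fun t ω => (X t ω, Y t ω)) P
  law : ∀ t, P.map (fun ω => (X t ω, Y t ω)) = μ

/-! ### Batch policies and their regret -/

/-- `0 = t₀ < t₁ < ⋯ < t_M = T`. -/
def IsGrid (T M : ℕ) (Γ : ℕ → ℕ) : Prop :=
  Γ 0 = 0 ∧ Γ M = T ∧ ∀ i < M, Γ i < Γ (i + 1)

/-- The times `t_{i-1} + 1, …, t_i` of batch `i ≥ 1`, shifted by one. -/
def batch {T : ℕ} (Γ : ℕ → ℕ) (i : ℕ) : Finset (Fin T) :=
  Finset.univ.filter fun t => Γ (i - 1) ≤ t.val ∧ t.val < Γ i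

/-- A rule that selects the arm at each time `t`, given the covariates and the observed rewards. -/
abbrev Policy (d T : ℕ) : Type := Fin T → (Fin T → Cov d) → (Fin T → ℝ) → Arm

/-- The arm at a time `t` of batch `i` depends (measurably) only on the covariates up to time `t`
and on the rewards observed in the batches before batch `i`. -/
def IsBatchPolicy {d T : ℕ} (M : ℕ) (Γ : ℕ → ℕ) (π : Policy d T) : Prop :=
  (∀ t, Measurable fun h : (Fin T → Cov d) × (Fin T → ℝ) => π t h.1 h.2) ∧
  ∀ i ∈ Finset.Icc 1 M, ∀ t ∈ batch (T := T) Γ i, ∀ (x x' : Fin T → Cov d) (y y' : Fin T → ℝ),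
    (∀ s ≤ t, x s = x' s) → (∀ s : Fin T, s.val < Γ (i - 1) → y s = y' s) →
      π t x y = π t x' y'

/-- The arms `A_t` pulled by the policy `π` when the covariates are `x` and the potential rewards
are `Y`: at time `t` the policy sees the rewards `Y_s^{(A_s)}` of earlier times `s` only (a batch
policy does not even look at those of the current batch). -/
def actions {d T : ℕ} (π : Policy d T) (x : Fin T → Cov d) (Y : Fin T → Arm → ℝ)
    (t : Fin T) : Arm :=
  π t x (fun s => if _h : s < t then Y s (actions π x Y s) else 0)
termination_by t.val

/-- `∑ₜ (f⋆(X_t) - f^{(A_t)}(X_t))`, where `f⋆ = max (f⁽¹⁾, f⁽⁻¹⁾)`. -/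
def regretSum {d T : ℕ} {Ω : Type*} (X : Fin T → Ω → Cov d) (Y : Fin T → Ω → Arm → ℝ)
    (f : Arm → Cov d → ℝ) (π : Policy d T) (ω : Ω) : ℝ :=
  ∑ t, (max (f 1 (X t ω)) (f (-1) (X t ω))
    - f (actions π (fun s => X s ω) (fun s => Y s ω) t) (X t ω))

/-- The expected cumulative regret `R_T(π)`. -/
def regret {d T : ℕ} {Ω : Type*} [MeasurableSpace Ω] (P : Measure Ω)
    (X : Fin T → Ω → Cov d) (Y : Fin T → Ω → Arm → ℝ)
    (f : Arm → Cov d → ℝ) (π : Policy d T) : ℝ :=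
  ∫ ω, regretSum X Y f π ω ∂P

/-! ### The tree of bins -/

/-- The width `w_i = (g₀ ⋯ g_{i-1})⁻¹` of the bins in layer `i`; `w₀ = 1`. -/
def width (g : ℕ → ℕ) (i : ℕ) : ℝ := (∏ l ∈ Finset.range i, (g l : ℝ))⁻¹

/-- A node of the tree: its layer, and the position of its bin in the regular partition of the cube
(counted from `0` in each coordinate). -/
@[ext]
structure Node (d : ℕ) where
  layer : ℕ
  pos : Fin d → ℕ

/-- The set `ℬ_i` of the nodes of layer `i`. -/
def layerNodes (d : ℕ) (g : ℕ → ℕ) (i : ℕ) : Set (Node d) :=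
  {C | C.layer = i ∧ ∀ j, C.pos j < ∏ l ∈ Finset.range i, g l}

/-- The bin of a node. In each coordinate it is half-open, except that the last bin is closed at
`1`, so that the bins of a layer partition the cube. -/
def Node.bin {d : ℕ} (g : ℕ → ℕ) (C : Node d) : Set (Cov d) :=
  {x ∈ unitCube d | ∀ j, (C.pos j : ℝ) * width g C.layer ≤ x j ∧
    (x j < ((C.pos j : ℝ) + 1) * width g C.layer ∨
      (((C.pos j : ℝ) + 1) * width g C.layer = 1 ∧ x j = 1))}

/-- The `gᵈ` children of a node, where `g` is the split factor. -/
def Node.children {d : ℕ} (C : Node d) (g : ℕ) : Set (Node d) :=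
  {C' | C'.layer = C.layer + 1 ∧ ∀ j, C.pos j * g ≤ C'.pos j ∧ C'.pos j < (C.pos j + 1) * g}

/-! ### Batched successive elimination with dynamic binning -/

/-- `U(τ, T, C) = 4 √(log(2 T |C|ᵈ) / τ)` for a bin of width `w = |C|`. -/
def threshold (d : ℕ) (τ : ℝ) (T : ℕ) (w : ℝ) : ℝ :=
  4 * Real.sqrt (Real.log (2 * T * w ^ d) / τ)

open Classical in
/-- The times of batch `i` whose covariate falls in the bin of `C`. -/
def visits {d T : ℕ} (Γ g : ℕ → ℕ) (x : Fin T → Cov d) (i : ℕ) (C : Node d) : Finset (Fin T) :=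
  (batch Γ i).filter fun t => x t ∈ C.bin g

open Classical in
/-- The empirical mean reward of arm `k` in the bin of `C` during batch `i`. -/
def empMean {d T : ℕ} (Γ g : ℕ → ℕ) (x : Fin T → Cov d) (a : Fin T → Arm) (y : Fin T → ℝ)
    (i : ℕ) (C : Node d) (k : Arm) : ℝ :=
  (∑ t ∈ (visits Γ g x i C).filter (fun t => a t = k), y t) /
    (((visits Γ g x i C).filter (fun t => a t = k)).card : ℝ)

open Classical in
/-- The arms of the active set `I` of `C` that remain at the end of batch `i`: if `I` has one arm
nothing happens, otherwise arm `k` is removed if its empirical mean falls more than `U(m_{C,i},T,C)`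
below the largest one. -/
def remaining {d T : ℕ} (Γ g : ℕ → ℕ) (x : Fin T → Cov d) (a : Fin T → Arm) (y : Fin T → ℝ)
    (i : ℕ) (C : Node d) (I : Finset Arm) : Finset Arm :=
  if I.card = 1 then I
  else I.filter fun k => ∀ k' ∈ I,
    empMean Γ g x a y i C k' - empMean Γ g x a y i C k ≤
      threshold d ((visits Γ g x i C).card : ℝ) T (width g C.layer)

/-- The pairs `(C, I_C)`, `C` an active node and `I_C` its set of active arms, after the update at
the end of batch `i` (for `i = 0`: before the first batch), when the covariates are `x`, the pulled
arms `a` and the observed rewards `y`. They are in force during batch `i + 1`. -/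
def activeState {d T : ℕ} (Γ g : ℕ → ℕ) (x : Fin T → Cov d) (a : Fin T → Arm) (y : Fin T → ℝ) :
    ℕ → Set (Node d × Finset Arm)
  | 0 => {q | q.1 ∈ layerNodes d g 1 ∧ q.2 = Finset.univ}
  | i + 1 =>
    {q | ∃ p ∈ activeState Γ g x a y i,
      q.2 = remaining Γ g x a y (i + 1) p.1 p.2 ∧
      ((q.2.card ≤ 1 ∧ q.1 = p.1) ∨ (1 < q.2.card ∧ q.1 ∈ p.1.children (g (i + 1))))}

/-- At the times in `S` the arms of `I` are pulled in a round-robin way: only arms of `I` are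
pulled, and, when `I` contains both arms, they alternate. -/
def RoundRobin {T : ℕ} (I : Finset Arm) (S : Finset (Fin T)) (a : Fin T → Arm) : Prop :=
  (∀ t ∈ S, a t ∈ I) ∧
  (1 < I.card → ∀ s ∈ S, ∀ t ∈ S, s < t → (∀ u ∈ S, ¬ (s < u ∧ u < t)) → a t ≠ a s)

/-- The policy `π` is an implementation of batched successive elimination with dynamic binning with
`M` batches, grid `Γ` and split factors `g`: in each of the first `M - 1` batches the active arms of
each active bin are pulled in a round-robin way, and in the last batch any active arm of the active
bin that contains the covariate is pulled. -/
def IsBaSEDB {d T : ℕ} (M : ℕ) (Γ g : ℕ → ℕ) (π : Policy d T) : Prop :=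
  IsBatchPolicy M Γ π ∧
  ∀ (x : Fin T → Cov d) (y : Fin T → ℝ), (∀ t, x t ∈ unitCube d) →
    (∀ i ∈ Finset.Icc 1 (M - 1), ∀ q ∈ activeState Γ g x (fun t => π t x y) y (i - 1),
      RoundRobin q.2 (visits Γ g x i q.1) (fun t => π t x y)) ∧
    (∀ q ∈ activeState Γ g x (fun t => π t x y) y (M - 1),
      ∀ t ∈ visits Γ g x M q.1, π t x y ∈ q.2)

/-! ### The choice of the grid and of the split factors -/

/-- `γ = β (1 + α) / (2 β + d)`. -/
def gammaExp (d : ℕ) (α β : ℝ) : ℝ := β * (1 + α) / (2 * β + d)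

/-- The exponent `(1 - γ) / (1 - γ^M)`. -/
def rateExp (d : ℕ) (α β : ℝ) (M : ℕ) : ℝ :=
  (1 - gammaExp d α β) / (1 - gammaExp d α β ^ M)

/-- `g₀ = ⌊b^{1/(2β+d)}⌋`, `g_i = ⌊g_{i-1}^γ⌋` for `1 ≤ i ≤ M - 2`, and `g_i = 1` from
`i = M - 1` on (the bins are not split for the last batch). -/
def splitFactor (d : ℕ) (α β b : ℝ) (M : ℕ) : ℕ → ℕ
  | 0 => ⌊b ^ (1 / (2 * β + d))⌋₊
  | i + 1 => if i + 1 ≤ M - 2 then ⌊(splitFactor d α β b M i : ℝ) ^ gammaExp d α β⌋₊ else 1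

/-- The batch sizes are `t_i - t_{i-1} = ⌊l_i w_i^{-(2β+d)} log(T w_i^d)⌋` for `1 ≤ i ≤ M - 1`. -/
def HasBatchSizes (d : ℕ) (β : ℝ) (T M : ℕ) (Γ g : ℕ → ℕ) (l : ℕ → ℝ) : Prop :=
  ∀ i ∈ Finset.Icc 1 (M - 1), (Γ i : ℤ) - (Γ (i - 1) : ℤ) =
    ⌊l i * width g i ^ (-(2 * β + d)) * Real.log (T * width g i ^ d)⌋

/-- `c₀ = 2 L d^{β/2} + 1`. -/
def cZero (d : ℕ) (β L : ℝ) : ℝ := 2 * L * (d : ℝ) ^ (β / 2) + 1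

/-- The calibration of the constants `l_i`: with `m⋆_{C,i} = (t_i - t_{i-1}) P_X(C)`, the threshold
satisfies `U(2 m⋆_{C,i}, T, C) ≥ 2 c₀ |C|^β` for all `1 ≤ i ≤ M - 1` and `C ∈ ℬ_i`. -/
def IsCalibrated {d : ℕ} (β L : ℝ) (T M : ℕ) (Γ g : ℕ → ℕ)
    (μ : Measure (Cov d × (Arm → ℝ))) : Prop :=
  ∀ i ∈ Finset.Icc 1 (M - 1), ∀ C ∈ layerNodes d g i,
    2 * cZero d β L * width g i ^ β ≤
      threshold d (2 * (((Γ i : ℝ) - Γ (i - 1)) * (μ.map Prod.fst).real (C.bin g))) T (width g i)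

end

/-! A covariate z descends through the bins `nodeAt g i z`. Suppose that in each batch its bin is
visited about as often as expected and both empirical means are accurate. Calibration keeps the
threshold above the oscillation of the mean rewards over the bin, and the lower bound on the batch
sizes makes it of order w_i^β. So an eliminated arm is nowhere better on the bin, and if both arms
survive batch i, the gap on the bin is O(w_i^β) (`elimination`). In batch i + 1 regret is thus paid
only where the gap is at most some Δ_i of order w_i^β, and by the margin condition its mean is
O(w_i^{β(1+α)}) per step (`lintegral_clippedGap_le`).

Since γ(2β+d) = β(1+α), the split factors balance this against the batch size: w_{i+1}^{-(2β+d)}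
w_i^{β(1+α)} ≤ b (`width_trade_off`). Each of the first M - 1 batches costs O(b log T), and there
are O(log T) of them. The last batch costs at most a constant times T w_{M-1}^{β(1+α)}. With S = 1 +
γ + ⋯ + γ^{M-2} and ρ the rate exponent, γSρ = 1 - ρ, which turns T into T^ρ. The repeated rounding
loses only a constant factor (`sum_log_ge`), and the lower bound on b loses at most (log T)²
(`last_batch_le`).

Bad events are charged to the covariate rather than excluded by a union bound over bins. If the
first bad batch for z is j + 1, the gap at z was still at most Δ_j, so the clipped gap pays for all
that is lost at z later, whatever the policy then does (`exists_active`). The event involves only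
times before the current one, hence is independent of the current observation, although that
observation selects the bin (`lintegral_selected_le`). The cost per step is p_j times the mean
clipped gap, where p_j = O(w_{j+1}^{-(2β+d)} log T / T); over T steps this is O(b log T) again, by
the same trade-off.

The bound p_j (`measure_badEvent_le`) combines Chernoff bounds for the visits with an exponential
supermartingale for the noise: an arm is chosen from the covariates so far and past rewards, so the
current noise stays centred. The number of pulls is random; a union over the number of visits
handles it, and round-robin gives each arm about half of them. -/

noncomputable section

open scoped ENNReal

/-! ### Resampling and independence in finite product spaces -/

section PiMeasure

variable {ι S : Type*} [Fintype ι] [DecidableEq ι] [MeasurableSpace S]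

/-- Resampling one coordinate preserves a product of copies of a probability measure. -/
theorem measurePreserving_update (μ : Measure S) [IsProbabilityMeasure μ] (t : ι) :
    MeasurePreserving (fun p : (ι → S) × S => Function.update p.1 t p.2)
      ((Measure.pi fun _ : ι => μ).prod μ) (Measure.pi fun _ : ι => μ) := by
  have hm : Measurable (fun p : (ι → S) × S => Function.update p.1 t p.2) := by
    rw [measurable_pi_iff]
    intro i
    by_cases h : i = t
    · subst h; simpa using measurable_snd
    · simp only [Function.update_of_ne h]
      exact (measurable_pi_apply i).comp measurable_fst
  refine ⟨hm, ?_⟩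
  refine (Measure.pi_eq fun s hs => ?_).symm
  rw [Measure.map_apply hm (MeasurableSet.univ_pi hs)]
  have : (fun p : (ι → S) × S => Function.update p.1 t p.2) ⁻¹' (Set.univ.pi s)
      = (Set.univ.pi (Function.update s t Set.univ)) ×ˢ (s t) := by
    ext p
    simp only [Set.mem_preimage, Set.mem_pi, Set.mem_univ, true_implies, Set.mem_prod]
    constructor
    · intro h
      refine ⟨fun i => ?_, by simpa using h t⟩
      by_cases hi : i = t
      · subst hi; simp
      · have := h i
        rw [Function.update_of_ne hi] at this ⊢
        exact this
    · rintro ⟨h1, h2⟩ i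
      by_cases hi : i = t
      · subst hi; simpa using h2
      · have := h1 i
        rw [Function.update_of_ne hi] at this ⊢
        exact this
  rw [this, Measure.prod_prod, Measure.pi_pi, ← Finset.mul_prod_erase _ _ (Finset.mem_univ t),
    ← Finset.mul_prod_erase _ (fun i => μ (s i)) (Finset.mem_univ t)]
  simp only [Function.update_self, measure_univ, one_mul]
  rw [mul_comm]
  congr 1
  refine Finset.prod_congr rfl fun i hi => ?_
  rw [Function.update_of_ne (Finset.ne_of_mem_erase hi)]

theorem lintegral_resample (μ : Measure S) [IsProbabilityMeasure μ] (t : ι)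
    {F : (ι → S) → ℝ≥0∞} (hF : Measurable F) :
    ∫⁻ w, F w ∂(Measure.pi fun _ : ι => μ)
      = ∫⁻ w, ∫⁻ v, F (Function.update w t v) ∂μ ∂(Measure.pi fun _ : ι => μ) := by
  have h := measurePreserving_update (ι := ι) μ t
  rw [← h.lintegral_comp hF]
  exact lintegral_prod _ (hF.comp h.measurable).aemeasurable

/-- If each factor depends only on the coordinates up to its index, and has integral at most `c`
over its last coordinate, then the product of the factors has integral at most `c ^ n`. -/
theorem lintegral_prod_le_of_adapted {T : ℕ} (μ : Measure S) [IsProbabilityMeasure μ]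
    (φ : Fin T → (Fin T → S) → ℝ≥0∞) (hφ : ∀ t, Measurable (φ t))
    (hdep : ∀ s t, s < t → ∀ w v, φ s (Function.update w t v) = φ s w)
    (c : ℝ≥0∞) (B : Finset (Fin T))
    (hstep : ∀ t ∈ B, ∀ w, ∫⁻ v, φ t (Function.update w t v) ∂μ ≤ c) :
    ∫⁻ w, ∏ t ∈ B, φ t w ∂(Measure.pi fun _ : Fin T => μ) ≤ c ^ B.card := by
  -- The last coordinate is integrated out first: the factors with smaller index do not see it, so
  -- they come out of the inner integral.
  induction B using Finset.induction_on_max with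
  | empty => simp
  | insert t B hlt ih =>
    have hnot : t ∉ B := fun h => lt_irrefl _ (hlt t h)
    rw [lintegral_resample μ t (Finset.measurable_prod _ fun s _ => hφ s),
      Finset.card_insert_of_notMem hnot, pow_succ]
    calc _ ≤ ∫⁻ w, (∏ s ∈ B, φ s w) * c ∂(Measure.pi fun _ : Fin T => μ) := by
          refine lintegral_mono fun w => ?_
          have : ∀ v, ∏ s ∈ insert t B, φ s (Function.update w t v)
              = (∏ s ∈ B, φ s w) * φ t (Function.update w t v) := by
            intro v
            rw [Finset.prod_insert hnot, mul_comm]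
            congr 1
            exact Finset.prod_congr rfl fun s hs => hdep s t (hlt s hs) w v
          simp only [this]
          rw [lintegral_const_mul]
          · exact mul_le_mul_right (hstep t (Finset.mem_insert_self _ _) w) _
          · exact (hφ t).comp (measurable_update w)
      _ = (∫⁻ w, (∏ s ∈ B, φ s w) ∂(Measure.pi fun _ : Fin T => μ)) * c :=
          lintegral_mul_const _ (Finset.measurable_prod _ fun s _ => hφ s)
      _ ≤ _ := mul_le_mul_left (ih fun s hs => hstep s (Finset.mem_insert_of_mem hs)) _

/-- An event that is unaffected by resampling coordinate `t` is independent of this coordinate,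
also when the event is selected by the value of the coordinate. -/
theorem lintegral_selected_le (μ : Measure S) [IsProbabilityMeasure μ] (t : ι)
    {h : S → ℝ≥0∞} (hh : Measurable h) (E : Set ((ι → S) × S)) (hE : MeasurableSet E)
    (hdep : ∀ w u v, (Function.update w t u, v) ∈ E ↔ (w, v) ∈ E) (p : ℝ≥0∞)
    (hp : ∀ v, (Measure.pi fun _ : ι => μ) {w | (w, v) ∈ E} ≤ p) :
    ∫⁻ w, h (w t) * E.indicator 1 (w, w t) ∂(Measure.pi fun _ : ι => μ)
      ≤ p * ∫⁻ v, h v ∂μ := by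
  have hm1 : Measurable fun w : ι → S => h (w t) * E.indicator (1 : (ι → S) × S → ℝ≥0∞) (w, w t) := by
    refine (hh.comp (measurable_pi_apply t)).mul ?_
    exact (measurable_one.indicator hE).comp (measurable_id.prodMk (measurable_pi_apply t))
  rw [lintegral_resample μ t hm1]
  have : ∀ w v, h (Function.update w t v t) *
      E.indicator (1 : (ι → S) × S → ℝ≥0∞) (Function.update w t v, Function.update w t v t)
      = h v * E.indicator (1 : (ι → S) × S → ℝ≥0∞) (w, v) := by
    intro w v
    rw [Function.update_self]
    congr 1
    by_cases hw : (w, v) ∈ E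
    · rw [Set.indicator_of_mem hw, Set.indicator_of_mem ((hdep w v v).2 hw)]; rfl
    · rw [Set.indicator_of_notMem hw, Set.indicator_of_notMem (fun hc => hw ((hdep w v v).1 hc))]
  simp only [this]
  rw [lintegral_lintegral_swap]
  · rw [← lintegral_const_mul _ hh]
    refine lintegral_mono fun v => ?_
    rw [lintegral_const_mul, mul_comm]
    · refine mul_le_mul_left ?_ _
      refine le_trans (le_of_eq ?_) (hp v)
      have hmv : MeasurableSet {w | (w, v) ∈ E} := hE.preimage measurable_prodMk_right
      rw [← lintegral_indicator_one hmv]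
      rfl
    · exact (measurable_one.indicator hE).comp measurable_prodMk_right
  · exact ((hh.comp measurable_snd).mul (measurable_one.indicator hE)).aemeasurable

end PiMeasure

/-! ### Exponential moments of the rewards -/

/-- The moment generating function of a centred Bernoulli variable. -/
theorem bernoulli_mgf_le {p : ℝ} (hp : p ∈ Set.Icc (0 : ℝ) 1) (lam : ℝ) :
    Real.exp (-lam * p) * (1 + p * (Real.exp lam - 1)) ≤ Real.exp (lam ^ 2 / 8) := by
  -- The Bernoulli law as a measure on ℝ, so that Hoeffding's lemma for `[0,1]`-valued variables
  -- applies; its variance proxy 1/4 gives the 1/8.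
  set ρ : Measure ℝ := ENNReal.ofReal p • Measure.dirac 1 + ENNReal.ofReal (1 - p) • Measure.dirac 0
    with hρ
  have h1p : 0 ≤ 1 - p := by linarith [hp.2]
  have : IsProbabilityMeasure ρ := ⟨by
    simp only [hρ, Measure.add_apply, Measure.smul_apply, measure_univ, smul_eq_mul, mul_one]
    rw [← ENNReal.ofReal_add hp.1 h1p]; simp⟩
  have hint : ∀ F : ℝ → ℝ, ∫ x, F x ∂ρ = p * F 1 + (1 - p) * F 0 := by
    intro F
    rw [hρ, integral_add_measure, integral_smul_measure, integral_smul_measure]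
    · simp [hp.1, h1p]
    · exact (integrable_dirac (by simp)).smul_measure (by simp)
    · exact (integrable_dirac (by simp)).smul_measure (by simp)
  have hb : ∀ᵐ x ∂ρ, (id x : ℝ) ∈ Set.Icc (0 : ℝ) 1 := by
    rw [hρ, ae_add_measure_iff]
    constructor <;> refine Measure.ae_smul_measure ?_ _ <;>
      simp
  have key := (hasSubgaussianMGF_of_mem_Icc (X := id) (μ := ρ) aemeasurable_id hb).mgf_le lam
  simp only [mgf, hint, id] at key
  have e1 : Real.exp (-lam * p) * (1 + p * (Real.exp lam - 1))
      = p * Real.exp (lam * (1 - (p * 1 + (1 - p) * 0)))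
        + (1 - p) * Real.exp (lam * (0 - (p * 1 + (1 - p) * 0))) := by
    have : lam * (1 - (p * 1 + (1 - p) * 0)) = -lam * p + lam := by ring
    rw [this, Real.exp_add]
    have : lam * (0 - (p * 1 + (1 - p) * 0)) = -lam * p := by ring
    rw [this]; ring
  rw [e1]
  refine key.trans (le_of_eq ?_)
  congr 1
  simp
  ring

/-- One step of the exponential supermartingale: only the covariate decides whether the reward
is looked at. -/
theorem lintegral_exp_indicator_le {d : ℕ} {μ : Measure (Cov d × (Arm → ℝ))}
    [IsProbabilityMeasure μ] {k : Arm} {f : Cov d → ℝ} (hf : Measurable f)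
    (hf01 : ∀ x, f x ∈ Set.Icc (0 : ℝ) 1)
    (hy : ∀ᵐ z ∂μ, z.2 k ∈ Set.Icc (0 : ℝ) 1)
    (hmean : μ[fun z : Cov d × (Arm → ℝ) => z.2 k | MeasurableSpace.comap Prod.fst inferInstance]
      =ᵐ[μ] fun z => f z.1)
    {A : Set (Cov d)} (hA : MeasurableSet A) (lam : ℝ) :
    ∫⁻ v, ENNReal.ofReal (Real.exp (A.indicator 1 v.1 * (lam * (v.2 k - f v.1) - lam ^ 2 / 8))) ∂μ
      ≤ 1 := by
  have hmy : Measurable fun z : Cov d × (Arm → ℝ) => z.2 k :=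
    (measurable_pi_apply k).comp measurable_snd
  have hyint : Integrable (fun z : Cov d × (Arm → ℝ) => z.2 k) μ := by
    refine Integrable.of_bound hmy.aestronglyMeasurable 1 ?_
    filter_upwards [hy] with z hz
    rw [Real.norm_eq_abs, abs_of_nonneg hz.1]; exact hz.2
  -- the pull-out property
  set G : Cov d → ℝ := fun x =>
    A.indicator 1 x * (Real.exp (-lam * f x) * (Real.exp lam - 1)) with hG
  have hGm : Measurable G :=
    (measurable_one.indicator hA).mul ((((hf.const_mul (-lam)).exp)).mul_const _)
  have hGb : ∀ x, |G x| ≤ Real.exp |lam| * |Real.exp lam - 1| := by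
    intro x
    simp only [hG, abs_mul, Real.abs_exp]
    have h1 : |A.indicator (1 : Cov d → ℝ) x| ≤ 1 := by
      by_cases hx : x ∈ A <;> simp [hx]
    have h2 : Real.exp (-lam * f x) ≤ Real.exp |lam| := by
      refine Real.exp_le_exp.2 ?_
      have := neg_abs_le lam
      have := abs_nonneg lam
      nlinarith [(hf01 x).1, (hf01 x).2]
    calc _ ≤ 1 * (Real.exp |lam| * |Real.exp lam - 1|) := by gcongr
      _ = _ := one_mul _
  have hpull : ∫ z, G z.1 * z.2 k ∂μ = ∫ z, G z.1 * f z.1 ∂μ := by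
    have hm : MeasurableSpace.comap Prod.fst inferInstance
        ≤ (inferInstance : MeasurableSpace (Cov d × (Arm → ℝ))) := measurable_fst.comap_le
    have hGs : StronglyMeasurable[MeasurableSpace.comap Prod.fst inferInstance]
        fun z : Cov d × (Arm → ℝ) => G z.1 :=
      (hGm.comp (comap_measurable _)).stronglyMeasurable
    have := condExp_stronglyMeasurable_mul_of_bound hm hGs hyint
      (Real.exp |lam| * |Real.exp lam - 1|) (Filter.Eventually.of_forall fun z => hGb z.1)
    rw [← integral_condExp hm]
    refine integral_congr_ae ?_
    filter_upwards [this, hmean] with z h1 h2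
    have h1' := h1
    simp only [Pi.mul_apply] at h1'
    rw [show (fun z : Cov d × (Arm → ℝ) => G z.1 * z.2 k)
      = (fun z : Cov d × (Arm → ℝ) => G z.1) * (fun z => z.2 k) from rfl, h1', h2]
  have hind : ∀ x, A.indicator (1 : Cov d → ℝ) x ∈ Set.Icc (0 : ℝ) 1 := by
    intro x; by_cases hx : x ∈ A <;> simp [hx]
  have hFm : Measurable fun v : Cov d × (Arm → ℝ) =>
      Real.exp (A.indicator 1 v.1 * (lam * (v.2 k - f v.1) - lam ^ 2 / 8)) := by
    refine Measurable.exp (((measurable_one.indicator hA).comp measurable_fst).mul ?_)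
    exact ((hmy.sub (hf.comp measurable_fst)).const_mul _).sub_const _
  -- `H` is the part of the bound `hbound` free of the reward, and `G` is, up to the factor
  -- exp(-lam²/8), the coefficient of the reward.
  set H : Cov d → ℝ := fun x => (1 - A.indicator 1 x)
    + A.indicator 1 x * (Real.exp (-lam * f x) * Real.exp (-(lam ^ 2 / 8))) with hH
  have hHm : Measurable H := by
    refine (measurable_const.sub (measurable_one.indicator hA)).add
      ((measurable_one.indicator hA).mul ((hf.const_mul (-lam)).exp.mul_const _))
  have hHb : ∀ x, |H x| ≤ 1 + Real.exp |lam| := by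
    intro x
    have h2 : Real.exp (-lam * f x) ≤ Real.exp |lam| := by
      refine Real.exp_le_exp.2 ?_
      have := neg_abs_le lam
      have := abs_nonneg lam
      nlinarith [(hf01 x).1, (hf01 x).2]
    have h3 : Real.exp (-(lam ^ 2 / 8)) ≤ 1 := Real.exp_le_one_iff.2 (by nlinarith [sq_nonneg lam])
    have h4 : Real.exp (-lam * f x) * Real.exp (-(lam ^ 2 / 8)) ≤ Real.exp |lam| :=
      (mul_le_of_le_one_right (Real.exp_pos _).le h3).trans h2
    have h5 : 0 ≤ Real.exp (-lam * f x) * Real.exp (-(lam ^ 2 / 8)) := by positivity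
    rw [abs_le]
    by_cases hx : x ∈ A
    · simp only [hH, hx, Set.indicator_of_mem, Pi.one_apply]
      constructor <;> nlinarith [Real.exp_pos |lam|]
    · simp only [hH, hx, Set.indicator_of_notMem, not_false_eq_true]
      constructor <;> nlinarith [Real.exp_pos |lam|]
  have hHi : Integrable (fun z : Cov d × (Arm → ℝ) => H z.1) μ :=
    Integrable.of_bound (hHm.comp measurable_fst).aestronglyMeasurable _
      (Filter.Eventually.of_forall fun z => hHb z.1)
  have hGyi : Integrable (fun z : Cov d × (Arm → ℝ) => G z.1 * z.2 k) μ :=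
    hyint.bdd_mul (c := Real.exp |lam| * |Real.exp lam - 1|)
      (hGm.comp measurable_fst).aestronglyMeasurable (Filter.Eventually.of_forall fun z => hGb z.1)
  have hGfi : Integrable (fun z : Cov d × (Arm → ℝ) => G z.1 * f z.1) μ := by
    refine Integrable.of_bound ((hGm.mul hf).comp measurable_fst).aestronglyMeasurable
      (Real.exp |lam| * |Real.exp lam - 1|) (Filter.Eventually.of_forall fun z => ?_)
    rw [Real.norm_eq_abs, abs_mul]
    have : |f z.1| ≤ 1 := by rw [abs_of_nonneg (hf01 _).1]; exact (hf01 _).2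
    exact (mul_le_of_le_one_right (abs_nonneg _) this).trans (hGb z.1)
  -- The chord of exp on [0, lam] majorises it by a function affine in the reward. Only the
  -- conditional mean then matters, which reduces the claim to a Bernoulli reward.
  have hbound : ∀ᵐ v ∂μ, Real.exp (A.indicator 1 v.1 * (lam * (v.2 k - f v.1) - lam ^ 2 / 8))
      ≤ H v.1 + Real.exp (-(lam ^ 2 / 8)) * (G v.1 * v.2 k) := by
    filter_upwards [hy] with v hv
    by_cases hx : v.1 ∈ A
    · simp only [hH, hG, hx, Set.indicator_of_mem, Pi.one_apply, one_mul, sub_self, zero_add]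
      have hconv : Real.exp (lam * v.2 k) ≤ 1 + v.2 k * (Real.exp lam - 1) := by
        have := convexOn_exp.2 (Set.mem_univ (0:ℝ)) (Set.mem_univ lam)
          (sub_nonneg.2 hv.2) hv.1 (by ring)
        simp only [smul_eq_mul, mul_zero, zero_add, Real.exp_zero, mul_one] at this
        rw [mul_comm lam]; linarith
      have : lam * (v.2 k - f v.1) - lam ^ 2 / 8
          = lam * v.2 k + (-lam * f v.1) + (-(lam ^ 2 / 8)) := by ring
      rw [this, Real.exp_add, Real.exp_add]
      have h5 : 0 ≤ Real.exp (-lam * f v.1) * Real.exp (-(lam ^ 2 / 8)) := by positivity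
      nlinarith
    · simp [hH, hG, hx]
  rw [← ofReal_integral_eq_lintegral_ofReal, ← ENNReal.ofReal_one]
  · refine ENNReal.ofReal_le_ofReal ?_
    calc _ ≤ ∫ v, (H v.1 + Real.exp (-(lam ^ 2 / 8)) * (G v.1 * v.2 k)) ∂μ := by
          refine integral_mono_of_nonneg (Filter.Eventually.of_forall fun v => (Real.exp_pos _).le)
            (hHi.add (hGyi.const_mul _)) hbound
      _ = ∫ v, (H v.1 + Real.exp (-(lam ^ 2 / 8)) * (G v.1 * f v.1)) ∂μ := by
          rw [integral_add hHi (hGyi.const_mul _), integral_add hHi (hGfi.const_mul _),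
            integral_const_mul, integral_const_mul, hpull]
      _ ≤ ∫ v, (1 : ℝ) ∂μ := by
          refine integral_mono (hHi.add (hGfi.const_mul _)) (integrable_const _) fun v => ?_
          by_cases hx : v.1 ∈ A
          · simp only [hH, hG, hx, Set.indicator_of_mem, Pi.one_apply, one_mul, sub_self, zero_add]
            have h1 := bernoulli_mgf_le (hf01 v.1) lam
            have h2 : Real.exp (-(lam ^ 2 / 8)) * Real.exp (lam ^ 2 / 8) = 1 := by
              rw [← Real.exp_add]; simp
            calc _ = Real.exp (-(lam ^ 2 / 8)) *
                  (Real.exp (-lam * f v.1) * (1 + f v.1 * (Real.exp lam - 1))) := by ring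
              _ ≤ Real.exp (-(lam ^ 2 / 8)) * Real.exp (lam ^ 2 / 8) := by gcongr
              _ = 1 := h2
          · simp [hH, hG, hx]
      _ = 1 := by simp
  · refine (hHi.add (hGyi.const_mul (Real.exp (-(lam ^ 2 / 8))))).mono'
      hFm.aestronglyMeasurable ?_
    filter_upwards [hbound] with v hv
    rw [Real.norm_eq_abs, Real.abs_exp]; exact hv
  · exact Filter.Eventually.of_forall fun v => (Real.exp_pos _).le

/-! ### The arms pulled along a sample path -/

/-- One observation: a covariate and the potential rewards of the two arms. -/
abbrev Obs (d : ℕ) : Type := Cov d × (Arm → ℝ)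

/-- The arms pulled along the sample path `w`. -/
def pulled {d T : ℕ} (π : Policy d T) (w : Fin T → Obs d) (t : Fin T) : Arm :=
  actions π (fun s => (w s).1) (fun s => (w s).2) t

/-- The rewards observed along the sample path `w`. -/
def observed {d T : ℕ} (π : Policy d T) (w : Fin T → Obs d) (t : Fin T) : ℝ :=
  (w t).2 (pulled π w t)

instance : MeasurableSingletonClass Arm := ⟨fun k => by
  have : ({k} : Set Arm) = (fun u : Arm => (u : ℤ)) ⁻¹' {(k : ℤ)} := by
    ext u; simp [Units.ext_iff]
  rw [this]
  exact (measurableSet_singleton _).preimage (comap_measurable _)⟩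

theorem IsGrid.le_of_le {T M : ℕ} {Γ : ℕ → ℕ} (h : IsGrid T M Γ) {i j : ℕ} (hij : i ≤ j)
    (hj : j ≤ M) : Γ i ≤ Γ j := by
  induction j, hij using Nat.le_induction with
  | base => exact le_rfl
  | succ j _ ih => exact (ih (by omega)).trans (h.2.2 j (by omega)).le

theorem IsGrid.exists_mem_batch {T M : ℕ} {Γ : ℕ → ℕ} (h : IsGrid T M Γ) (t : Fin T) :
    ∃ i ∈ Finset.Icc 1 M, t ∈ batch (T := T) Γ i := by
  have hex : ∃ i, t.val < Γ i := ⟨M, by rw [h.2.1]; exact t.2⟩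
  classical
  set i := Nat.find hex
  have h1 : t.val < Γ i := Nat.find_spec hex
  have h0 : i ≠ 0 := by
    intro h0; rw [h0, h.1] at h1; omega
  refine ⟨i, Finset.mem_Icc.2 ⟨by omega, Nat.find_min' hex (by rw [h.2.1]; exact t.2)⟩, ?_⟩
  refine Finset.mem_filter.2 ⟨Finset.mem_univ _, ?_, h1⟩
  exact not_lt.1 (Nat.find_min hex (m := i - 1) (by omega))

section

variable {d T M : ℕ} {Γ : ℕ → ℕ} {π : Policy d T}

theorem actions_congr (hΓ : IsGrid T M Γ) (hπ : IsBatchPolicy M Γ π) {x x' : Fin T → Cov d}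
    {Y Y' : Fin T → Arm → ℝ} (t : Fin T) (hx : ∀ s ≤ t, x s = x' s) (hY : ∀ s < t, Y s = Y' s) :
    actions π x Y t = actions π x' Y' t := by
  induction t using WellFoundedLT.induction with
  | ind t ih =>
    rw [actions, actions]
    obtain ⟨i, hi, hti⟩ := hΓ.exists_mem_batch t
    refine hπ.2 i hi t hti _ _ _ _ hx fun s _ => ?_
    by_cases hs : s < t
    · simp only [hs, dite_true]
      rw [hY s hs, ih s hs (fun u hu => hx u (hu.trans hs.le)) (fun u hu => hY u (hu.trans hs))]
    · simp only [hs, dite_false]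

/-- Predictability: the covariate of time `t` may influence the arm, but its potential rewards may
not. This keeps the noise centred at the pulled arm. -/
theorem pulled_congr (hΓ : IsGrid T M Γ) (hπ : IsBatchPolicy M Γ π) {w w' : Fin T → Obs d}
    (t : Fin T) (hw : ∀ s < t, w s = w' s) (ht : (w t).1 = (w' t).1) :
    pulled π w t = pulled π w' t := by
  refine actions_congr hΓ hπ t (fun s hs => ?_) fun s hs => by rw [hw s hs]
  rcases hs.lt_or_eq with h | h
  · rw [hw s h]
  · rw [h, ht]

theorem pulled_update (hΓ : IsGrid T M Γ) (hπ : IsBatchPolicy M Γ π) (w : Fin T → Obs d)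
    {s t : Fin T} (hst : s < t) (v : Obs d) :
    pulled π (Function.update w t v) s = pulled π w s := by
  refine pulled_congr hΓ hπ s (fun u hu => ?_) ?_
  · rw [Function.update_of_ne (hu.trans hst).ne]
  · rw [Function.update_of_ne hst.ne]

/-- The pulled arms are those that the policy selects given all observed rewards. -/
theorem pulled_eq (hΓ : IsGrid T M Γ) (hπ : IsBatchPolicy M Γ π) (w : Fin T → Obs d)
    (t : Fin T) : pulled π w t = π t (fun s => (w s).1) (observed π w) := by
  rw [pulled, actions]
  obtain ⟨i, hi, hti⟩ := hΓ.exists_mem_batch t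
  refine hπ.2 i hi t hti _ _ _ _ (fun _ _ => rfl) fun s hs => ?_
  have : s < t := Fin.lt_def.2 (lt_of_lt_of_le hs (Finset.mem_filter.1 hti).2.1)
  simp only [this, dite_true]
  rfl

theorem measurable_pulled (hπ : IsBatchPolicy M Γ π) (t : Fin T) :
    Measurable fun w : Fin T → Obs d => pulled π w t := by
  induction t using WellFoundedLT.induction with
  | ind t ih =>
    have : (fun w : Fin T → Obs d => pulled π w t) =
        (fun h : (Fin T → Cov d) × (Fin T → ℝ) => π t h.1 h.2) ∘
        fun w : Fin T → Obs d => (fun s => (w s).1,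
          fun s => if s < t then (w s).2 (pulled π w s) else 0) := by
      funext w
      simp only [pulled, Function.comp]
      rw [actions]
      rfl
    rw [this]
    refine (hπ.1 t).comp (Measurable.prodMk ?_ ?_)
    · exact measurable_pi_lambda _ fun s => (measurable_pi_apply s).fst
    · refine measurable_pi_lambda _ fun s => ?_
      by_cases hs : s < t
      · simp only [hs, if_true]
        -- A reward at a random arm is written as a finite sum over arms, to which measurability of
        -- the arm applies.
        have h2 : (fun w : Fin T → Obs d => (w s).2 (pulled π w s))
            = fun w => ∑ k : Arm, ({k} : Set Arm).indicator 1 (pulled π w s) * (w s).2 k := by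
          funext w
          rw [Finset.sum_eq_single (pulled π w s)]
          · simp
          · intro k _ hk; simp [Ne.symm hk]
          · exact fun h => absurd (Finset.mem_univ _) h
        rw [h2]
        refine Finset.measurable_sum _ fun k _ => Measurable.mul ?_ ?_
        · exact (measurable_one.indicator (measurableSet_singleton k)).comp (ih s hs)
        · exact (measurable_pi_apply k).comp (measurable_pi_apply s).snd
      · simp only [hs, if_false]
        exact measurable_const

end

/-! ### Concentration in one bin during one batch -/

section Concentration

variable {d T M : ℕ} {Γ : ℕ → ℕ} {π : Policy d T}

/-- The number of visits to `S` at the times in `B`. -/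
def visitCount (B : Finset (Fin T)) (S : Set (Cov d)) (w : Fin T → Obs d) : ℝ :=
  ∑ t ∈ B, S.indicator 1 (w t).1

/-- Whether at time `t` the set `S` is visited and arm `k` is pulled. -/
def pullInd (π : Policy d T) (S : Set (Cov d)) (k : Arm) (w : Fin T → Obs d) (t : Fin T) : ℝ :=
  S.indicator 1 (w t).1 * ({k} : Set Arm).indicator 1 (pulled π w t)

/-- The number of pulls of arm `k` on visits to `S` at the times in `B`. -/
def pullCount (π : Policy d T) (B : Finset (Fin T)) (S : Set (Cov d)) (k : Arm)
    (w : Fin T → Obs d) : ℝ :=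
  ∑ t ∈ B, pullInd π S k w t

/-- The sum of the noise terms of these pulls. -/
def noiseSum (π : Policy d T) (f : Arm → Cov d → ℝ) (B : Finset (Fin T)) (S : Set (Cov d))
    (k : Arm) (w : Fin T → Obs d) : ℝ :=
  ∑ t ∈ B, pullInd π S k w t * ((w t).2 k - f k (w t).1)

theorem measurable_visitCount (B : Finset (Fin T)) {S : Set (Cov d)} (hS : MeasurableSet S) :
    Measurable (visitCount B S) :=
  Finset.measurable_sum _ fun t _ =>
    (measurable_one.indicator hS).comp (measurable_pi_apply t).fst

theorem measurable_pullInd (hπ : IsBatchPolicy M Γ π) {S : Set (Cov d)} (hS : MeasurableSet S)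
    (k : Arm) (t : Fin T) : Measurable fun w => pullInd π S k w t :=
  ((measurable_one.indicator hS).comp (measurable_pi_apply t).fst).mul
    ((measurable_one.indicator (measurableSet_singleton k)).comp (measurable_pulled hπ t))

theorem measurable_pullCount (hπ : IsBatchPolicy M Γ π) (B : Finset (Fin T)) {S : Set (Cov d)}
    (hS : MeasurableSet S) (k : Arm) : Measurable (pullCount π B S k) :=
  Finset.measurable_sum _ fun t _ => measurable_pullInd hπ hS k t

theorem measurable_noiseSum (hπ : IsBatchPolicy M Γ π) {f : Arm → Cov d → ℝ}
    (hf : ∀ k, Measurable (f k)) (B : Finset (Fin T)) {S : Set (Cov d)} (hS : MeasurableSet S)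
    (k : Arm) : Measurable (noiseSum π f B S k) :=
  Finset.measurable_sum _ fun t _ => by
    have h1 : Measurable fun w : Fin T → Obs d => (w t).2 k :=
      (measurable_pi_apply k).comp (measurable_pi_apply t).snd
    exact (measurable_pullInd hπ hS k t).mul (h1.sub ((hf k).comp (measurable_pi_apply t).fst))

theorem pullInd_nonneg (S : Set (Cov d)) (k : Arm) (w : Fin T → Obs d) (t : Fin T) :
    0 ≤ pullInd π S k w t :=
  mul_nonneg (Set.indicator_nonneg (fun _ _ => zero_le_one) _)
    (Set.indicator_nonneg (fun _ _ => zero_le_one) _)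

theorem pullCount_nonneg (B : Finset (Fin T)) (S : Set (Cov d)) (k : Arm) (w : Fin T → Obs d) :
    0 ≤ pullCount π B S k w :=
  Finset.sum_nonneg fun t _ => pullInd_nonneg S k w t

theorem pullCount_add (B : Finset (Fin T)) (S : Set (Cov d)) (w : Fin T → Obs d) :
    pullCount π B S 1 w + pullCount π B S (-1) w = visitCount B S w := by
  rw [pullCount, pullCount, visitCount, ← Finset.sum_add_distrib]
  refine Finset.sum_congr rfl fun t _ => ?_
  rw [pullInd, pullInd, ← mul_add]
  rcases Int.units_eq_one_or (pulled π w t) with h | h <;> rw [h] <;> simp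

theorem pullInd_update (hΓ : IsGrid T M Γ) (hπ : IsBatchPolicy M Γ π) (w : Fin T → Obs d)
    {s t : Fin T} (hst : s < t) (v : Obs d) (S : Set (Cov d)) (k : Arm) :
    pullInd π S k (Function.update w t v) s = pullInd π S k w s := by
  rw [pullInd, pullInd, pulled_update hΓ hπ w hst, Function.update_of_ne hst.ne]

/-- Chernoff's bound: Markov's inequality for the exponential of `Z`. -/
theorem measure_le_of_lintegral_exp_le {A : Type*} [MeasurableSpace A] {ν : Measure A} {Z : A → ℝ}
    (hZ : Measurable Z) {c : ℝ}
    (h : ∫⁻ w, ENNReal.ofReal (Real.exp (Z w)) ∂ν ≤ ENNReal.ofReal c) (a : ℝ) :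
    ν {w | a ≤ Z w} ≤ ENNReal.ofReal (c * Real.exp (-a)) := by
  have h1 := mul_meas_ge_le_lintegral (μ := ν) (hZ.exp.ennreal_ofReal)
    (ENNReal.ofReal (Real.exp a))
  have h2 : {w | a ≤ Z w} ⊆
      {w | ENNReal.ofReal (Real.exp a) ≤ ENNReal.ofReal (Real.exp (Z w))} := fun w hw =>
    ENNReal.ofReal_le_ofReal (Real.exp_le_exp.2 hw)
  have h3 : ENNReal.ofReal (Real.exp (-a)) * ENNReal.ofReal (Real.exp a) = 1 := by
    rw [← ENNReal.ofReal_mul (Real.exp_pos _).le, ← Real.exp_add]; simp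
  calc ν {w | a ≤ Z w} = ENNReal.ofReal (Real.exp (-a)) *
        (ENNReal.ofReal (Real.exp a) * ν {w | a ≤ Z w}) := by rw [← mul_assoc, h3, one_mul]
    _ ≤ ENNReal.ofReal (Real.exp (-a)) * ENNReal.ofReal c := by
        refine mul_le_mul_right (le_trans ?_ (h1.trans h)) _
        exact mul_le_mul_right (measure_mono h2) _
    _ = _ := by rw [← ENNReal.ofReal_mul (Real.exp_pos _).le, mul_comm]

variable {μ : Measure (Obs d)} [IsProbabilityMeasure μ]

theorem prod_ofReal_exp {A : Type*} (B : Finset A) (z : A → ℝ) :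
    ∏ t ∈ B, ENNReal.ofReal (Real.exp (z t)) = ENNReal.ofReal (Real.exp (∑ t ∈ B, z t)) := by
  rw [Real.exp_sum, ENNReal.ofReal_prod_of_nonneg fun _ _ => (Real.exp_pos _).le]

/-- The visits are independent Bernoulli variables with parameter p = P_X(S), and 1 + p(e^θ - 1) ≤
exp(p(e^θ - 1)). -/
theorem lintegral_exp_visitCount_le (B : Finset (Fin T)) {S : Set (Cov d)} (hS : MeasurableSet S)
    (θ : ℝ) :
    ∫⁻ w, ENNReal.ofReal (Real.exp (θ * visitCount B S w)) ∂(Measure.pi fun _ : Fin T => μ)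
      ≤ ENNReal.ofReal (Real.exp (B.card * (μ.map Prod.fst).real S * (Real.exp θ - 1))) := by
  set p := (μ.map Prod.fst).real S with hp
  have hmS : Measurable fun v : Obs d => S.indicator (1 : Cov d → ℝ) v.1 :=
    (measurable_one.indicator hS).comp measurable_fst
  have key := lintegral_prod_le_of_adapted μ
    (fun t w => ENNReal.ofReal (Real.exp (θ * S.indicator 1 (w t).1)))
    (fun t => (((hmS.comp (measurable_pi_apply t)).const_mul θ).exp).ennreal_ofReal)
    (fun s t hst w v => by rw [Function.update_of_ne hst.ne])
    (ENNReal.ofReal (Real.exp (p * (Real.exp θ - 1)))) B (fun t _ w => by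
      simp only [Function.update_self]
      have hpt : ∀ v : Obs d, Real.exp (θ * S.indicator 1 v.1)
          = 1 + (Real.exp θ - 1) * (Prod.fst ⁻¹' S).indicator 1 v := by
        intro v
        by_cases hv : v.1 ∈ S
        · rw [Set.indicator_of_mem hv, Set.indicator_of_mem (by exact hv)]; simp
        · rw [Set.indicator_of_notMem hv, Set.indicator_of_notMem (by exact hv)]; simp
      have hSm : MeasurableSet ((Prod.fst : Obs d → Cov d) ⁻¹' S) := hS.preimage measurable_fst
      have hi : Integrable (fun v : Obs d => ((Prod.fst : Obs d → Cov d) ⁻¹' S).indicator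
          (1 : Obs d → ℝ) v) μ := (integrable_const (1 : ℝ)).indicator hSm
      have hii : Integrable (fun v : Obs d => 1 + (Real.exp θ - 1) *
          ((Prod.fst : Obs d → Cov d) ⁻¹' S).indicator (1 : Obs d → ℝ) v) μ :=
        (integrable_const _).add (hi.const_mul _)
      rw [← ofReal_integral_eq_lintegral_ofReal]
      · refine ENNReal.ofReal_le_ofReal ?_
        simp only [hpt]
        rw [integral_add (integrable_const _) (hi.const_mul _), integral_const_mul,
          integral_indicator_one hSm]
        have : μ.real ((Prod.fst : Obs d → Cov d) ⁻¹' S) = p := by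
          rw [hp, Measure.real, Measure.real, Measure.map_apply measurable_fst hS]
        rw [this]
        simp only [integral_const, probReal_univ, smul_eq_mul, mul_one]
        have := Real.add_one_le_exp (p * (Real.exp θ - 1))
        linarith
      · simp only [hpt]; exact hii
      · exact Filter.Eventually.of_forall fun v => (Real.exp_pos _).le)
  simp only [prod_ofReal_exp, ← Finset.mul_sum] at key
  refine key.trans (le_of_eq ?_)
  rw [← ENNReal.ofReal_pow (Real.exp_pos _).le, ← Real.exp_nat_mul]
  congr 2; ring

/-- Given the past, the covariate alone decides whether the reward of arm `k` counts, so each factor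
has integral at most 1. The penalty has to contain the random `pullCount`, since the arms are chosen
adaptively. -/
theorem lintegral_exp_noiseSum_le (hΓ : IsGrid T M Γ) (hπ : IsBatchPolicy M Γ π)
    {f : Arm → Cov d → ℝ} (hf : ∀ k, Measurable (f k)) (hf01 : ∀ k x, f k x ∈ Set.Icc (0 : ℝ) 1)
    (hy : ∀ᵐ z ∂μ, ∀ k, z.2 k ∈ Set.Icc (0 : ℝ) 1)
    (hmean : ∀ k, μ[fun z : Obs d => z.2 k | MeasurableSpace.comap Prod.fst inferInstance]
      =ᵐ[μ] fun z => f k z.1)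
    (B : Finset (Fin T)) {S : Set (Cov d)} (hS : MeasurableSet S) (k : Arm) (lam : ℝ) :
    ∫⁻ w, ENNReal.ofReal (Real.exp (lam * noiseSum π f B S k w
        - lam ^ 2 / 8 * pullCount π B S k w)) ∂(Measure.pi fun _ : Fin T => μ)
      ≤ ENNReal.ofReal 1 := by
  have hmy : ∀ t : Fin T, Measurable fun w : Fin T → Obs d => (w t).2 k := fun t =>
    (measurable_pi_apply k).comp (measurable_pi_apply t).snd
  have key := lintegral_prod_le_of_adapted μ
    (fun t w => ENNReal.ofReal (Real.exp (pullInd π S k w t *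
      (lam * ((w t).2 k - f k (w t).1) - lam ^ 2 / 8))))
    (fun t => ((measurable_pullInd hπ hS k t).mul ((((hmy t).sub
      ((hf k).comp (measurable_pi_apply t).fst)).const_mul lam).sub_const _)).exp.ennreal_ofReal)
    (fun s t hst w v => by
      rw [pullInd_update hΓ hπ w hst, Function.update_of_ne hst.ne]) 1 B (fun t _ w => by
      set A : Set (Cov d) := {x | x ∈ S ∧ pulled π (Function.update w t (x, 0)) t = k} with hA
      have hAm : MeasurableSet A := by
        refine hS.inter ?_
        exact (measurableSet_singleton k).preimage ((measurable_pulled hπ t).comp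
          ((measurable_update w).comp (measurable_id.prodMk measurable_const)))
      have : ∀ v : Obs d, pullInd π S k (Function.update w t v) t = A.indicator 1 v.1 := by
        intro v
        have hp : pulled π (Function.update w t v) t
            = pulled π (Function.update w t (v.1, 0)) t := by
          refine pulled_congr hΓ hπ t (fun s hs => ?_) (by simp)
          rw [Function.update_of_ne hs.ne, Function.update_of_ne hs.ne]
        rw [pullInd, Function.update_self, hp]
        by_cases h1 : v.1 ∈ S <;>
          by_cases h2 : pulled π (Function.update w t (v.1, 0)) t = k <;> simp [hA, h1, h2]
      simp only [this, Function.update_self]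
      exact lintegral_exp_indicator_le (hf k) (hf01 k) (hy.mono fun z hz => hz k) (hmean k) hAm lam)
  simp only [prod_ofReal_exp, one_pow] at key
  rw [ENNReal.ofReal_one]
  refine le_trans (le_of_eq ?_) key
  refine lintegral_congr fun w => ?_
  congr 2
  rw [noiseSum, pullCount, Finset.mul_sum, Finset.mul_sum, ← Finset.sum_sub_distrib]
  exact Finset.sum_congr rfl fun t _ => by ring

/-- In a round-robin batch, the visits to the bin are too few or too many (compared with their
expected number `m`), or some empirical mean is off by more than a quarter of the threshold. -/
def badEvent (π : Policy d T) (f : Arm → Cov d → ℝ) (B : Finset (Fin T)) (S : Set (Cov d))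
    (m Λ : ℝ) : Set (Fin T → Obs d) :=
  {w | |pullCount π B S 1 w - pullCount π B S (-1) w| ≤ 1 ∧
    (visitCount B S w < m / 4 ∨ 2 * m < visitCount B S w ∨
      ∃ k, pullCount π B S k w * √(Λ / visitCount B S w) < |noiseSum π f B S k w|)}

theorem measurableSet_badEvent (hπ : IsBatchPolicy M Γ π) {f : Arm → Cov d → ℝ}
    (hf : ∀ k, Measurable (f k)) (B : Finset (Fin T)) {S : Set (Cov d)} (hS : MeasurableSet S)
    (m Λ : ℝ) : MeasurableSet (badEvent π f B S m Λ) := by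
  have hv := measurable_visitCount B hS
  have hp := measurable_pullCount hπ B hS
  have hn := measurable_noiseSum hπ hf B hS
  refine MeasurableSet.inter ?_ (MeasurableSet.union ?_ (MeasurableSet.union ?_ ?_))
  · exact measurableSet_le ((hp 1).sub (hp (-1))).abs measurable_const
  · exact measurableSet_lt hv measurable_const
  · exact measurableSet_lt measurable_const hv
  · have : {w | ∃ k, pullCount π B S k w * √(Λ / visitCount B S w) < |noiseSum π f B S k w|}
      = ⋃ k, {w | pullCount π B S k w * √(Λ / visitCount B S w) < |noiseSum π f B S k w|} := by
      ext w; simp only [Set.mem_ofPred_eq, Set.mem_iUnion]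
    rw [show (fun w => ∃ k, pullCount π B S k w * √(Λ / visitCount B S w) < |noiseSum π f B S k w|)
      = {w | ∃ k, pullCount π B S k w * √(Λ / visitCount B S w) < |noiseSum π f B S k w|} from rfl,
      this]
    refine MeasurableSet.iUnion fun k => measurableSet_lt ?_ (hn k).abs
    exact (hp k).mul (measurable_const.div hv).sqrt

theorem badEvent_update (hΓ : IsGrid T M Γ) (hπ : IsBatchPolicy M Γ π) {f : Arm → Cov d → ℝ}
    {B : Finset (Fin T)} {S : Set (Cov d)} {m Λ : ℝ} {t : Fin T} (ht : ∀ s ∈ B, s < t)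
    (w : Fin T → Obs d) (u : Obs d) :
    Function.update w t u ∈ badEvent π f B S m Λ ↔ w ∈ badEvent π f B S m Λ := by
  have h1 : visitCount B S (Function.update w t u) = visitCount B S w :=
    Finset.sum_congr rfl fun s hs => by rw [Function.update_of_ne (ht s hs).ne]
  have h2 : ∀ k, pullCount π B S k (Function.update w t u) = pullCount π B S k w := fun k =>
    Finset.sum_congr rfl fun s hs => pullInd_update hΓ hπ w (ht s hs) u S k
  have h3 : ∀ k, noiseSum π f B S k (Function.update w t u) = noiseSum π f B S k w := fun k =>
    Finset.sum_congr rfl fun s hs => by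
      rw [pullInd_update hΓ hπ w (ht s hs), Function.update_of_ne (ht s hs).ne]
  simp only [badEvent, Set.mem_ofPred_eq, h1, h2, h3]

theorem visitCount_eq_natCast (B : Finset (Fin T)) (S : Set (Cov d)) (w : Fin T → Obs d) :
    ∃ n : ℕ, visitCount B S w = n := by
  classical
  refine ⟨(B.filter fun t => (w t).1 ∈ S).card, ?_⟩
  simp [visitCount, Set.indicator_apply]

/-- A union bound: 2e^{-Λ} for the number of visits, and at most 2m values of that number times 2
arms times 2 signs, each costing 2e^{-Λ}. This is (2 + 16m)e^{-Λ}, and m ≥ 8 absorbs the 2.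
Unbalanced pulls are excluded by the definition of `badEvent`, so the bound holds for any fixed set
`S`, active bin or not. -/
theorem measure_badEvent_le (hΓ : IsGrid T M Γ) (hπ : IsBatchPolicy M Γ π)
    {f : Arm → Cov d → ℝ} (hf : ∀ k, Measurable (f k)) (hf01 : ∀ k x, f k x ∈ Set.Icc (0 : ℝ) 1)
    (hy : ∀ᵐ z ∂μ, ∀ k, z.2 k ∈ Set.Icc (0 : ℝ) 1)
    (hmean : ∀ k, μ[fun z : Obs d => z.2 k | MeasurableSpace.comap Prod.fst inferInstance]
      =ᵐ[μ] fun z => f k z.1)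
    (B : Finset (Fin T)) {S : Set (Cov d)} (hS : MeasurableSet S) {m Λ : ℝ}
    (hm : m = B.card * (μ.map Prod.fst).real S) (hΛ : 1 ≤ Λ) (hmΛ : 8 * Λ ≤ m) :
    (Measure.pi fun _ : Fin T => μ) (badEvent π f B S m Λ)
      ≤ ENNReal.ofReal (17 * m * Real.exp (-Λ)) := by
  set ν := Measure.pi fun _ : Fin T => μ
  have hv := measurable_visitCount B hS
  have hl2 : 0.6931 < Real.log 2 := lt_trans (by norm_num) Real.log_two_gt_d9
  have hl2' : Real.log 2 < 0.6932 := lt_trans Real.log_two_lt_d9 (by norm_num)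
  -- Chernoff at θ = -log 2 gives exp(-(1/2 - (log 2)/4)m), and below θ = log 2 gives exp(-(2 log 2
  -- - 1)m). Both rates exceed 1/8, so m ≥ 8Λ suffices.
  have hlow : ν {w | visitCount B S w < m / 4} ≤ ENNReal.ofReal (Real.exp (-Λ)) := by
    have h1 := lintegral_exp_visitCount_le (μ := μ) B hS (-Real.log 2)
    rw [← hm, Real.exp_neg, Real.exp_log (by norm_num)] at h1
    have h2 := measure_le_of_lintegral_exp_le (hv.const_mul _) h1 (-Real.log 2 * (m / 4))
    refine (measure_mono fun w hw => ?_).trans (h2.trans (ENNReal.ofReal_le_ofReal ?_))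
    · have : visitCount B S w < m / 4 := hw
      rw [Set.mem_ofPred_eq]
      nlinarith
    · rw [← Real.exp_add]
      refine Real.exp_le_exp.2 ?_
      nlinarith
  have hhigh : ν {w | 2 * m < visitCount B S w} ≤ ENNReal.ofReal (Real.exp (-Λ)) := by
    have h1 := lintegral_exp_visitCount_le (μ := μ) B hS (Real.log 2)
    rw [← hm, Real.exp_log (by norm_num)] at h1
    have h2 := measure_le_of_lintegral_exp_le (hv.const_mul _) h1 (Real.log 2 * (2 * m))
    refine (measure_mono fun w hw => ?_).trans (h2.trans (ENNReal.ofReal_le_ofReal ?_))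
    · have : 2 * m < visitCount B S w := hw
      rw [Set.mem_ofPred_eq]
      nlinarith
    · rw [← Real.exp_add]
      refine Real.exp_le_exp.2 ?_
      nlinarith
  -- deviations, for a given number of visits, arm and sign
  set E : ℕ → Arm → Arm → Set (Fin T → Obs d) := fun n k σ =>
    {w | Λ - 1 / 2 ≤ (((σ : ℤ) : ℝ) * (4 * √(Λ / n))) * noiseSum π f B S k w
      - (((σ : ℤ) : ℝ) * (4 * √(Λ / n))) ^ 2 / 8 * pullCount π B S k w} with hE
  have hEle : ∀ n k σ, ν (E n k σ) ≤ ENNReal.ofReal (2 * Real.exp (-Λ)) := by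
    intro n k σ
    refine (measure_le_of_lintegral_exp_le
      (((measurable_noiseSum hπ hf B hS k).const_mul _).sub
        ((measurable_pullCount hπ B hS k).const_mul _))
      (lintegral_exp_noiseSum_le hΓ hπ hf hf01 hy hmean B hS k _) _).trans
      (ENNReal.ofReal_le_ofReal ?_)
    rw [one_mul, show -(Λ - 1 / 2) = 1 / 2 + -Λ by ring, Real.exp_add]
    refine mul_le_mul_of_nonneg_right ?_ (Real.exp_pos _).le
    have h1 : Real.exp (1 / 2) ^ 2 = Real.exp 1 := by
      rw [← Real.exp_nat_mul]; norm_num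
    have h2 := Real.exp_one_lt_d9
    nlinarith [Real.exp_pos (1 / 2 : ℝ)]
  have hsub : badEvent π f B S m Λ ⊆ ({w | visitCount B S w < m / 4} ∪
      {w | 2 * m < visitCount B S w}) ∪
      ⋃ n ∈ Finset.Icc 1 ⌊2 * m⌋₊, ⋃ k ∈ (Finset.univ : Finset Arm),
        ⋃ σ ∈ (Finset.univ : Finset Arm), E n k σ := by
    rintro w ⟨hrr, hbad⟩
    by_cases h1 : visitCount B S w < m / 4
    · exact Or.inl (Or.inl h1)
    by_cases h2 : 2 * m < visitCount B S w
    · exact Or.inl (Or.inr h2)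
    right
    obtain ⟨k, hk⟩ := (hbad.resolve_left h1).resolve_left h2
    obtain ⟨n, hn⟩ := visitCount_eq_natCast B S w
    rw [hn] at h1 h2 hk
    have hn2 : 2 * Λ ≤ n := by linarith [not_lt.1 h1]
    have hn1 : (1 : ℝ) ≤ n := by linarith
    have hn0 : (0 : ℝ) < n := by linarith
    have hnm : n ∈ Finset.Icc 1 ⌊2 * m⌋₊ := by
      rw [Finset.mem_Icc]
      exact ⟨by exact_mod_cast hn1, Nat.le_floor (not_lt.1 h2)⟩
    have hpc : ((n : ℝ) - 1) / 2 ≤ pullCount π B S k w := by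
      have hadd := pullCount_add (π := π) B S w
      rw [hn] at hadd
      have := abs_le.1 hrr
      rcases Int.units_eq_one_or k with rfl | rfl <;> linarith
    have hpc0 := pullCount_nonneg (π := π) B S k w
    set s := √(Λ / n) with hs
    have hs0 : 0 ≤ s := Real.sqrt_nonneg _
    have hs2 : s ^ 2 * n = Λ := by
      rw [hs, Real.sq_sqrt (by positivity)]; field_simp
    -- With tilt 4s the exponent is 4s·noise - 2s²·pulls, at least 2s²·pulls once noise exceeds
    -- s·pulls. Balance gives pulls ≥ (n-1)/2, so this is at least s²(n-1) = Λ - s² ≥ Λ - 1/2. The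
    -- missing 1/2 is the factor e^{1/2} ≤ 2 in `hEle`.
    have hcal : Λ - 1 / 2 ≤ 2 * s ^ 2 * pullCount π B S k w := by
      have h5 : s ^ 2 * (n - 1) ≤ 2 * s ^ 2 * pullCount π B S k w := by nlinarith [sq_nonneg s]
      have h6 : s ^ 2 ≤ 1 / 2 := by
        rw [hs, Real.sq_sqrt (by positivity), div_le_iff₀ hn0]; linarith
      nlinarith
    obtain ⟨σ, hσ⟩ : ∃ σ : Arm, |noiseSum π f B S k w| = ((σ : ℤ) : ℝ) * noiseSum π f B S k w := by
      rcases le_total 0 (noiseSum π f B S k w) with h | h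
      · exact ⟨1, by rw [abs_of_nonneg h]; simp⟩
      · exact ⟨-1, by rw [abs_of_nonpos h]; simp⟩
    have hσ2 : ((σ : ℤ) : ℝ) ^ 2 = 1 := by
      rcases Int.units_eq_one_or σ with rfl | rfl <;> simp
    rw [hσ] at hk
    simp only [Set.mem_iUnion]
    refine ⟨n, hnm, k, Finset.mem_univ _, σ, Finset.mem_univ _, ?_⟩
    rw [hE, Set.mem_ofPred_eq, ← hs]
    have e1 : (((σ : ℤ) : ℝ) * (4 * s)) * noiseSum π f B S k w
      - (((σ : ℤ) : ℝ) * (4 * s)) ^ 2 / 8 * pullCount π B S k w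
      = 4 * s * (((σ : ℤ) : ℝ) * noiseSum π f B S k w)
        - ((σ : ℤ) : ℝ) ^ 2 * (2 * s ^ 2) * pullCount π B S k w := by ring
    rw [e1, hσ2]
    have h7 : s * (pullCount π B S k w * s) ≤ s * (((σ : ℤ) : ℝ) * noiseSum π f B S k w) :=
      mul_le_mul_of_nonneg_left hk.le hs0
    nlinarith
  have hm0 : 0 ≤ m := by linarith
  calc ν (badEvent π f B S m Λ)
      ≤ (ν {w | visitCount B S w < m / 4} + ν {w | 2 * m < visitCount B S w}) +
        ∑ n ∈ Finset.Icc 1 ⌊2 * m⌋₊, ∑ k ∈ (Finset.univ : Finset Arm),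
          ∑ σ ∈ (Finset.univ : Finset Arm), ν (E n k σ) := by
        refine (measure_mono hsub).trans ((measure_union_le _ _).trans (add_le_add
          (measure_union_le _ _) ?_))
        refine (measure_biUnion_finset_le _ _).trans (Finset.sum_le_sum fun n _ => ?_)
        refine (measure_biUnion_finset_le _ _).trans (Finset.sum_le_sum fun k _ => ?_)
        exact measure_biUnion_finset_le _ _
    _ ≤ (ENNReal.ofReal (Real.exp (-Λ)) + ENNReal.ofReal (Real.exp (-Λ))) +
        ∑ n ∈ Finset.Icc 1 ⌊2 * m⌋₊, ∑ k ∈ (Finset.univ : Finset Arm),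
          ∑ σ ∈ (Finset.univ : Finset Arm), ENNReal.ofReal (2 * Real.exp (-Λ)) := by
        refine add_le_add (add_le_add hlow hhigh) ?_
        exact Finset.sum_le_sum fun n _ => Finset.sum_le_sum fun k _ =>
          Finset.sum_le_sum fun σ _ => hEle n k σ
    _ = ENNReal.ofReal ((2 + 8 * ⌊2 * m⌋₊) * Real.exp (-Λ)) := by
        have hcard : (Finset.univ : Finset Arm).card = 2 := rfl
        simp only [Finset.sum_const, hcard, Nat.card_Icc, Nat.add_sub_cancel, nsmul_eq_mul]
        rw [← ENNReal.ofReal_natCast, ← ENNReal.ofReal_natCast,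
          ← ENNReal.ofReal_mul (by positivity), ← ENNReal.ofReal_mul (by positivity),
          ← ENNReal.ofReal_mul (by positivity), ← ENNReal.ofReal_add (by positivity)
          (by positivity), ← ENNReal.ofReal_add (by positivity) (by positivity)]
        congr 1; push_cast; ring
    _ ≤ _ := by
        refine ENNReal.ofReal_le_ofReal (mul_le_mul_of_nonneg_right ?_ (Real.exp_pos _).le)
        have := Nat.floor_le (show 0 ≤ 2 * m by linarith)
        linarith

end Concentration

/-! ### Geometry of the bins -/

section Bins

variable {d : ℕ} {g : ℕ → ℕ}

/-- The number of bins of layer `i` in each coordinate. -/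
def binCount (g : ℕ → ℕ) (i : ℕ) : ℕ := ∏ l ∈ Finset.range i, g l

theorem width_eq (g : ℕ → ℕ) (i : ℕ) : width g i = ((binCount g i : ℕ) : ℝ)⁻¹ := by
  rw [width, binCount]; push_cast; rfl

theorem binCount_succ (g : ℕ → ℕ) (i : ℕ) : binCount g (i + 1) = binCount g i * g i :=
  Finset.prod_range_succ _ _

theorem binCount_pos (hg : ∀ l, 0 < g l) (i : ℕ) : 0 < binCount g i :=
  Finset.prod_pos fun l _ => hg l

theorem width_pos (hg : ∀ l, 0 < g l) (i : ℕ) : 0 < width g i := by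
  rw [width_eq]; have := binCount_pos hg i; positivity

theorem width_le_one (hg : ∀ l, 0 < g l) (i : ℕ) : width g i ≤ 1 := by
  rw [width_eq]; exact inv_le_one_of_one_le₀ (by exact_mod_cast binCount_pos hg i)

/-- The node of layer `i` whose bin contains `x`. -/
def nodeAt (g : ℕ → ℕ) (i : ℕ) (x : Cov d) : Node d :=
  ⟨i, fun j => min ⌊x j * binCount g i⌋₊ (binCount g i - 1)⟩

theorem nodeAt_mem_layerNodes (hg : ∀ l, 0 < g l) (i : ℕ) (x : Cov d) :
    nodeAt g i x ∈ layerNodes d g i := by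
  refine ⟨rfl, fun j => ?_⟩
  have := binCount_pos hg i
  show min _ (binCount g i - 1) < binCount g i
  omega

theorem mem_bin_nodeAt (hg : ∀ l, 0 < g l) (i : ℕ) {x : Cov d} (hx : x ∈ unitCube d) :
    x ∈ (nodeAt g i x).bin g := by
  refine ⟨hx, fun j => ?_⟩
  have hG := binCount_pos hg i
  have hG' : (0 : ℝ) < binCount g i := by exact_mod_cast hG
  have hx0 := (hx j).1
  have hx1 := (hx j).2
  show ((min ⌊x j * binCount g i⌋₊ (binCount g i - 1) : ℕ) : ℝ) * width g i ≤ x j ∧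
    (x j < (((min ⌊x j * binCount g i⌋₊ (binCount g i - 1) : ℕ) : ℝ) + 1) * width g i ∨ _)
  rw [width_eq, ← div_eq_mul_inv, ← div_eq_mul_inv, div_le_iff₀ hG', lt_div_iff₀ hG']
  have hfl := Nat.floor_le (mul_nonneg hx0 hG'.le)
  have hcast : ((binCount g i - 1 : ℕ) : ℝ) = (binCount g i : ℝ) - 1 := by
    rw [Nat.cast_sub hG]; simp
  constructor
  · refine le_trans ?_ hfl
    exact_mod_cast min_le_left _ _
  -- On the face `x j = 1` the floor is one too large; the `min` in `nodeAt` falls back to the last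
  -- bin, which is closed there.
  · rcases hx1.lt_or_eq with h | h
    · left
      have h1 : ⌊x j * binCount g i⌋₊ ≤ binCount g i - 1 := by
        have : ⌊x j * binCount g i⌋₊ < binCount g i := by
          rw [Nat.floor_lt (mul_nonneg hx0 hG'.le)]; nlinarith
        omega
      rw [min_eq_left h1]
      exact Nat.lt_floor_add_one _
    · right
      refine ⟨?_, h⟩
      show (((min ⌊x j * binCount g i⌋₊ (binCount g i - 1) : ℕ) : ℝ) + 1) * width g i = 1
      rw [h, one_mul, Nat.floor_natCast, min_eq_right (Nat.sub_le _ _), hcast, width_eq]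
      field_simp
      ring

/-- Dividing the fine index by the split factor gives the coarse one, and clipping to the last bin
respects this. So the bins of a fixed point form a path in the tree, which the algorithm follows
while both arms survive. -/
theorem nodeAt_succ_mem_children (hg : ∀ l, 0 < g l) (i : ℕ) {x : Cov d} (hx : x ∈ unitCube d) :
    nodeAt g (i + 1) x ∈ (nodeAt g i x).children (g i) := by
  refine ⟨rfl, fun j => ?_⟩
  have hG := binCount_pos hg i
  have hG' : (0 : ℝ) < binCount g i := by exact_mod_cast hG
  have hgi := hg i
  have hx0 := (hx j).1
  have hx1 := (hx j).2
  show min ⌊x j * binCount g i⌋₊ (binCount g i - 1) * g i ≤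
      min ⌊x j * binCount g (i + 1)⌋₊ (binCount g (i + 1) - 1) ∧
    min ⌊x j * binCount g (i + 1)⌋₊ (binCount g (i + 1) - 1) <
      (min ⌊x j * binCount g i⌋₊ (binCount g i - 1) + 1) * g i
  rw [binCount_succ]
  -- ⌊y⌋ / k = ⌊y / k⌋ for a natural number k; the rest is arithmetic with quotient and remainder.
  have hdiv : ⌊x j * (binCount g i * g i : ℕ)⌋₊ / g i = ⌊x j * binCount g i⌋₊ := by
    rw [← Nat.floor_div_natCast]
    congr 1
    have : (g i : ℝ) ≠ 0 := by exact_mod_cast hgi.ne'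
    push_cast; field_simp
  set u := ⌊x j * (binCount g i * g i : ℕ)⌋₊
  rw [← hdiv]
  set G := binCount g i
  have h1 := Nat.div_add_mod u (g i)
  have h2 := Nat.mod_lt u hgi
  set q := u / g i
  set r := u % g i
  set k := g i
  obtain ⟨G', hG'⟩ : ∃ G', G = G' + 1 := ⟨G - 1, by omega⟩
  have hGk : (G' + 1) * k - 1 = G' * k + (k - 1) := by
    have : (G' + 1) * k = G' * k + k := by ring
    omega
  rw [hG', hGk, Nat.add_sub_cancel]
  rcases le_total q G' with h | h
  · rw [min_eq_left h]
    have h4 : q * k ≤ G' * k := Nat.mul_le_mul_right _ h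
    have h5 : (q + 1) * k = q * k + k := by ring
    have h6 : k * q = q * k := by ring
    omega
  · rw [min_eq_right h]
    have h4 : G' * k ≤ q * k := Nat.mul_le_mul_right _ h
    have h5 : (G' + 1) * k = G' * k + k := by ring
    have h6 : k * q = q * k := by ring
    omega

theorem measurable_coord (j : Fin d) : Measurable fun x : Cov d => x j :=
  (measurable_pi_apply j).comp (WithLp.measurable_ofLp 2 _)

theorem measurableSet_unitCube : MeasurableSet (unitCube d) := by
  have : unitCube d = ⋂ j, (fun x : Cov d => x j) ⁻¹' Set.Icc 0 1 := by
    ext x; simp [unitCube]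
  rw [this]
  exact MeasurableSet.iInter fun j => measurableSet_Icc.preimage (measurable_coord j)

theorem measurableSet_bin (C : Node d) : MeasurableSet (C.bin g) := by
  have : C.bin g = unitCube d ∩ ⋂ j, ((fun x : Cov d => x j) ⁻¹'
      (Set.Ici ((C.pos j : ℝ) * width g C.layer) ∩ (Set.Iio (((C.pos j : ℝ) + 1) * width g C.layer) ∪
        {y | ((C.pos j : ℝ) + 1) * width g C.layer = 1 ∧ y = 1}))) := by
    ext x; simp [Node.bin]
  rw [this]
  refine measurableSet_unitCube.inter (MeasurableSet.iInter fun j => ?_)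
  refine MeasurableSet.preimage ?_ (measurable_coord j)
  refine measurableSet_Ici.inter (measurableSet_Iio.union ?_)
  by_cases h : ((C.pos j : ℝ) + 1) * width g C.layer = 1 <;> simp [h]

theorem measurableSet_nodeAt_eq (i : ℕ) (C : Node d) : MeasurableSet {x : Cov d | nodeAt g i x = C} := by
  have : {x : Cov d | nodeAt g i x = C} = {x : Cov d | i = C.layer} ∩
      ⋂ j, {x : Cov d | min ⌊x j * binCount g i⌋₊ (binCount g i - 1) = C.pos j} := by
    ext x
    simp [nodeAt, Node.ext_iff, funext_iff]
  rw [this]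
  refine (MeasurableSet.const _).inter (MeasurableSet.iInter fun j => ?_)
  have hm : Measurable fun x : Cov d => min ⌊x j * binCount g i⌋₊ (binCount g i - 1) :=
    (Nat.measurable_floor.comp ((measurable_coord j).mul_const _)).min measurable_const
  exact (measurableSet_singleton (C.pos j)).preimage hm

instance : Countable (Node d) := by
  have : Function.Injective fun C : Node d => (C.layer, C.pos) := fun C C' h => by
    simp only [Prod.mk.injEq] at h
    exact Node.ext h.1 h.2
  exact this.countable

theorem norm_sub_le_of_mem_bin {C : Node d} {x x' : Cov d} (hx : x ∈ C.bin g)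
    (hx' : x' ∈ C.bin g) : ‖x - x'‖ ≤ √d * width g C.layer := by
  have hw : 0 ≤ width g C.layer := by rw [width_eq]; positivity
  have hc : ∀ {y}, y ∈ C.bin g → ∀ j, (C.pos j : ℝ) * width g C.layer ≤ y j ∧
      y j ≤ ((C.pos j : ℝ) + 1) * width g C.layer := fun {y} hy j => by
    refine ⟨(hy.2 j).1, ?_⟩
    rcases (hy.2 j).2 with h | ⟨h1, h2⟩
    · exact h.le
    · rw [h1, h2]
  have hsq : ‖x - x'‖ ^ 2 ≤ (√d * width g C.layer) ^ 2 := by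
    rw [EuclideanSpace.real_norm_sq_eq, mul_pow, Real.sq_sqrt (Nat.cast_nonneg d)]
    calc ∑ j, (x - x') j ^ 2 ≤ ∑ _j : Fin d, width g C.layer ^ 2 := by
          refine Finset.sum_le_sum fun j _ => sq_le_sq' ?_ ?_
          · have h1 := hc hx j; have h2 := hc hx' j
            simp only [PiLp.sub_apply]; linarith
          · have h1 := hc hx j; have h2 := hc hx' j
            simp only [PiLp.sub_apply]; linarith
      _ = _ := by simp
  exact le_of_sq_le_sq hsq (by positivity)

/-- The half-open box with the same corners lies in the bin. A lower bound is enough: visits are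
bounded above through the calibration. -/
theorem volume_bin_ge (hg : ∀ l, 0 < g l) {i : ℕ} {C : Node d} (hC : C ∈ layerNodes d g i) :
    ENNReal.ofReal (width g i ^ d) ≤ volume (C.bin g) := by
  obtain ⟨hl, hpos⟩ := hC
  have hG := binCount_pos hg i
  have hG' : (0 : ℝ) < binCount g i := by exact_mod_cast hG
  have hw := width_pos hg i
  have hsub : (WithLp.ofLp ⁻¹' (Set.univ.pi fun j => Set.Ico ((C.pos j : ℝ) * width g i)
      (((C.pos j : ℝ) + 1) * width g i)) : Set (Cov d)) ⊆ C.bin g := by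
    intro x hx
    have hx' : ∀ j, (C.pos j : ℝ) * width g i ≤ x j ∧ x j < ((C.pos j : ℝ) + 1) * width g i :=
      fun j => hx j (Set.mem_univ j)
    refine ⟨fun j => ⟨le_trans (by positivity) (hx' j).1, (hx' j).2.le.trans ?_⟩, fun j => ?_⟩
    · have : (C.pos j : ℝ) + 1 ≤ binCount g i := by exact_mod_cast hpos j
      rw [width_eq]
      exact (mul_le_mul_of_nonneg_right this (by positivity)).trans
        (mul_inv_cancel₀ hG'.ne').le
    · rw [hl]; exact ⟨(hx' j).1, Or.inl (hx' j).2⟩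
  refine le_trans (le_of_eq ?_) (measure_mono hsub)
  rw [(PiLp.volume_preserving_ofLp (Fin d)).measure_preimage
    (MeasurableSet.univ_pi fun j => measurableSet_Ico).nullMeasurableSet, volume_pi_pi]
  simp only [Real.volume_Ico]
  have : ∀ j, ((C.pos j : ℝ) + 1) * width g i - C.pos j * width g i = width g i := fun j => by ring
  simp only [this, Finset.prod_const, Finset.card_univ, Fintype.card_fin]
  rw [ENNReal.ofReal_pow hw.le]

theorem IsBanditLaw.measure_bin_ge {α β L δ₀ D₀ cLo cHi : ℝ} {μ : Measure (Obs d)}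
    {f : Arm → Cov d → ℝ} (h : IsBanditLaw α β L δ₀ D₀ cLo cHi μ f) (hcLo : 0 < cLo)
    (hg : ∀ l, 0 < g l) {i : ℕ} {C : Node d} (hC : C ∈ layerNodes d g i) :
    cLo * width g i ^ d ≤ (μ.map Prod.fst).real (C.bin g) := by
  obtain ⟨p, hp, hb, hmap⟩ := h.density
  have := h.isProb
  have : IsProbabilityMeasure (μ.map Prod.fst) :=
    Measure.isProbabilityMeasure_map measurable_fst.aemeasurable
  rw [Measure.real, ← ENNReal.ofReal_le_iff_le_toReal (measure_ne_top _ _),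
    ENNReal.ofReal_mul hcLo.le]
  have hBm := measurableSet_bin (g := g) C
  calc ENNReal.ofReal cLo * ENNReal.ofReal (width g i ^ d)
      ≤ ENNReal.ofReal cLo * volume (C.bin g) := mul_le_mul_right (volume_bin_ge hg hC) _
    _ = ∫⁻ _ in C.bin g, ENNReal.ofReal cLo ∂(volume.restrict (unitCube d)) := by
        rw [setLIntegral_const, Measure.restrict_apply hBm, Set.inter_eq_left.2 fun x hx => hx.1]
    _ ≤ ∫⁻ x in C.bin g, ENNReal.ofReal (p x) ∂(volume.restrict (unitCube d)) := by
        refine lintegral_mono_ae ?_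
        exact (ae_restrict_of_ae hb).mono fun x hx => ENNReal.ofReal_le_ofReal hx.1
    _ = _ := by rw [hmap, withDensity_apply _ hBm]

theorem IsBanditLaw.ae_mem_unitCube {α β L δ₀ D₀ cLo cHi : ℝ} {μ : Measure (Obs d)}
    {f : Arm → Cov d → ℝ} (h : IsBanditLaw α β L δ₀ D₀ cLo cHi μ f) :
    ∀ᵐ z ∂μ, z.1 ∈ unitCube d := by
  obtain ⟨p, hp, hb, hmap⟩ := h.density
  have h1 : ∀ᵐ x ∂(μ.map Prod.fst), x ∈ unitCube d := by
    rw [hmap]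
    exact withDensity_absolutelyContinuous _ _ (ae_restrict_mem measurableSet_unitCube)
  exact (ae_map_iff measurable_fst.aemeasurable measurableSet_unitCube).1 h1

end Bins

/-! ### The algorithm along a sample path without bad events -/

section Path

variable {d T M : ℕ} {Γ g : ℕ → ℕ} {π : Policy d T}

theorem one_lt_card_arm : 1 < (Finset.univ : Finset Arm).card := by decide

/-- The arms are ±1 and alternate, so a running sum is 0 or the latest arm. Recording the last visit
is what lets the induction on the largest time close. -/
theorem RoundRobin.sum_cases {T : ℕ} {a : Fin T → Arm} {S : Finset (Fin T)}
    (h : RoundRobin Finset.univ S a) :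
    (S = ∅ ∧ ∑ t ∈ S, ((a t : ℤ)) = 0) ∨
      ∃ t ∈ S, (∀ s ∈ S, s ≤ t) ∧ (∑ t ∈ S, ((a t : ℤ)) = 0 ∨ ∑ t ∈ S, ((a t : ℤ)) = a t) := by
  have h2 := h.2 (by decide)
  clear h
  induction S using Finset.induction_on_max with
  | empty => left; simp
  | insert t S hlt ih =>
    right
    have hnot : t ∉ S := fun h => lt_irrefl _ (hlt t h)
    refine ⟨t, Finset.mem_insert_self _ _, fun s hs => ?_, ?_⟩
    · rcases Finset.mem_insert.1 hs with rfl | hs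
      · exact le_rfl
      · exact (hlt s hs).le
    rw [Finset.sum_insert hnot]
    have hS : ∀ s ∈ S, ∀ t ∈ S, s < t → (∀ u ∈ S, ¬ (s < u ∧ u < t)) → a t ≠ a s := by
      intro s hs t' ht' hst hu
      refine h2 s (Finset.mem_insert_of_mem hs) t' (Finset.mem_insert_of_mem ht') hst ?_
      intro u hu'
      rcases Finset.mem_insert.1 hu' with rfl | hu'
      · exact fun hc => lt_asymm hc.2 (hlt t' ht')
      · exact hu u hu'
    rcases ih hS with ⟨rfl, h0⟩ | ⟨s, hs, hmax, hsum⟩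
    · right; simp
    · have hne := h2 s (Finset.mem_insert_of_mem hs) t (Finset.mem_insert_self _ _) (hlt s hs) (by
        intro u hu hc
        rcases Finset.mem_insert.1 hu with rfl | hu
        · exact lt_irrefl _ hc.2
        · exact absurd (hmax u hu) (not_le.2 hc.1))
      rcases hsum with h | h
      · right; rw [h, add_zero]
      · left; rw [h]
        rcases Int.units_eq_one_or (a t) with h1 | h1 <;>
          rcases Int.units_eq_one_or (a s) with h3 | h3 <;> rw [h1, h3] at hne ⊢ <;> simp_all

theorem RoundRobin.abs_sum_le {T : ℕ} {a : Fin T → Arm} {S : Finset (Fin T)}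
    (h : RoundRobin Finset.univ S a) : |∑ t ∈ S, ((a t : ℤ) : ℝ)| ≤ 1 := by
  have : (∑ t ∈ S, ((a t : ℤ) : ℝ)) = ((∑ t ∈ S, (a t : ℤ) : ℤ) : ℝ) := by push_cast; rfl
  rw [this]
  rcases h.sum_cases with ⟨_, h0⟩ | ⟨t, _, _, h0 | h0⟩
  · rw [h0]; simp
  · rw [h0]; simp
  · rw [h0]; rcases Int.units_eq_one_or (a t) with h1 | h1 <;> rw [h1] <;> simp

variable (Γ g π) in
/-- The visits to the bin of `C` during batch `i` at which arm `k` is pulled. -/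
def armVisits (w : Fin T → Obs d) (i : ℕ) (C : Node d) (k : Arm) : Finset (Fin T) :=
  (visits Γ g (fun t => (w t).1) i C).filter fun t => pulled π w t = k

theorem pullInd_sum_eq (w : Fin T → Obs d) (i : ℕ) (C : Node d) (k : Arm) (z : Fin T → ℝ) :
    ∑ t ∈ batch Γ i, pullInd π (C.bin g) k w t * z t = ∑ t ∈ armVisits Γ g π w i C k, z t := by
  classical
  rw [armVisits, visits, Finset.filter_filter, Finset.sum_filter]
  refine Finset.sum_congr rfl fun t _ => ?_
  by_cases h1 : (w t).1 ∈ C.bin g <;> by_cases h2 : pulled π w t = k <;> simp [pullInd, h1, h2]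

theorem pullCount_eq_card (w : Fin T → Obs d) (i : ℕ) (C : Node d) (k : Arm) :
    pullCount π (batch Γ i) (C.bin g) k w = (armVisits Γ g π w i C k).card := by
  have := pullInd_sum_eq (Γ := Γ) (g := g) (π := π) w i C k fun _ => 1
  simpa [pullCount] using this

theorem visitCount_eq_card (w : Fin T → Obs d) (i : ℕ) (C : Node d) :
    visitCount (batch Γ i) (C.bin g) w = (visits Γ g (fun t => (w t).1) i C).card := by
  classical
  simp [visitCount, visits, Set.indicator_apply]

theorem pullCount_sub_eq (w : Fin T → Obs d) (i : ℕ) (C : Node d) :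
    pullCount π (batch Γ i) (C.bin g) 1 w - pullCount π (batch Γ i) (C.bin g) (-1) w
      = ∑ t ∈ visits Γ g (fun t => (w t).1) i C, ((pulled π w t : ℤ) : ℝ) := by
  classical
  rw [pullCount, pullCount, ← Finset.sum_sub_distrib, visits, Finset.sum_filter]
  refine Finset.sum_congr rfl fun t _ => ?_
  by_cases h1 : (w t).1 ∈ C.bin g <;> rcases Int.units_eq_one_or (pulled π w t) with h | h <;>
    simp [pullInd, h1, h]

theorem noiseSum_eq (f : Arm → Cov d → ℝ) (w : Fin T → Obs d) (i : ℕ) (C : Node d) (k : Arm) :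
    noiseSum π f (batch Γ i) (C.bin g) k w
      = ∑ t ∈ armVisits Γ g π w i C k, observed π w t
        - ∑ t ∈ armVisits Γ g π w i C k, f k (w t).1 := by
  rw [noiseSum, pullInd_sum_eq (z := fun t => (w t).2 k - f k (w t).1), Finset.sum_sub_distrib]
  congr 1
  refine Finset.sum_congr rfl fun t ht => ?_
  rw [observed, (Finset.mem_filter.1 ht).2]

theorem holder_on_bin {L β : ℝ} (hL : 0 < L) (hβ : 0 < β) {φ : Cov d → ℝ}
    (hsm : ∀ x ∈ unitCube d, ∀ x' ∈ unitCube d, |φ x - φ x'| ≤ L * ‖x - x'‖ ^ β)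
    {C : Node d} {x x' : Cov d} (hx : x ∈ C.bin g) (hx' : x' ∈ C.bin g) :
    |φ x - φ x'| ≤ L * (d : ℝ) ^ (β / 2) * width g C.layer ^ β := by
  have hw : 0 ≤ width g C.layer := by rw [width_eq]; positivity
  refine (hsm x hx.1 x' hx'.1).trans ?_
  rw [mul_assoc]
  refine mul_le_mul_of_nonneg_left ?_ hL.le
  calc ‖x - x'‖ ^ β ≤ (√d * width g C.layer) ^ β :=
        Real.rpow_le_rpow (norm_nonneg _) (norm_sub_le_of_mem_bin hx hx') hβ.le
    _ = _ := by
        rw [Real.mul_rpow (Real.sqrt_nonneg _) hw, Real.sqrt_eq_rpow,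
          ← Real.rpow_mul (Nat.cast_nonneg d)]
        congr 2; ring

/-- If the batch is not bad for the bin, each empirical mean is close to the mean reward
everywhere on the bin. -/
theorem abs_empMean_sub_le {L β : ℝ} (hL : 0 < L) (hβ : 0 < β) {f : Arm → Cov d → ℝ}
    (hsm : ∀ k, ∀ x ∈ unitCube d, ∀ x' ∈ unitCube d, |f k x - f k x'| ≤ L * ‖x - x'‖ ^ β)
    {w : Fin T → Obs d} {i : ℕ} {C : Node d} {m Λ : ℝ} (hΛ : 1 ≤ Λ) (hm : 8 * Λ ≤ m)
    (hrr : RoundRobin Finset.univ (visits Γ g (fun t => (w t).1) i C) (pulled π w))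
    (hbad : w ∉ badEvent π f (batch Γ i) (C.bin g) m Λ) {z : Cov d} (hz : z ∈ C.bin g) (k : Arm) :
    |empMean Γ g (fun t => (w t).1) (pulled π w) (observed π w) i C k - f k z|
      ≤ √(Λ / (visits Γ g (fun t => (w t).1) i C).card)
        + L * (d : ℝ) ^ (β / 2) * width g C.layer ^ β := by
  classical
  have habs : |pullCount π (batch Γ i) (C.bin g) 1 w - pullCount π (batch Γ i) (C.bin g) (-1) w|
      ≤ 1 := by rw [pullCount_sub_eq]; exact hrr.abs_sum_le
  -- Balance is automatic from round-robin, so avoiding `badEvent` negates its second half.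
  have hnb : ¬ _ := fun h => hbad ⟨habs, h⟩
  push Not at hnb
  obtain ⟨h1, -, h3⟩ := hnb
  have hdev := h3 k
  have hsum := pullCount_add (π := π) (batch Γ i) (C.bin g) w
  rw [← visitCount_eq_card]
  set N := visitCount (batch Γ i) (C.bin g) w
  -- At least m/4 ≥ 2 visits, split between the arms with difference at most 1.
  have hn : 0 < pullCount π (batch Γ i) (C.bin g) k w := by
    have := abs_le.1 habs
    rcases Int.units_eq_one_or k with rfl | rfl <;> linarith
  rw [pullCount_eq_card] at hn hdev
  have hE : empMean Γ g (fun t => (w t).1) (pulled π w) (observed π w) i C k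
      = (∑ t ∈ armVisits Γ g π w i C k, observed π w t) / (armVisits Γ g π w i C k).card := by
    rw [empMean, armVisits]
  rw [hE]
  rw [noiseSum_eq] at hdev
  set A := armVisits Γ g π w i C k with hA
  have hsm' : |∑ t ∈ A, f k (w t).1 - A.card * f k z|
      ≤ A.card * (L * (d : ℝ) ^ (β / 2) * width g C.layer ^ β) := by
    have : ∑ t ∈ A, f k (w t).1 - A.card * f k z = ∑ t ∈ A, (f k (w t).1 - f k z) := by
      rw [Finset.sum_sub_distrib]; simp
    rw [this]
    refine (Finset.abs_sum_le_sum_abs _ _).trans ?_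
    refine (Finset.sum_le_card_nsmul _ _ _ fun t ht => ?_).trans (nsmul_eq_mul _ _).le
    have hvis := (Finset.mem_filter.1 ht).1
    exact holder_on_bin hL hβ (hsm k) (Finset.mem_filter.1 hvis).2 hz
  -- Noise plus bias: deviation from the average of `f k` at the visits, then of that average from
  -- the value at `z`.
  have hE2 : (∑ t ∈ A, observed π w t) / A.card - f k z
      = ((∑ t ∈ A, observed π w t - ∑ t ∈ A, f k (w t).1)
        + (∑ t ∈ A, f k (w t).1 - A.card * f k z)) / A.card := by
    field_simp; ring
  rw [hE2, abs_div, abs_of_pos hn, div_le_iff₀ hn]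
  calc _ ≤ _ := abs_add_le _ _
    _ ≤ A.card * √(Λ / N) + A.card * (L * (d : ℝ) ^ (β / 2) * width g C.layer ^ β) :=
        add_le_add hdev hsm'
    _ = _ := by ring

theorem visits_card_bounds {f : Arm → Cov d → ℝ}
    {w : Fin T → Obs d} {i : ℕ} {C : Node d} {m Λ : ℝ}
    (hrr : RoundRobin Finset.univ (visits Γ g (fun t => (w t).1) i C) (pulled π w))
    (hbad : w ∉ badEvent π f (batch Γ i) (C.bin g) m Λ) :
    m / 4 ≤ (visits Γ g (fun t => (w t).1) i C).card ∧
      (visits Γ g (fun t => (w t).1) i C).card ≤ 2 * m := by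
  have habs : |pullCount π (batch Γ i) (C.bin g) 1 w - pullCount π (batch Γ i) (C.bin g) (-1) w|
      ≤ 1 := by rw [pullCount_sub_eq]; exact hrr.abs_sum_le
  have hnb : ¬ _ := fun h => hbad ⟨habs, h⟩
  push Not at hnb
  rw [← visitCount_eq_card]
  exact ⟨hnb.1, hnb.2.1⟩

/-- The elimination at the end of a batch that is not bad for the bin: if an arm is removed then
the other one is optimal on the whole bin, otherwise the gap is small on the bin. -/
theorem elimination {L β K : ℝ} (hL : 0 < L) (hβ : 0 < β) (hg : ∀ l, 0 < g l)
    {f : Arm → Cov d → ℝ}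
    (hsm : ∀ k, ∀ x ∈ unitCube d, ∀ x' ∈ unitCube d, |f k x - f k x'| ≤ L * ‖x - x'‖ ^ β)
    {w : Fin T → Obs d} {i : ℕ} {C : Node d} (hC : C.layer = i) {m : ℝ}
    (hΛ : 1 ≤ Real.log (2 * T * width g i ^ d)) (hm : 8 * Real.log (2 * T * width g i ^ d) ≤ m)
    (hcal : 2 * cZero d β L * width g i ^ β ≤ threshold d (2 * m) T (width g i))
    (hK : threshold d (m / 4) T (width g i) ≤ K * width g i ^ β)
    (hrr : RoundRobin Finset.univ (visits Γ g (fun t => (w t).1) i C) (pulled π w))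
    (hbad : w ∉ badEvent π f (batch Γ i) (C.bin g) m (Real.log (2 * T * width g i ^ d))) :
    ((remaining Γ g (fun t => (w t).1) (pulled π w) (observed π w) i C Finset.univ).card ≤ 1 →
      ∀ k ∈ remaining Γ g (fun t => (w t).1) (pulled π w) (observed π w) i C Finset.univ,
        ∀ z ∈ C.bin g, max (f 1 z) (f (-1) z) ≤ f k z) ∧
    (1 < (remaining Γ g (fun t => (w t).1) (pulled π w) (observed π w) i C Finset.univ).card →
        ∀ z ∈ C.bin g, |f 1 z - f (-1) z|
          ≤ (3 / 2 * K + 2 * (L * (d : ℝ) ^ (β / 2))) * width g i ^ β) := by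
  subst hC
  classical
  set Λ := Real.log (2 * T * width g C.layer ^ d) with hΛd
  set N : ℝ := ((visits Γ g (fun t => (w t).1) C.layer C).card : ℝ) with hN
  set E : Arm → ℝ := empMean Γ g (fun t => (w t).1) (pulled π w) (observed π w) C.layer C with hE
  set δ := L * (d : ℝ) ^ (β / 2) * width g C.layer ^ β with hδ
  have hw := width_pos hg C.layer
  have hwβ : 0 < width g C.layer ^ β := Real.rpow_pos_of_pos hw _
  obtain ⟨hN1, hN2⟩ := visits_card_bounds hrr hbad
  rw [← hN] at hN1 hN2
  have hN0 : 0 < N := by linarith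
  have hdev : ∀ z ∈ C.bin g, ∀ k, |E k - f k z| ≤ √(Λ / N) + δ := fun z hz k =>
    abs_empMean_sub_le hL hβ hsm hΛ hm hrr hbad hz k
  have hU : threshold d N T (width g C.layer) = 4 * √(Λ / N) := rfl
  -- The calibration is stated at 2m visits; at most 2m occurred, so the actual threshold is no
  -- smaller.
  have hlow : cZero d β L * width g C.layer ^ β ≤ 2 * √(Λ / N) := by
    have h1 : threshold d (2 * m) T (width g C.layer) = 4 * √(Λ / (2 * m)) := rfl
    have h2 : √(Λ / (2 * m)) ≤ √(Λ / N) := Real.sqrt_le_sqrt (by gcongr)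
    linarith
  have hhigh : 4 * √(Λ / N) ≤ K * width g C.layer ^ β := by
    have h1 : threshold d (m / 4) T (width g C.layer) = 4 * √(Λ / (m / 4)) := rfl
    have h2 : √(Λ / N) ≤ √(Λ / (m / 4)) := Real.sqrt_le_sqrt (by
      have : 0 < m / 4 := by linarith
      gcongr)
    linarith
  -- The role of `cZero`: the bias stays below √(Λ/N), so an empirical mean is off by less than half
  -- the threshold 4√(Λ/N), and two errors cannot cause a wrong elimination.
  have hlow2 : 2 * δ < 2 * √(Λ / N) := by
    refine lt_of_lt_of_le ?_ hlow
    rw [cZero, hδ]; linarith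
  have hs0 : 0 ≤ √(Λ / N) := Real.sqrt_nonneg _
  have hcard : (Finset.univ : Finset Arm).card ≠ 1 := by decide
  have hR : remaining Γ g (fun t => (w t).1) (pulled π w) (observed π w) C.layer C Finset.univ
      = Finset.univ.filter fun k => ∀ k', E k' - E k ≤ 4 * √(Λ / N) := by
    rw [remaining, if_neg hcard]
    ext k
    simp only [Finset.mem_filter, Finset.mem_univ, true_and, true_implies]
    rfl
  rw [hR]
  refine ⟨?_, ?_⟩
  · intro hc k hk z hz
    have hnk : -k ∉ Finset.univ.filter fun k => ∀ k', E k' - E k ≤ 4 * √(Λ / N) := by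
      intro h
      have := Finset.card_le_one.1 hc k hk (-k) h
      rcases Int.units_eq_one_or k with rfl | rfl <;> exact absurd this (by decide)
    simp only [Finset.mem_filter, Finset.mem_univ, true_and, not_forall, not_le] at hnk
    obtain ⟨k', hk'⟩ := hnk
    have hkk : k' = k := by
      by_contra hne
      have : k' = -k := by
        rcases Int.units_eq_one_or k with rfl | rfl <;>
          rcases Int.units_eq_one_or k' with rfl | rfl <;> first | rfl | exact absurd rfl hne
      rw [this] at hk'; linarith
    rw [hkk] at hk'
    have h1 := abs_le.1 (hdev z hz k)
    have h2 := abs_le.1 (hdev z hz (-k))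
    have h3 : f (-k) z ≤ f k z := by linarith
    rcases Int.units_eq_one_or k with rfl | rfl
    · exact max_le le_rfl h3
    · rw [neg_neg] at h3; exact max_le h3 le_rfl
  · intro hc z hz
    have hall : ∀ k, k ∈ Finset.univ.filter fun k => ∀ k', E k' - E k ≤ 4 * √(Λ / N) := by
      have : (Finset.univ.filter fun k => ∀ k', E k' - E k ≤ 4 * √(Λ / N)) = Finset.univ := by
        refine Finset.eq_univ_of_card _ (le_antisymm (Finset.card_le_univ _) ?_)
        exact hc
      rw [this]; exact fun k => Finset.mem_univ k
    have a1 := (Finset.mem_filter.1 (hall 1)).2 (-1)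
    have a2 := (Finset.mem_filter.1 (hall (-1))).2 1
    have h1 := abs_le.1 (hdev z hz 1)
    have h2 := abs_le.1 (hdev z hz (-1))
    -- If both arms survive, the gap is at most the threshold plus two errors, 6√(Λ/N) + 2δ, and
    -- `hhigh` bounds 6√(Λ/N) by 3/2 of K w^β.
    have e : (3 / 2 * K + 2 * (L * (d : ℝ) ^ (β / 2))) * width g C.layer ^ β
      = 3 / 2 * (K * width g C.layer ^ β) + 2 * δ := by rw [hδ]; ring
    rw [e, abs_le]
    constructor <;> linarith

/-- The gap between the mean rewards, set to `0` where it exceeds `δ`. -/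
def clippedGap (f : Arm → Cov d → ℝ) (δ : ℝ) (z : Cov d) : ℝ :=
  if |f 1 z - f (-1) z| ≤ δ then |f 1 z - f (-1) z| else 0

theorem clippedGap_nonneg (f : Arm → Cov d → ℝ) (δ : ℝ) (z : Cov d) : 0 ≤ clippedGap f δ z := by
  unfold clippedGap; split_ifs <;> positivity

theorem clippedGap_of_le {f : Arm → Cov d → ℝ} {δ : ℝ} {z : Cov d}
    (h : |f 1 z - f (-1) z| ≤ δ) : clippedGap f δ z = |f 1 z - f (-1) z| := if_pos h

theorem max_sub_le_gap (f : Arm → Cov d → ℝ) (z : Cov d) (k : Arm) :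
    max (f 1 z) (f (-1) z) - f k z ≤ |f 1 z - f (-1) z| := by
  have h1 := le_abs_self (f 1 z - f (-1) z)
  have h2 := neg_abs_le (f 1 z - f (-1) z)
  have h3 := abs_nonneg (f 1 z - f (-1) z)
  rcases Int.units_eq_one_or k with rfl | rfl <;> rw [sub_le_iff_le_add] <;>
    refine max_le ?_ ?_ <;> linarith

variable (Γ g π) in
/-- Batch `i` is bad for the bin of layer `i` that contains `z`. -/
def badAt (μ : Measure (Obs d)) (f : Arm → Cov d → ℝ) (i : ℕ) (z : Cov d) : Set (Fin T → Obs d) :=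
  badEvent π f (batch Γ i) ((nodeAt g i z).bin g)
    (((Γ i : ℝ) - Γ (i - 1)) * (μ.map Prod.fst).real ((nodeAt g i z).bin g))
    (Real.log (2 * T * width g i ^ d))

variable (Γ g π) in
/-- The contribution to the regret at `z` of bad events in the batches up to `i`. -/
def badRegret (μ : Measure (Obs d)) (f : Arm → Cov d → ℝ) (Δ : ℕ → ℝ) (i : ℕ)
    (w : Fin T → Obs d) (z : Cov d) : ℝ :=
  ∑ j ∈ Finset.range i, clippedGap f (Δ j) z * (badAt Γ g π μ f (j + 1) z).indicator 1 w

variable {μ : Measure (Obs d)}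

theorem badRegret_succ (f : Arm → Cov d → ℝ) (Δ : ℕ → ℝ) (i : ℕ)
    (w : Fin T → Obs d) (z : Cov d) : badRegret Γ g π μ f Δ (i + 1) w z = badRegret Γ g π μ f Δ i w z
      + clippedGap f (Δ i) z * (badAt Γ g π μ f (i + 1) z).indicator 1 w :=
  Finset.sum_range_succ _ _

theorem badRegret_nonneg (f : Arm → Cov d → ℝ) (Δ : ℕ → ℝ) (i : ℕ)
    (w : Fin T → Obs d) (z : Cov d) : 0 ≤ badRegret Γ g π μ f Δ i w z :=
  Finset.sum_nonneg fun _ _ => mul_nonneg (clippedGap_nonneg _ _ _)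
    (Set.indicator_nonneg (fun _ _ => zero_le_one) _)

/-- What the calibration of the grid gives for each bin. -/
structure BatchScale (d T M : ℕ) (β L K : ℝ) (Γ g : ℕ → ℕ) (μ : Measure (Obs d)) : Prop where
  log_ge : ∀ i ∈ Finset.Icc 1 (M - 1), 1 ≤ Real.log (2 * T * width g i ^ d)
  visits_ge : ∀ i ∈ Finset.Icc 1 (M - 1), ∀ C ∈ layerNodes d g i,
    8 * Real.log (2 * T * width g i ^ d)
      ≤ ((Γ i : ℝ) - Γ (i - 1)) * (μ.map Prod.fst).real (C.bin g)
  threshold_le : ∀ i ∈ Finset.Icc 1 (M - 1), ∀ C ∈ layerNodes d g i,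
    threshold d (((Γ i : ℝ) - Γ (i - 1)) * (μ.map Prod.fst).real (C.bin g) / 4) T (width g i)
      ≤ K * width g i ^ β

/-- Induction over the batches. While both arms survive, the active bin of `z` is on its path, of
layer i + 1, but its gap is controlled at the scale `Δ i` of the parent layer, where the last test
took place. Once a bad event occurs, `badRegret` dominates the gap at `z`, and being nondecreasing
in `i` it covers every later batch. Without one, `elimination` yields an optimal single arm or the
next gap bound. -/
theorem exists_active {L β K : ℝ} (hL : 0 < L) (hβ : 0 < β) (hg : ∀ l, 0 < g l)
    {f : Arm → Cov d → ℝ}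
    (hsm : ∀ k, ∀ x ∈ unitCube d, ∀ x' ∈ unitCube d, |f k x - f k x'| ≤ L * ‖x - x'‖ ^ β)
    (hf01 : ∀ k x, f k x ∈ Set.Icc (0 : ℝ) 1)
    (hΓ : IsGrid T M Γ) (hπ : IsBaSEDB M Γ g π) (hsc : BatchScale d T M β L K Γ g μ)
    (hcal : IsCalibrated β L T M Γ g μ) {Δ : ℕ → ℝ} (hΔ0 : 1 ≤ Δ 0)
    (hΔ : ∀ i, (3 / 2 * K + 2 * (L * (d : ℝ) ^ (β / 2))) * width g i ^ β ≤ Δ i)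
    {w : Fin T → Obs d} (hw : ∀ t, (w t).1 ∈ unitCube d) {z : Cov d} (hz : z ∈ unitCube d)
    (i : ℕ) (hi : i ≤ M - 1) :
    ∃ q ∈ activeState Γ g (fun t => (w t).1) (pulled π w) (observed π w) i, z ∈ q.1.bin g ∧
      ((q = (nodeAt g (i + 1) z, Finset.univ) ∧ (|f 1 z - f (-1) z| ≤ Δ i ∨
          |f 1 z - f (-1) z| ≤ badRegret Γ g π μ f Δ i w z)) ∨
        (q.2.card = 1 ∧
          ∀ k ∈ q.2, max (f 1 z) (f (-1) z) - f k z ≤ badRegret Γ g π μ f Δ i w z)) := by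
  have hpull : (fun t => π t (fun s => (w s).1) (observed π w)) = pulled π w := by
    funext t; exact (pulled_eq hΓ hπ.1 w t).symm
  induction i with
  | zero =>
    refine ⟨(nodeAt g 1 z, Finset.univ), ⟨nodeAt_mem_layerNodes hg 1 z, rfl⟩,
      mem_bin_nodeAt hg 1 hz, Or.inl ⟨rfl, Or.inl (le_trans ?_ hΔ0)⟩⟩
    have h1 := hf01 1 z
    have h2 := hf01 (-1) z
    rw [abs_le]
    constructor <;> linarith [h1.1, h1.2, h2.1, h2.2]
  | succ i ih =>
    obtain ⟨p, hp, hpz, hA | hB⟩ := ih (by omega)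
    · obtain ⟨rfl, hgap⟩ := hA
      have hi1 : i + 1 ∈ Finset.Icc 1 (M - 1) := Finset.mem_Icc.2 ⟨by omega, hi⟩
      have hrr := (hπ.2 (fun s => (w s).1) (observed π w) hw).1 (i + 1) hi1
        (nodeAt g (i + 1) z, Finset.univ) (by rw [hpull]; exact hp)
      rw [hpull] at hrr
      have hCl := nodeAt_mem_layerNodes hg (i + 1) z
      set R := remaining Γ g (fun t => (w t).1) (pulled π w) (observed π w) (i + 1)
        (nodeAt g (i + 1) z) Finset.univ with hR
      -- the next active pair, and the bound on the gap, according to the remaining arms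
      have hRne : R.Nonempty := by
        classical
        rw [hR, remaining, if_neg (by decide)]
        obtain ⟨k, -, hk⟩ := Finset.exists_max_image (Finset.univ : Finset Arm)
          (empMean Γ g (fun t => (w t).1) (pulled π w) (observed π w) (i + 1)
            (nodeAt g (i + 1) z)) ⟨1, Finset.mem_univ _⟩
        refine ⟨k, Finset.mem_filter.2 ⟨Finset.mem_univ _, fun k' hk' => ?_⟩⟩
        refine (sub_nonpos.2 (hk k' hk')).trans ?_
        unfold threshold; positivity
      have hmono : badRegret Γ g π μ f Δ i w z ≤ badRegret Γ g π μ f Δ (i + 1) w z := by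
        rw [badRegret_succ]
        have : 0 ≤ clippedGap f (Δ i) z * (badAt Γ g π μ f (i + 1) z).indicator 1 w :=
          mul_nonneg (clippedGap_nonneg _ _ _) (Set.indicator_nonneg (fun _ _ => zero_le_one) _)
        linarith
      -- At a first bad batch the gap is still at most `Δ i`, so it is not clipped and the new
      -- summand is the entire gap. After that, monotonicity suffices.
      have hcases : |f 1 z - f (-1) z| ≤ badRegret Γ g π μ f Δ (i + 1) w z ∨
          w ∉ badAt Γ g π μ f (i + 1) z := by
        by_cases hb : w ∈ badAt Γ g π μ f (i + 1) z
        · left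
          rcases hgap with h | h
          · rw [badRegret_succ, Set.indicator_of_mem hb, clippedGap_of_le h]
            have := badRegret_nonneg (Γ := Γ) (g := g) (π := π) (μ := μ) f Δ i w z
            simp only [Pi.one_apply, mul_one]; linarith
          · exact h.trans hmono
        · exact Or.inr hb
      have helim := fun hb => elimination (K := K) hL hβ hg hsm (w := w) (i := i + 1)
        (C := nodeAt g (i + 1) z) rfl (hsc.log_ge _ hi1) (hsc.visits_ge _ hi1 _ hCl)
        (hcal _ hi1 _ hCl) (hsc.threshold_le _ hi1 _ hCl) hrr hb
      by_cases hc : R.card ≤ 1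
      · refine ⟨(nodeAt g (i + 1) z, R), ⟨_, hp, rfl, Or.inl ⟨hc, rfl⟩⟩, hpz, Or.inr
          ⟨le_antisymm hc (Finset.card_pos.2 hRne), fun k hk => ?_⟩⟩
        rcases hcases with h | h
        · exact (max_sub_le_gap f z k).trans h
        · have := (helim h).1 hc k hk z hpz
          have h0 := badRegret_nonneg (Γ := Γ) (g := g) (π := π) (μ := μ) f Δ (i + 1) w z
          linarith
      · have hRu : R = Finset.univ :=
          Finset.eq_univ_of_card _ (le_antisymm (Finset.card_le_univ _) (not_le.1 hc))
        refine ⟨(nodeAt g (i + 1 + 1) z, Finset.univ), ⟨_, hp, hRu.symm, Or.inr ⟨one_lt_card_arm,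
          nodeAt_succ_mem_children hg (i + 1) hz⟩⟩, mem_bin_nodeAt hg _ hz, Or.inl ⟨rfl, ?_⟩⟩
        rcases hcases with h | h
        · exact Or.inr h
        · exact Or.inl (((helim h).2 (not_le.1 hc) z hpz).trans (hΔ _))
    · refine ⟨p, ⟨p, hp, ?_, Or.inl ⟨hB.1.le, rfl⟩⟩, hpz, Or.inr ⟨hB.1, fun k hk => ?_⟩⟩
      · rw [remaining, if_pos hB.1]
      · refine (hB.2 k hk).trans ?_
        rw [badRegret_succ]
        have : 0 ≤ clippedGap f (Δ i) z * (badAt Γ g π μ f (i + 1) z).indicator 1 w :=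
          mul_nonneg (clippedGap_nonneg _ _ _) (Set.indicator_nonneg (fun _ _ => zero_le_one) _)
        linarith

/-- The regret at a time of batch `i + 1`. -/
theorem regret_at_le {L β K : ℝ} (hL : 0 < L) (hβ : 0 < β) (hg : ∀ l, 0 < g l)
    {f : Arm → Cov d → ℝ}
    (hsm : ∀ k, ∀ x ∈ unitCube d, ∀ x' ∈ unitCube d, |f k x - f k x'| ≤ L * ‖x - x'‖ ^ β)
    (hf01 : ∀ k x, f k x ∈ Set.Icc (0 : ℝ) 1)
    (hΓ : IsGrid T M Γ) (hπ : IsBaSEDB M Γ g π) (hsc : BatchScale d T M β L K Γ g μ)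
    (hcal : IsCalibrated β L T M Γ g μ) {Δ : ℕ → ℝ} (hΔ0 : 1 ≤ Δ 0)
    (hΔ : ∀ i, (3 / 2 * K + 2 * (L * (d : ℝ) ^ (β / 2))) * width g i ^ β ≤ Δ i)
    {w : Fin T → Obs d} (hw : ∀ t, (w t).1 ∈ unitCube d) (i : ℕ) (hi : i < M) (t : Fin T)
    (ht : t ∈ batch (T := T) Γ (i + 1)) :
    max (f 1 (w t).1) (f (-1) (w t).1) - f (pulled π w t) (w t).1
      ≤ clippedGap f (Δ i) (w t).1 + badRegret Γ g π μ f Δ i w (w t).1 := by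
  classical
  have hpull : (fun t => π t (fun s => (w s).1) (observed π w)) = pulled π w := by
    funext t; exact (pulled_eq hΓ hπ.1 w t).symm
  obtain ⟨q, hq, hqz, hcase⟩ := exists_active hL hβ hg hsm hf01 hΓ hπ hsc hcal hΔ0 hΔ hw (hw t) i
    (by omega)
  have hpol := hπ.2 (fun s => (w s).1) (observed π w) hw
  rw [hpull] at hpol
  have hmem : pulled π w t ∈ q.2 := by
    have hvis : t ∈ visits Γ g (fun s => (w s).1) (i + 1) q.1 := Finset.mem_filter.2 ⟨ht, hqz⟩
    -- The last batch has its own rule; in the others membership is part of round-robin.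
    by_cases hiM : i + 1 = M
    · subst hiM
      have := hpol.2 q hq t hvis
      rwa [← pulled_eq hΓ hπ.1] at this
    · exact (hpol.1 (i + 1) (Finset.mem_Icc.2 ⟨by omega, by omega⟩) q hq).1 t hvis
  have h0 := badRegret_nonneg (Γ := Γ) (g := g) (π := π) (μ := μ) f Δ i w (w t).1
  have h1 := clippedGap_nonneg f (Δ i) (w t).1
  rcases hcase with ⟨-, h | h⟩ | ⟨-, h⟩
  · have := max_sub_le_gap f (w t).1 (pulled π w t)
    rw [clippedGap_of_le h]; linarith
  · have := max_sub_le_gap f (w t).1 (pulled π w t)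
    linarith
  · have := h _ hmem
    linarith

end Path

/-! ### The expected regret on the product space -/

section Expected

variable {d T M : ℕ} {Γ g : ℕ → ℕ} {π : Policy d T} {μ : Measure (Obs d)} {f : Arm → Cov d → ℝ}

theorem batch_card (hΓ : IsGrid T M Γ) {i : ℕ} (hi : i ≤ M) :
    ((batch (T := T) Γ i).card : ℝ) = (Γ i : ℝ) - Γ (i - 1) := by
  have h1 : Γ (i - 1) ≤ Γ i := hΓ.le_of_le (by omega) hi
  have h2 : Γ i ≤ T := by
    have := hΓ.le_of_le hi le_rfl
    rwa [hΓ.2.1] at this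
  have : (batch (T := T) Γ i).card = Γ i - Γ (i - 1) := by
    have h3 : (batch (T := T) Γ i).map Fin.valEmbedding = Finset.Ico (Γ (i - 1)) (Γ i) := by
      ext n
      simp only [batch, Finset.mem_map, Finset.mem_filter, Finset.mem_univ, true_and,
        Fin.valEmbedding_apply, Finset.mem_Ico]
      constructor
      · rintro ⟨t, ht, rfl⟩; exact ht
      · intro hn; exact ⟨⟨n, by omega⟩, hn, rfl⟩
    rw [← Finset.card_map, h3, Nat.card_Ico]
  rw [this, Nat.cast_sub h1]

/-- The regret at time `t` along the sample path `w`. -/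
def regretAt (π : Policy d T) (f : Arm → Cov d → ℝ) (t : Fin T) (w : Fin T → Obs d) : ℝ :=
  max (f 1 (w t).1) (f (-1) (w t).1) - f (pulled π w t) (w t).1

theorem measurable_regretAt (hπ : IsBatchPolicy M Γ π) (hf : ∀ k, Measurable (f k)) (t : Fin T) :
    Measurable (regretAt π f t) := by
  have hx : Measurable fun w : Fin T → Obs d => (w t).1 := (measurable_pi_apply t).fst
  refine (((hf 1).comp hx).max ((hf (-1)).comp hx)).sub ?_
  have h2 : (fun w : Fin T → Obs d => f (pulled π w t) (w t).1)
      = fun w => ∑ k : Arm, ({k} : Set Arm).indicator 1 (pulled π w t) * f k (w t).1 := by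
    funext w
    rw [Finset.sum_eq_single (pulled π w t)]
    · simp
    · intro k _ hk; simp [Ne.symm hk]
    · exact fun h => absurd (Finset.mem_univ _) h
  rw [h2]
  exact Finset.measurable_sum _ fun k _ =>
    ((measurable_one.indicator (measurableSet_singleton k)).comp (measurable_pulled hπ t)).mul
      ((hf k).comp hx)

theorem regretAt_mem (hf01 : ∀ k x, f k x ∈ Set.Icc (0 : ℝ) 1) (t : Fin T) (w : Fin T → Obs d) :
    regretAt π f t w ∈ Set.Icc (0 : ℝ) 1 := by
  rw [regretAt]
  set z := (w t).1
  have h := hf01 (pulled π w t) z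
  have hm : max (f 1 z) (f (-1) z) ≤ 1 := max_le (hf01 1 z).2 (hf01 (-1) z).2
  refine ⟨?_, by linarith [h.1]⟩
  rw [sub_nonneg]
  rcases Int.units_eq_one_or (pulled π w t) with h1 | h1 <;> rw [h1]
  · exact le_max_left _ _
  · exact le_max_right _ _

theorem measurable_clippedGap (hf : ∀ k, Measurable (f k)) (δ : ℝ) :
    Measurable (clippedGap f δ) :=
  Measurable.ite (measurableSet_le ((hf 1).sub (hf (-1))).abs measurable_const)
    ((hf 1).sub (hf (-1))).abs measurable_const

/-- The margin condition bounds the mean of the clipped gap. -/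
theorem lintegral_clippedGap_le [IsProbabilityMeasure μ] {α δ₀ D₀ : ℝ} (hα : 0 < α) (hδ₀ : 0 < δ₀)
    (hD₀ : 0 < D₀)
    (hf : ∀ k, Measurable (f k))
    (hmargin : ∀ δ ∈ Set.Icc (0 : ℝ) δ₀,
      μ.real {z | 0 < |f 1 z.1 - f (-1) z.1| ∧ |f 1 z.1 - f (-1) z.1| ≤ δ} ≤ D₀ * δ ^ α)
    {δ : ℝ} (hδ : 0 ≤ δ) :
    ∫⁻ v, ENNReal.ofReal (clippedGap f δ v.1) ∂μ
      ≤ ENNReal.ofReal ((D₀ + δ₀ ^ (-α)) * δ ^ (1 + α)) := by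
  set A : Set (Obs d) := {z | 0 < |f 1 z.1 - f (-1) z.1| ∧ |f 1 z.1 - f (-1) z.1| ≤ δ} with hA
  have hgm : Measurable fun v : Obs d => |f 1 v.1 - f (-1) v.1| :=
    (((hf 1).comp measurable_fst).sub ((hf (-1)).comp measurable_fst)).abs
  have hAm : MeasurableSet A :=
    (measurableSet_lt measurable_const hgm).inter (measurableSet_le hgm measurable_const)
  have hAle : μ.real A ≤ (D₀ + δ₀ ^ (-α)) * δ ^ α := by
    have hp : 0 ≤ δ ^ α := Real.rpow_nonneg hδ _
    have hp' : 0 ≤ δ₀ ^ (-α) := Real.rpow_nonneg hδ₀.le _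
    -- Beyond δ₀ the margin condition is silent, but there 1 ≤ (δ/δ₀)^α; hence the extra constant
    -- δ₀^{-α}.
    rcases le_total δ δ₀ with h | h
    · refine (hmargin δ ⟨hδ, h⟩).trans ?_
      nlinarith
    · have h1 : δ₀ ^ (-α) * δ₀ ^ α = 1 := by rw [← Real.rpow_add hδ₀]; simp
      have h2 : δ₀ ^ α ≤ δ ^ α := Real.rpow_le_rpow hδ₀.le h hα.le
      have h3 : μ.real A ≤ 1 := measureReal_le_one
      nlinarith
  calc ∫⁻ v, ENNReal.ofReal (clippedGap f δ v.1) ∂μ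
      ≤ ∫⁻ v, A.indicator (fun _ => ENNReal.ofReal δ) v ∂μ := by
        refine lintegral_mono fun v => ?_
        by_cases hv : v ∈ A
        · rw [Set.indicator_of_mem hv]
          refine ENNReal.ofReal_le_ofReal ?_
          unfold clippedGap; split_ifs with h
          · exact h
          · exact hδ
        · rw [Set.indicator_of_notMem hv]
          simp only [nonpos_iff_eq_zero, ENNReal.ofReal_eq_zero]
          unfold clippedGap; split_ifs with h
          · by_contra hc
            exact hv ⟨not_le.1 hc, h⟩
          · exact le_rfl
    _ = ENNReal.ofReal δ * μ A := by rw [lintegral_indicator_const hAm]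
    _ = ENNReal.ofReal (δ * μ.real A) := by
        rw [ENNReal.ofReal_mul hδ, ofReal_measureReal]
    _ ≤ _ := by
        refine ENNReal.ofReal_le_ofReal ?_
        rw [Real.rpow_add' hδ (by linarith), Real.rpow_one]
        calc δ * μ.real A ≤ δ * ((D₀ + δ₀ ^ (-α)) * δ ^ α) := mul_le_mul_of_nonneg_left hAle hδ
          _ = _ := by ring

/-- The bin is selected by the second component, but there are only countably many nodes, and for
each the set is a rectangle. -/
theorem measurableSet_badAt (hπ : IsBatchPolicy M Γ π) (hf : ∀ k, Measurable (f k)) (i : ℕ) :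
    MeasurableSet {p : (Fin T → Obs d) × Obs d | p.1 ∈ badAt Γ g π μ f i p.2.1} := by
  have : {p : (Fin T → Obs d) × Obs d | p.1 ∈ badAt Γ g π μ f i p.2.1}
      = ⋃ C : Node d, (Prod.snd ⁻¹' (Prod.fst ⁻¹' {x : Cov d | nodeAt g i x = C})) ∩
        (Prod.fst ⁻¹' badEvent π f (batch Γ i) (C.bin g)
          (((Γ i : ℝ) - Γ (i - 1)) * (μ.map Prod.fst).real (C.bin g))
          (Real.log (2 * T * width g i ^ d))) := by
    ext p
    simp only [Set.mem_iUnion, Set.mem_inter_iff, Set.mem_preimage, Set.mem_ofPred_eq]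
    constructor
    · intro h; exact ⟨_, rfl, h⟩
    · rintro ⟨C, rfl, h⟩; exact h
  rw [this]
  refine MeasurableSet.iUnion fun C => MeasurableSet.inter ?_ ?_
  · exact ((measurableSet_nodeAt_eq i C).preimage measurable_fst).preimage measurable_snd
  · exact (measurableSet_badEvent hπ hf _ (measurableSet_bin C) _ _).preimage measurable_fst

/-- Bad events of earlier batches are untouched by resampling time `t`, so each term of `badRegret`
integrates to at most `p j * H j`. Extending the sum to all `j < M - 1` makes this part of the bound
the same for every batch. -/
theorem lintegral_regretAt_le [IsProbabilityMeasure μ] {L β K : ℝ} (hL : 0 < L) (hβ : 0 < β)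
    (hg : ∀ l, 0 < g l) (hf : ∀ k, Measurable (f k))
    (hsm : ∀ k, ∀ x ∈ unitCube d, ∀ x' ∈ unitCube d, |f k x - f k x'| ≤ L * ‖x - x'‖ ^ β)
    (hf01 : ∀ k x, f k x ∈ Set.Icc (0 : ℝ) 1) (hcube : ∀ᵐ z ∂μ, z.1 ∈ unitCube d)
    (hΓ : IsGrid T M Γ) (hπ : IsBaSEDB M Γ g π) (hsc : BatchScale d T M β L K Γ g μ)
    (hcal : IsCalibrated β L T M Γ g μ) {Δ : ℕ → ℝ} (hΔ0 : 1 ≤ Δ 0)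
    (hΔ : ∀ i, (3 / 2 * K + 2 * (L * (d : ℝ) ^ (β / 2))) * width g i ^ β ≤ Δ i)
    {H p : ℕ → ℝ} (hH0 : ∀ i, 0 ≤ H i) (hp0 : ∀ i, 0 ≤ p i)
    (hH : ∀ i, ∫⁻ v, ENNReal.ofReal (clippedGap f (Δ i) v.1) ∂μ ≤ ENNReal.ofReal (H i))
    (hp : ∀ i < M - 1, ∀ z, (Measure.pi fun _ : Fin T => μ) (badAt Γ g π μ f (i + 1) z)
      ≤ ENNReal.ofReal (p i))
    (i : ℕ) (hi : i < M) (t : Fin T) (ht : t ∈ batch (T := T) Γ (i + 1)) :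
    ∫⁻ w, ENNReal.ofReal (regretAt π f t w) ∂(Measure.pi fun _ : Fin T => μ)
      ≤ ENNReal.ofReal (H i + ∑ j ∈ Finset.range (M - 1), p j * H j) := by
  set ν := Measure.pi fun _ : Fin T => μ
  set h : ℕ → Obs d → ℝ≥0∞ := fun j v => ENNReal.ofReal (clippedGap f (Δ j) v.1) with hh
  have hhm : ∀ j, Measurable (h j) := fun j =>
    ((measurable_clippedGap hf (Δ j)).comp measurable_fst).ennreal_ofReal
  set E : ℕ → Set ((Fin T → Obs d) × Obs d) :=
    fun j => {p | p.1 ∈ badAt Γ g π μ f (j + 1) p.2.1} with hE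
  have hcube' : ∀ᵐ w ∂ν, ∀ t, (w t).1 ∈ unitCube d := by
    rw [ae_all_iff]
    intro t
    exact (measurePreserving_eval (fun _ : Fin T => μ) t).quasiMeasurePreserving.ae hcube
  have hEm : ∀ j, MeasurableSet (E j) := fun j => measurableSet_badAt hπ.1 hf (j + 1)
  have hm2 : ∀ j, Measurable fun w : Fin T → Obs d =>
      h j (w t) * (E j).indicator (1 : (Fin T → Obs d) × Obs d → ℝ≥0∞) (w, w t) := fun j =>
    ((hhm j).comp (measurable_pi_apply t)).mul ((measurable_one.indicator (hEm j)).comp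
      (measurable_id.prodMk (measurable_pi_apply t)))
  have hptw : ∀ᵐ w ∂ν, ENNReal.ofReal (regretAt π f t w) ≤
      h i (w t) + ∑ j ∈ Finset.range i,
        h j (w t) * (E j).indicator (1 : (Fin T → Obs d) × Obs d → ℝ≥0∞) (w, w t) := by
    filter_upwards [hcube'] with w hw
    refine (ENNReal.ofReal_le_ofReal (regret_at_le hL hβ hg hsm hf01 hΓ hπ hsc hcal hΔ0 hΔ hw i hi
      t ht)).trans ?_
    have hnn : ∀ j ∈ Finset.range i, 0 ≤ clippedGap f (Δ j) (w t).1 *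
        (badAt Γ g π μ f (j + 1) (w t).1).indicator (1 : (Fin T → Obs d) → ℝ) w := fun j _ =>
      mul_nonneg (clippedGap_nonneg _ _ _) (Set.indicator_nonneg (fun _ _ => zero_le_one) _)
    rw [ENNReal.ofReal_add (clippedGap_nonneg _ _ _) (badRegret_nonneg _ _ _ _ _), badRegret,
      ENNReal.ofReal_sum_of_nonneg hnn]
    refine add_le_add le_rfl (Finset.sum_le_sum fun j _ => ?_)
    rw [ENNReal.ofReal_mul (clippedGap_nonneg _ _ _)]
    refine mul_le_mul_right ?_ _
    by_cases hb : w ∈ badAt Γ g π μ f (j + 1) (w t).1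
    · rw [Set.indicator_of_mem hb, Set.indicator_of_mem (by exact hb)]; simp
    · rw [Set.indicator_of_notMem hb]; simp
  have hone : ∀ j < i, ∫⁻ w, h j (w t) *
      (E j).indicator (1 : (Fin T → Obs d) × Obs d → ℝ≥0∞) (w, w t) ∂ν
      ≤ ENNReal.ofReal (p j * H j) := by
    intro j hj
    -- Batch j + 1 with j < i ends no later than batch i, hence before time `t` of batch i + 1.
    have hlt : ∀ s ∈ batch (T := T) Γ (j + 1), s < t := by
      intro s hs
      have h1 := (Finset.mem_filter.1 hs).2.2
      have h2 := (Finset.mem_filter.1 ht).2.1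
      have h3 : Γ (j + 1) ≤ Γ i := hΓ.le_of_le (by omega) hi.le
      rw [Nat.add_sub_cancel] at h2
      exact Fin.lt_def.2 (by omega)
    refine (lintegral_selected_le μ t (hhm j) (E j) (hEm j) ?_ (ENNReal.ofReal (p j)) ?_).trans ?_
    · intro w u v
      exact badEvent_update hΓ hπ.1 hlt w u
    · intro v
      exact hp j (by omega) v.1
    · rw [ENNReal.ofReal_mul (hp0 j)]
      exact mul_le_mul_right (hH j) _
  calc _ ≤ ∫⁻ w, (h i (w t) + ∑ j ∈ Finset.range i,
        h j (w t) * (E j).indicator (1 : (Fin T → Obs d) × Obs d → ℝ≥0∞) (w, w t)) ∂ν :=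
        lintegral_mono_ae hptw
    _ = ∫⁻ w, h i (w t) ∂ν + ∑ j ∈ Finset.range i, ∫⁻ w,
        h j (w t) * (E j).indicator (1 : (Fin T → Obs d) × Obs d → ℝ≥0∞) (w, w t) ∂ν := by
        have hmi : Measurable fun w : Fin T → Obs d => h i (w t) :=
          (hhm i).comp (measurable_pi_apply t)
        rw [lintegral_add_left hmi, lintegral_finsetSum _ fun j _ => hm2 j]
    _ ≤ ENNReal.ofReal (H i) + ∑ j ∈ Finset.range i, ENNReal.ofReal (p j * H j) := by
        refine add_le_add ?_ (Finset.sum_le_sum fun j hj => hone j (Finset.mem_range.1 hj))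
        rw [(measurePreserving_eval (fun _ : Fin T => μ) t).lintegral_comp (hhm i)]
        exact hH i
    _ ≤ ENNReal.ofReal (H i) + ∑ j ∈ Finset.range (M - 1), ENNReal.ofReal (p j * H j) := by
        refine add_le_add le_rfl (Finset.sum_le_sum_of_subset ?_)
        exact Finset.range_mono (by omega)
    _ = _ := by
        rw [ENNReal.ofReal_add (hH0 i) (Finset.sum_nonneg fun j _ => mul_nonneg (hp0 j) (hH0 j)),
          ENNReal.ofReal_sum_of_nonneg fun j _ => mul_nonneg (hp0 j) (hH0 j)]

theorem integral_sum_regretAt_le [IsProbabilityMeasure μ] (hπ : IsBatchPolicy M Γ π)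
    (hf : ∀ k, Measurable (f k)) (hf01 : ∀ k x, f k x ∈ Set.Icc (0 : ℝ) 1)
    (hΓ : IsGrid T M Γ) {H : ℕ → ℝ} {q : ℝ} (hH0 : ∀ i, 0 ≤ H i) (hq0 : 0 ≤ q)
    (h : ∀ i < M, ∀ t ∈ batch (T := T) Γ (i + 1),
      ∫⁻ w, ENNReal.ofReal (regretAt π f t w) ∂(Measure.pi fun _ : Fin T => μ)
        ≤ ENNReal.ofReal (H i + q)) :
    ∫ w, ∑ t, regretAt π f t w ∂(Measure.pi fun _ : Fin T => μ)
      ≤ ∑ i ∈ Finset.range M, ((Γ (i + 1) : ℝ) - Γ i) * H i + T * q := by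
  have hint : ∀ t, Integrable (regretAt π f t) (Measure.pi fun _ : Fin T => μ) := fun t =>
    Integrable.of_bound (measurable_regretAt hπ hf t).aestronglyMeasurable 1
      (Filter.Eventually.of_forall fun w => by
        have := regretAt_mem (π := π) hf01 t w
        rw [Real.norm_eq_abs, abs_of_nonneg this.1]; exact this.2)
  rw [integral_finsetSum _ fun t _ => hint t]
  have hone : ∀ t, ∫ w, regretAt π f t w ∂(Measure.pi fun _ : Fin T => μ)
      ≤ ∑ i ∈ Finset.range M, (if t ∈ batch (T := T) Γ (i + 1) then H i else 0) + q := by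
    intro t
    obtain ⟨i, hi, hti⟩ := hΓ.exists_mem_batch t
    obtain ⟨i, rfl⟩ : ∃ j, i = j + 1 := ⟨i - 1, by have := (Finset.mem_Icc.1 hi).1; omega⟩
    have hiM : i < M := (Finset.mem_Icc.1 hi).2
    rw [integral_eq_lintegral_of_nonneg_ae
      (Filter.Eventually.of_forall fun w => (regretAt_mem hf01 t w).1)
      (measurable_regretAt hπ hf t).aestronglyMeasurable]
    have h1 : (∫⁻ w, ENNReal.ofReal (regretAt π f t w) ∂(Measure.pi fun _ : Fin T => μ)).toReal
        ≤ H i + q := by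
      refine ENNReal.toReal_le_of_le_ofReal (add_nonneg (hH0 i) hq0) (h i hiM t hti)
    refine h1.trans (add_le_add ?_ le_rfl)
    have := Finset.single_le_sum (f := fun i => if t ∈ batch (T := T) Γ (i + 1) then H i else 0)
      (fun i _ => by split_ifs; exacts [hH0 i, le_rfl]) (Finset.mem_range.2 hiM)
    simpa [hti] using this
  refine (Finset.sum_le_sum fun t _ => hone t).trans (le_of_eq ?_)
  rw [Finset.sum_add_distrib, Finset.sum_comm]
  congr 1
  · refine Finset.sum_congr rfl fun i hi => ?_
    rw [Finset.sum_ite_mem, Finset.univ_inter, Finset.sum_const, nsmul_eq_mul,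
      batch_card hΓ (Finset.mem_range.1 hi)]
    rfl
  · simp

end Expected

/-! ### The split factors -/

section SplitFactors

/-- `1 + γ + ⋯ + γ^{n-1}` in closed form. -/
def geomExp (γ : ℝ) (n : ℕ) : ℝ := (1 - γ ^ n) / (1 - γ)

variable {γ : ℝ}

theorem geomExp_zero : geomExp γ 0 = 0 := by simp [geomExp]

theorem geomExp_succ (h1 : γ < 1) (n : ℕ) : geomExp γ (n + 1) = 1 + γ * geomExp γ n := by
  have : 1 - γ ≠ 0 := by linarith
  rw [geomExp, geomExp, pow_succ]; field_simp; ring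

theorem geomExp_nonneg (h0 : 0 < γ) (h1 : γ < 1) (n : ℕ) : 0 ≤ geomExp γ n :=
  div_nonneg (sub_nonneg.2 (pow_le_one₀ h0.le h1.le)) (by linarith)

theorem geomExp_le (h0 : 0 < γ) (h1 : γ < 1) (n : ℕ) : geomExp γ n ≤ 1 / (1 - γ) := by
  have := pow_nonneg h0.le n
  exact div_le_div_of_nonneg_right (by linarith) (by linarith)

/-- Rounding down in the recursion `a ↦ ⌊a ^ γ⌋` costs only a constant factor in the product. -/
theorem sum_log_ge (h0 : 0 < γ) (h1 : γ < 1) (n : ℕ) (a : ℕ → ℕ) (ha : 1 ≤ a 0)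
    (hrec : ∀ l, l + 1 < n → a (l + 1) = ⌊(a l : ℝ) ^ γ⌋₊) :
    geomExp γ n * Real.log (a 0) + 1 / ((1 - γ) * (1 - 2 ^ (γ - 1))) * (1 / (a 0 : ℝ) - 1)
      ≤ ∑ l ∈ Finset.range n, Real.log (a l) := by
  -- Rounding x^γ down to y costs at most 1/y in the logarithm, weighted by a geometric sum at most
  -- 1/(1-γ). While x ≥ 2, y/x ≤ 2^{γ-1}, so with this `A` the cost is at most A(1/y - 1/x), which
  -- telescopes; once x = 1 nothing is lost.
  set A := 1 / ((1 - γ) * (1 - (2 : ℝ) ^ (γ - 1))) with hA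
  have h2 : (2 : ℝ) ^ (γ - 1) < 1 :=
    Real.rpow_lt_one_of_one_lt_of_neg (by norm_num) (by linarith)
  have hA0 : 0 < A := by
    rw [hA]; exact one_div_pos.2 (mul_pos (by linarith) (by linarith))
  induction n generalizing a with
  | zero =>
    have : (1 : ℝ) ≤ a 0 := by exact_mod_cast ha
    have h3 : 1 / (a 0 : ℝ) ≤ 1 := by rw [div_le_one (by linarith)]; exact this
    simp only [geomExp_zero, zero_mul, zero_add, Finset.range_zero, Finset.sum_empty]
    nlinarith
  | succ n ih =>
    have hx1 : (1 : ℝ) ≤ a 0 := by exact_mod_cast ha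
    have hx0 : (0 : ℝ) < a 0 := by linarith
    rw [Finset.sum_range_succ', geomExp_succ h1]
    rcases Nat.eq_zero_or_pos n with rfl | hn
    · have h3 : 1 / (a 0 : ℝ) ≤ 1 := by rw [div_le_one (by linarith)]; exact hx1
      simp only [geomExp_zero, Finset.range_zero, Finset.sum_empty]
      nlinarith
    · have hr := hrec 0 (by omega)
      have hge : (1 : ℝ) ≤ (a 0 : ℝ) ^ γ := Real.one_le_rpow hx1 h0.le
      have ha1 : 1 ≤ a 1 := by rw [hr]; exact Nat.le_floor (by exact_mod_cast hge)
      have key := ih (fun l => a (l + 1)) ha1 fun l hl => hrec (l + 1) (by omega)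
      simp only [zero_add] at key
      set x : ℝ := (a 0 : ℝ)
      set y : ℝ := (a 1 : ℝ) with hy
      have hy1 : (1 : ℝ) ≤ y := by rw [hy]; exact_mod_cast ha1
      have hyx : y ≤ x ^ γ := by
        rw [hy, hr]; exact Nat.floor_le (by positivity)
      have hxy : x ^ γ < y + 1 := by rw [hy, hr]; exact Nat.lt_floor_add_one _
      have hS := geomExp_nonneg h0 h1 n
      have hS' := geomExp_le h0 h1 n
      -- the loss of one step
      have hloss : γ * geomExp γ n * Real.log x + A * (1 / x - 1)
          ≤ geomExp γ n * Real.log y + A * (1 / y - 1) := by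
        rcases Nat.lt_or_ge 1 (a 0) with hbig | hsmall
        · have hx2 : (2 : ℝ) ≤ (a 0 : ℝ) := by exact_mod_cast (show 2 ≤ a 0 from hbig)
          have hlog : γ * Real.log x ≤ Real.log y + 1 / y := by
            rw [← Real.log_rpow hx0]
            calc Real.log (x ^ γ) ≤ Real.log (y * (1 + 1 / y)) := by
                  refine Real.log_le_log (by positivity) ?_
                  have : y * (1 + 1 / y) = y + 1 := by field_simp
                  rw [this]; exact hxy.le
              _ = Real.log y + Real.log (1 + 1 / y) :=
                  Real.log_mul (by linarith) (by positivity)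
              _ ≤ _ := by
                  have := Real.log_le_sub_one_of_pos (show 0 < 1 + 1 / y by positivity)
                  linarith
          have hratio : y / x ≤ 2 ^ (γ - 1) := by
            calc y / x ≤ x ^ γ / x := by gcongr
              _ = x ^ (γ - 1) := by rw [Real.rpow_sub_one hx0.ne']
              _ ≤ 2 ^ (γ - 1) := Real.rpow_le_rpow_of_nonpos (by norm_num) hx2 (by linarith)
          have hAy : 1 / (1 - γ) ≤ A * (1 - y / x) := by
            have : 1 / (1 - γ) = A * (1 - 2 ^ (γ - 1)) := by
              rw [hA]
              have h3 : (1 : ℝ) - 2 ^ (γ - 1) ≠ 0 := by linarith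
              have h4 : 1 - γ ≠ 0 := by linarith
              field_simp
            rw [this]
            exact mul_le_mul_of_nonneg_left (by linarith) hA0.le
          have h5 : geomExp γ n * (1 / y) ≤ A * (1 / y) - A * (1 / x) := by
            have : A * (1 / y) - A * (1 / x) = A * (1 - y / x) * (1 / y) := by
              field_simp
            rw [this]
            exact mul_le_mul_of_nonneg_right (hS'.trans hAy) (by positivity)
          have h6 := mul_le_mul_of_nonneg_left hlog hS
          nlinarith
        · have hx : x = 1 := by
            have : a 0 = 1 := le_antisymm hsmall ha
            simp [x, this]
          have hy' : y = 1 := by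
            rw [hx, Real.one_rpow] at hyx
            exact le_antisymm hyx hy1
          rw [hx, hy']; simp
      linarith

theorem geomExp_mul_rate (h0 : 0 < γ) (h1 : γ < 1) {M : ℕ} (hM : 1 ≤ M) (n : ℕ) :
    (1 - γ) / (1 - γ ^ M) * geomExp γ n = (1 - γ ^ n) / (1 - γ ^ M) := by
  have h3 : 1 - γ ≠ 0 := by linarith
  have h4 : 1 - γ ^ M ≠ 0 := by
    have := pow_lt_one₀ h0.le h1 (by omega : M ≠ 0); linarith
  rw [geomExp]; field_simp

variable {d : ℕ} {α β b : ℝ} {M : ℕ}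

theorem gammaExp_pos (hα : 0 < α) (hβ : 0 < β) : 0 < gammaExp d α β := by
  unfold gammaExp; positivity

theorem gammaExp_lt_one (hd : 0 < d) (hβ : 0 < β) (hαβ : α * β ≤ 1) :
    gammaExp d α β < 1 := by
  have : (1 : ℝ) ≤ d := by exact_mod_cast hd
  unfold gammaExp
  rw [div_lt_one (by positivity)]
  nlinarith

theorem gammaExp_mul (hβ : 0 < β) : gammaExp d α β * (2 * β + d) = β * (1 + α) := by
  unfold gammaExp
  have : (2 * β + d : ℝ) ≠ 0 := by positivity
  field_simp

theorem splitFactor_pos (hγ : 0 < gammaExp d α β) (h0 : 1 ≤ splitFactor d α β b M 0) (l : ℕ) :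
    0 < splitFactor d α β b M l := by
  induction l with
  | zero => exact h0
  | succ l ih =>
    rw [splitFactor]
    split_ifs
    · refine Nat.le_floor ?_
      push_cast
      exact Real.one_le_rpow (by exact_mod_cast ih) hγ.le
    · exact Nat.one_pos

theorem splitFactor_succ_le (hγ : 0 < gammaExp d α β) (h0 : 1 ≤ splitFactor d α β b M 0) (l : ℕ) :
    (splitFactor d α β b M (l + 1) : ℝ) ≤ (splitFactor d α β b M l : ℝ) ^ gammaExp d α β := by
  have := splitFactor_pos hγ h0 l
  rw [splitFactor]
  split_ifs
  · exact Nat.floor_le (by positivity)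
  · push_cast
    exact Real.one_le_rpow (by exact_mod_cast this) hγ.le

/-- Each factor after the first is at most the γ-th power of its predecessor, so shifting the
product by one index costs `g 0`. Rounding down only helps here. -/
theorem binCount_succ_le (hγ : 0 < gammaExp d α β) (h0 : 1 ≤ splitFactor d α β b M 0) (i : ℕ) :
    (binCount (splitFactor d α β b M) (i + 1) : ℝ)
      ≤ splitFactor d α β b M 0 * (binCount (splitFactor d α β b M) i : ℝ) ^ gammaExp d α β := by
  induction i with
  | zero => simp [binCount]
  | succ i ih =>
    rw [binCount_succ, Nat.cast_mul]
    conv_rhs => rw [binCount_succ, Nat.cast_mul, Real.mul_rpow (by positivity) (by positivity),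
      ← mul_assoc]
    exact mul_le_mul ih (splitFactor_succ_le hγ h0 i) (by positivity) (by positivity)

theorem binCount_le_rpow (hγ : 0 < gammaExp d α β) (hγ1 : gammaExp d α β < 1)
    (h0 : 1 ≤ splitFactor d α β b M 0) (i : ℕ) :
    (binCount (splitFactor d α β b M) i : ℝ)
      ≤ (splitFactor d α β b M 0 : ℝ) ^ geomExp (gammaExp d α β) i := by
  have hpos : (0 : ℝ) < splitFactor d α β b M 0 := by exact_mod_cast h0
  induction i with
  | zero => simp [binCount, geomExp_zero]
  | succ i ih =>
    refine (binCount_succ_le hγ h0 i).trans ?_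
    rw [geomExp_succ hγ1, Real.rpow_add hpos, Real.rpow_one]
    refine mul_le_mul_of_nonneg_left ?_ hpos.le
    rw [mul_comm, Real.rpow_mul hpos.le]
    exact Real.rpow_le_rpow (by positivity) ih hγ.le

theorem splitFactor_zero_rpow_le (hβ : 0 < β) (hb : 0 ≤ b) :
    (splitFactor d α β b M 0 : ℝ) ^ (2 * β + d) ≤ b := by
  have hq : (0 : ℝ) < 2 * β + d := by positivity
  calc (splitFactor d α β b M 0 : ℝ) ^ (2 * β + d)
      ≤ (b ^ (1 / (2 * β + d))) ^ (2 * β + d) := by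
        refine Real.rpow_le_rpow (by positivity) ?_ hq.le
        rw [splitFactor]; exact Nat.floor_le (by positivity)
    _ = b := by rw [← Real.rpow_mul hb, one_div_mul_cancel hq.ne', Real.rpow_one]

/-- The size of batch `i + 1` compensates the gap after batch `i`. -/
theorem width_trade_off (hα : 0 < α) (hβ : 0 < β) (hb : 0 ≤ b)
    (h0 : 1 ≤ splitFactor d α β b M 0) (i : ℕ) :
    width (splitFactor d α β b M) (i + 1) ^ (-(2 * β + d))
      * width (splitFactor d α β b M) i ^ (β * (1 + α)) ≤ b := by
  set g := splitFactor d α β b M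
  have hγ : 0 < gammaExp d α β := gammaExp_pos hα hβ
  have hq : (0 : ℝ) < 2 * β + d := by positivity
  have hg := splitFactor_pos hγ h0
  have hG : ∀ i, (0 : ℝ) < binCount g i := fun i => by exact_mod_cast binCount_pos hg i
  rw [width_eq, width_eq, Real.rpow_neg (inv_nonneg.2 (hG _).le), Real.inv_rpow (hG _).le,
    Real.inv_rpow (hG _).le, inv_inv, ← div_eq_mul_inv,
    div_le_iff₀ (Real.rpow_pos_of_pos (hG i) _)]
  -- γ is defined so that γ(2β+d) = β(1+α): the powers of `binCount g i` then match, leaving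
  -- g₀^{2β+d} ≤ b.
  calc (binCount g (i + 1) : ℝ) ^ (2 * β + d)
      ≤ (g 0 * (binCount g i : ℝ) ^ gammaExp d α β) ^ (2 * β + d) :=
        Real.rpow_le_rpow (hG _).le (binCount_succ_le hγ h0 i) hq.le
    _ = (g 0 : ℝ) ^ (2 * β + d) * (binCount g i : ℝ) ^ (β * (1 + α)) := by
        rw [Real.mul_rpow (by positivity) (Real.rpow_nonneg (hG i).le _), ← Real.rpow_mul (hG i).le,
          gammaExp_mul hβ]
    _ ≤ b * _ := mul_le_mul_of_nonneg_right (splitFactor_zero_rpow_le hβ hb)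
        (Real.rpow_nonneg (hG i).le _)

/-- The bins of each layer up to `M` are wide enough to be visited often. -/
theorem binCount_rpow_le (hα : 0 < α) (hβ : 0 < β) (hγ1 : gammaExp d α β < 1)
    (h0 : 1 ≤ splitFactor d α β b M 0) {bHi T : ℝ} (hT : 1 ≤ T) (hb : 0 ≤ b)
    (hbu : b ≤ bHi * T ^ rateExp d α β M) (hM : 1 ≤ M) {i : ℕ} (hi : i ≤ M) :
    (binCount (splitFactor d α β b M) i : ℝ) ^ (2 * β + d)
      ≤ max 1 bHi ^ (1 / (1 - gammaExp d α β)) * T := by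
  have hγ : 0 < gammaExp d α β := gammaExp_pos hα hβ
  have hq : (0 : ℝ) < 2 * β + d := by positivity
  set γ := gammaExp d α β with hγd
  set g := splitFactor d α β b M
  have hS := geomExp_nonneg hγ hγ1 i
  have hTr : 0 ≤ T ^ rateExp d α β M := Real.rpow_nonneg (by linarith) _
  have hB : 1 ≤ max 1 bHi := le_max_left _ _
  calc (binCount g i : ℝ) ^ (2 * β + d) ≤ ((g 0 : ℝ) ^ geomExp γ i) ^ (2 * β + d) :=
        Real.rpow_le_rpow (by positivity) (binCount_le_rpow hγ hγ1 h0 i) hq.le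
    _ = ((g 0 : ℝ) ^ (2 * β + d)) ^ geomExp γ i := by
        rw [← Real.rpow_mul (by positivity), ← Real.rpow_mul (by positivity), mul_comm]
    _ ≤ b ^ geomExp γ i :=
        Real.rpow_le_rpow (by positivity) (splitFactor_zero_rpow_le hβ hb) hS
    _ ≤ (max 1 bHi * T ^ rateExp d α β M) ^ geomExp γ i := by
        refine Real.rpow_le_rpow hb (hbu.trans ?_) hS
        exact mul_le_mul_of_nonneg_right (le_max_right _ _) hTr
    _ = max 1 bHi ^ geomExp γ i * T ^ ((1 - γ ^ i) / (1 - γ ^ M)) := by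
        rw [Real.mul_rpow (by linarith) hTr, ← Real.rpow_mul (by linarith), rateExp,
          geomExp_mul_rate hγ hγ1 hM]
    _ ≤ max 1 bHi ^ (1 / (1 - γ)) * T ^ (1 : ℝ) := by
        refine mul_le_mul (Real.rpow_le_rpow_of_exponent_le hB (geomExp_le hγ hγ1 i))
          (Real.rpow_le_rpow_of_exponent_le hT ?_) (Real.rpow_nonneg (by linarith) _)
          (Real.rpow_nonneg (by linarith) _)
        have h1 := pow_lt_one₀ hγ.le hγ1 (by omega : M ≠ 0)
        have h2 := pow_le_pow_of_le_one hγ.le hγ1.le hi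
        rw [div_le_one (by linarith)]; linarith
    _ = _ := by rw [Real.rpow_one]

/-- The bins at the end of the last but one batch are narrow enough. -/
theorem last_batch_le (hα : 0 < α) (hβ : 0 < β) (hγ1 : gammaExp d α β < 1)
    (h0 : 1 ≤ splitFactor d α β b M 0) {bLo T : ℝ} (hbLo : 0 < bLo) (hT : 1 ≤ T)
    (hlog : 1 ≤ Real.log T)
    (hbl : bLo * T ^ rateExp d α β M / Real.log T ^ (2 * (1 - gammaExp d α β)) ≤ b)
    (hM : 1 ≤ M) :
    T * width (splitFactor d α β b M) (M - 1) ^ (β * (1 + α))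
      ≤ Real.exp (β * (1 + α) / ((1 - gammaExp d α β) * (1 - 2 ^ (gammaExp d α β - 1))))
        * 2 ^ (β * (1 + α) / (1 - gammaExp d α β))
        * (min 1 bLo)⁻¹ ^ (1 / (1 - gammaExp d α β))
        * Real.log T ^ 2 * T ^ rateExp d α β M := by
  have hγ : 0 < gammaExp d α β := gammaExp_pos hα hβ
  have hq : (0 : ℝ) < 2 * β + d := by positivity
  have hγq := gammaExp_mul (d := d) (α := α) hβ
  set γ := gammaExp d α β with hγd
  set g := splitFactor d α β b M with hg
  set n := M - 1 with hn
  have hgpos := splitFactor_pos hγ h0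
  have hT0 : 0 < T := by linarith
  have hrate : rateExp d α β M = (1 - γ) / (1 - γ ^ M) := rfl
  have hS := geomExp_nonneg hγ hγ1 n
  have hS' := geomExp_le hγ hγ1 n
  have hlog0 : 0 < Real.log T := by linarith
  have hG : (0 : ℝ) < binCount g n := by exact_mod_cast binCount_pos hgpos n
  have hTr : 0 < T ^ rateExp d α β M := Real.rpow_pos_of_pos hT0 _
  have hLr : 0 < Real.log T ^ (2 * (1 - γ)) := Real.rpow_pos_of_pos hlog0 _
  have hb0 : 0 < b := lt_of_lt_of_le (div_pos (mul_pos hbLo hTr) hLr) hbl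
  set A := 1 / ((1 - γ) * (1 - (2 : ℝ) ^ (γ - 1))) with hA
  have h2 : (2 : ℝ) ^ (γ - 1) < 1 :=
    Real.rpow_lt_one_of_one_lt_of_neg (by norm_num) (by linarith)
  have hA0 : 0 < A := by
    rw [hA]; exact one_div_pos.2 (mul_pos (by linarith) (by linarith))
  have hg0 : (1 : ℝ) ≤ g 0 := by exact_mod_cast h0
  -- logarithm of the number of bins
  have hsum := sum_log_ge hγ hγ1 n g h0 fun l hl => by
    rw [hg, splitFactor, if_pos (by omega)]
  have hlogG : Real.log (binCount g n) = ∑ l ∈ Finset.range n, Real.log (g l) := by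
    rw [binCount]; push_cast
    exact Real.log_prod fun l _ => by exact_mod_cast (hgpos l).ne'
  -- The floor at most halves the first factor: b^{1/(2β+d)} < g₀ + 1 ≤ 2g₀.
  have hlogg0 : 1 / (2 * β + d) * Real.log b - Real.log 2 ≤ Real.log (g 0) := by
    rw [← Real.log_rpow hb0, ← Real.log_div (Real.rpow_pos_of_pos hb0 _).ne' (by norm_num)]
    refine Real.log_le_log (div_pos (Real.rpow_pos_of_pos hb0 _) (by norm_num)) ?_
    have : b ^ (1 / (2 * β + d)) < g 0 + 1 := by
      rw [hg, splitFactor]; exact Nat.lt_floor_add_one _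
    linarith
  have hlogb : Real.log (min 1 bLo) + rateExp d α β M * Real.log T
      - 2 * (1 - γ) * Real.log (Real.log T) ≤ Real.log b := by
    have h3 := Real.log_le_log (div_pos (mul_pos hbLo hTr) hLr) hbl
    rw [Real.log_div (mul_pos hbLo hTr).ne' hLr.ne', Real.log_mul hbLo.ne' hTr.ne',
      Real.log_rpow hT0, Real.log_rpow hlog0] at h3
    have h4 := Real.log_le_log (lt_min one_pos hbLo) (min_le_right 1 bLo)
    linarith
  -- With `min 1 bLo` for `bLo` the logarithm is nonpositive, so the exponent depending on `n` may
  -- be raised to 1/(1-γ).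
  have hmin : Real.log (min 1 bLo) ≤ 0 :=
    Real.log_nonpos (le_min zero_le_one hbLo.le) (min_le_left _ _)
  have hmin0 : 0 < min 1 bLo := lt_min one_pos hbLo
  have hll : 0 ≤ Real.log (Real.log T) := Real.log_nonneg hlog
  have hl2 : 0 < Real.log 2 := Real.log_pos (by norm_num)
  have hG1 : geomExp γ n * (1 / (2 * β + d) * Real.log b - Real.log 2) - A
      ≤ Real.log (binCount g n) := by
    rw [hlogG]
    have h5 := mul_le_mul_of_nonneg_left hlogg0 hS
    have h6 : 0 ≤ A * (1 / (g 0 : ℝ)) := by positivity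
    linarith
  have hpn : γ ^ M = γ ^ n * γ := by rw [← pow_succ]; congr 1; omega
  have hpM := pow_lt_one₀ hγ.le hγ1 (by omega : M ≠ 0)
  -- the exponents
  have hexp : γ * geomExp γ n * rateExp d α β M = 1 - rateExp d α β M := by
    have := geomExp_mul_rate hγ hγ1 hM n
    rw [hrate, mul_assoc, mul_comm (geomExp γ n), this]
    have h7 : 1 - γ ^ M ≠ 0 := by linarith
    rw [hpn] at h7 ⊢
    rw [eq_sub_iff_add_eq, ← mul_div_assoc, ← add_div, div_eq_one_iff_eq h7]
    ring
  -- The factor (log T)^{-2(1-γ)} allowed in b gets raised to the power γ·`geomExp γ n`; this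
  -- inequality limits the loss to (log T)².
  have hexp2 : γ * geomExp γ n * (1 - γ) ≤ 1 := by
    have : γ * geomExp γ n * (1 - γ) = γ * (1 - γ ^ n) := by
      rw [geomExp]; field_simp [show (1 : ℝ) - γ ≠ 0 by linarith]
    rw [this]
    have := pow_nonneg hγ.le n
    nlinarith
  have hexp3 : γ * geomExp γ n ≤ 1 / (1 - γ) := by nlinarith
  -- everything in logarithms
  rw [← Real.log_le_log_iff (by
    have : 0 < width g n := width_pos hgpos n
    positivity) (by positivity)]
  have hw0 : 0 < width g n := width_pos hgpos n
  rw [Real.log_mul hT0.ne' (Real.rpow_pos_of_pos hw0 _).ne', Real.log_rpow hw0, width_eq,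
    Real.log_inv, Real.log_mul (by positivity) (by positivity),
    Real.log_mul (by positivity) (by positivity), Real.log_mul (by positivity) (by positivity),
    Real.log_mul (by positivity) (by positivity), Real.log_exp, Real.log_rpow (by norm_num),
    Real.log_rpow (by positivity), Real.log_rpow hT0, one_div, Real.log_inv, Real.log_pow]
  have hA' : β * (1 + α) / ((1 - γ) * (1 - 2 ^ (γ - 1))) = β * (1 + α) * A := by
    rw [hA]; ring
  rw [hA', ← hγq]
  have hq1 : (2 * β + d) * (1 / (2 * β + d)) = 1 := by field_simp
  have h8 := mul_le_mul_of_nonneg_left hG1 (mul_pos hγ hq).le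
  have h9 := mul_le_mul_of_nonneg_left hlogb (mul_nonneg hγ.le hS)
  have e1 : γ * (2 * β + d) * (geomExp γ n * (1 / (2 * β + d) * Real.log b - Real.log 2) - A)
      = γ * geomExp γ n * Real.log b * ((2 * β + d) * (1 / (2 * β + d)))
        - γ * (2 * β + d) * (geomExp γ n * Real.log 2) - γ * (2 * β + d) * A := by ring
  rw [e1, hq1, mul_one] at h8
  have e2 : γ * geomExp γ n * (Real.log (min 1 bLo) + rateExp d α β M * Real.log T
      - 2 * (1 - γ) * Real.log (Real.log T))
      = γ * geomExp γ n * Real.log (min 1 bLo) + (γ * geomExp γ n * rateExp d α β M) * Real.log T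
        - 2 * (γ * geomExp γ n * (1 - γ)) * Real.log (Real.log T) := by ring
  rw [e2, hexp] at h9
  have h10 : γ * (2 * β + d) * (geomExp γ n * Real.log 2)
      ≤ γ * (2 * β + d) / (1 - γ) * Real.log 2 := by
    have := mul_le_mul_of_nonneg_right hS' hl2.le
    have := mul_le_mul_of_nonneg_left this (mul_pos hγ hq).le
    calc _ ≤ _ := this
      _ = _ := by ring
  have h11 : (1 - γ)⁻¹ * Real.log (min 1 bLo) ≤ γ * geomExp γ n * Real.log (min 1 bLo) := by
    rw [← one_div]
    exact mul_le_mul_of_nonpos_right hexp3 hmin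
  have h12 : (γ * geomExp γ n * (1 - γ)) * Real.log (Real.log T) ≤ 1 * Real.log (Real.log T) :=
    mul_le_mul_of_nonneg_right hexp2 hll
  push_cast
  linarith

end SplitFactors

/-! ### The batch sizes -/

section BatchSizes

variable {d T M : ℕ} {Γ g : ℕ → ℕ} {μ : Measure (Obs d)} {f : Arm → Cov d → ℝ}

theorem log_two_mul_le {x : ℝ} (hx : 2 ≤ x) : Real.log (2 * x) ≤ 2 * Real.log x := by
  rw [Real.log_mul (by norm_num) (by linarith)]
  have := Real.log_le_log (by norm_num) hx
  linarith

/-- The expected number of visits to a bin is at least logarithmic, the threshold is of the order of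
the oscillation of the mean rewards over the bin, and there are not too many visits. -/
theorem expected_visits_bounds {α β L δ₀ D₀ cLo cHi lLo : ℝ} {l : ℕ → ℝ}
    (hL : 0 < L) (hcLo : 0 < cLo) (hlLo : 0 < lLo) (hg : ∀ j, 0 < g j)
    (hlaw : IsBanditLaw α β L δ₀ D₀ cLo cHi μ f) (hΓ : IsGrid T M Γ)
    (hsz : HasBatchSizes d β T M Γ g l) (hcal : IsCalibrated β L T M Γ g μ) {i : ℕ}
    (hi : i ∈ Finset.Icc 1 (M - 1)) (hl : lLo ≤ l i) (hTw : 2 ≤ T * width g i ^ d)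
    (hw : 32 ≤ lLo * cLo * width g i ^ (-(2 * β))) {C : Node d} (hC : C ∈ layerNodes d g i) :
    8 * Real.log (2 * T * width g i ^ d)
        ≤ ((Γ i : ℝ) - Γ (i - 1)) * (μ.map Prod.fst).real (C.bin g) ∧
      threshold d (((Γ i : ℝ) - Γ (i - 1)) * (μ.map Prod.fst).real (C.bin g) / 4) T (width g i)
        ≤ 16 / √(lLo * cLo) * width g i ^ β ∧
      ((Γ i : ℝ) - Γ (i - 1)) * (μ.map Prod.fst).real (C.bin g)
        ≤ 2 * Real.log (2 * T * width g i ^ d) * width g i ^ (-(2 * β)) := by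
  have hw0 := width_pos hg i
  have hi' := Finset.mem_Icc.1 hi
  set w := width g i with hwd
  set x := Real.log (T * w ^ d) with hx
  have hΛ : Real.log (2 * T * w ^ d) ≤ 2 * x := by rw [mul_assoc]; exact log_two_mul_le hTw
  have hxpos : 0 < x := Real.log_pos (by linarith)
  have hΛ1 : 0 < Real.log (2 * T * w ^ d) := Real.log_pos (by rw [mul_assoc]; linarith)
  set Λ := Real.log (2 * T * w ^ d)
  set q := (μ.map Prod.fst).real (C.bin g) with hq
  have hqge : cLo * w ^ d ≤ q := hlaw.measure_bin_ge hcLo hg hC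
  have hwd0 : 0 < w ^ d := pow_pos hw0 d
  have hq0 : 0 < q := lt_of_lt_of_le (mul_pos hcLo hwd0) hqge
  set n : ℝ := (Γ i : ℝ) - Γ (i - 1) with hn
  have hn1 : (1 : ℝ) ≤ n := by
    have h1 := hΓ.2.2 (i - 1) (by omega)
    rw [Nat.sub_add_cancel hi'.1] at h1
    have h2 : (Γ (i - 1) : ℝ) + 1 ≤ Γ i := by exact_mod_cast h1
    linarith
  -- A batch contains at least one time, so the floor n satisfies n + 1 ≤ 2n and rounding loses at
  -- most a factor 2.
  have hnge : lLo * w ^ (-(2 * β + d)) * x / 2 ≤ n := by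
    have h1 := hsz i hi
    have h2 := Int.lt_floor_add_one (l i * w ^ (-(2 * β + d)) * x)
    rw [← h1] at h2
    push_cast at h2
    have h3 : lLo * w ^ (-(2 * β + d)) * x ≤ l i * w ^ (-(2 * β + d)) * x := by gcongr
    linarith
  have hpow : w ^ (-(2 * β + d)) * w ^ d = w ^ (-(2 * β)) := by
    rw [← Real.rpow_natCast w d, ← Real.rpow_add hw0]
    congr 1; ring
  have hmge : lLo * cLo / 2 * w ^ (-(2 * β)) * x ≤ n * q := by
    calc lLo * cLo / 2 * w ^ (-(2 * β)) * x
        = (lLo * w ^ (-(2 * β + d)) * x / 2) * (cLo * w ^ d) := by rw [← hpow]; ring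
      _ ≤ n * q := mul_le_mul hnge hqge (by positivity) (by linarith)
  have hm0 : 0 < n * q := mul_pos (by linarith) hq0
  refine ⟨?_, ?_, ?_⟩
  -- The constant 32 gives at least 16x expected visits, and Λ ≤ 2x.
  · have : 32 * x ≤ lLo * cLo * w ^ (-(2 * β)) * x := mul_le_mul_of_nonneg_right hw hxpos.le
    linarith
  · have h1 : threshold d (n * q / 4) T w = 4 * √(Λ / (n * q / 4)) := rfl
    have hwβ : w ^ (-(2 * β)) = (w ^ β)⁻¹ ^ 2 := by
      rw [← Real.rpow_neg hw0.le, ← Real.rpow_natCast, ← Real.rpow_mul hw0.le]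
      congr 1; push_cast; ring
    have hwb : 0 < w ^ β := Real.rpow_pos_of_pos hw0 _
    have hlc : 0 < lLo * cLo := mul_pos hlLo hcLo
    have h2 : √(Λ / (n * q / 4)) ≤ 4 / √(lLo * cLo) * w ^ β := by
      refine Real.sqrt_le_iff.2 ⟨by positivity, ?_⟩
      rw [mul_pow, div_pow, Real.sq_sqrt hlc.le, div_le_iff₀ (by positivity)]
      rw [hwβ] at hmge
      have h3 : 4 ^ 2 / (lLo * cLo) * (w ^ β) ^ 2 * (lLo * cLo / 2 * (w ^ β)⁻¹ ^ 2 * x / 4)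
          = 2 * x := by field_simp; norm_num
      calc Λ ≤ 2 * x := hΛ
        _ = _ := h3.symm
        _ ≤ _ := by gcongr
    rw [h1]
    calc 4 * √(Λ / (n * q / 4)) ≤ 4 * (4 / √(lLo * cLo) * w ^ β) := by gcongr
      _ = _ := by ring
  -- The calibration, read backwards: a large threshold means few visits. As c₀ ≥ 1, it gives Λ/(2m)
  -- ≥ w^{2β}/4.
  · have h1 := hcal i hi C hC
    have h2 : threshold d (2 * (n * q)) T w = 4 * √(Λ / (2 * (n * q))) := rfl
    rw [h2] at h1
    have hwb : 0 < w ^ β := Real.rpow_pos_of_pos hw0 _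
    have hc1 : 1 ≤ cZero d β L := by
      unfold cZero
      have : 0 ≤ 2 * L * (d : ℝ) ^ (β / 2) := by positivity
      linarith
    have h3 : w ^ β / 2 ≤ √(Λ / (2 * (n * q))) := by nlinarith
    have h4 := Real.le_sqrt' (by positivity) |>.1 h3
    rw [le_div_iff₀ (by positivity)] at h4
    rw [Real.rpow_neg hw0.le, ← div_eq_mul_inv, le_div_iff₀ (Real.rpow_pos_of_pos hw0 _)]
    have h5 : w ^ (2 * β) = (w ^ β) ^ 2 := by
      rw [← Real.rpow_natCast, ← Real.rpow_mul hw0.le]; congr 1; push_cast; ring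
    rw [h5]
    nlinarith

end BatchSizes

/-! ### The regret bound on the product space -/

section Main

variable {d T M : ℕ} {Γ : ℕ → ℕ} {π : Policy d T} {μ : Measure (Obs d)} {f : Arm → Cov d → ℝ}

/-- Batch size times `H i` and `T * p i * H i` are both at most a constant times log T ·
w_{i+1}^{-(2β+d)} w_i^{β(1+α)}, hence O(b log T); they contribute 4/`cLo` and 34. The last batch is
charged with its maximal length `T`, which gives `r`. -/
theorem integral_sum_regretAt_le_of_widths {g : ℕ → ℕ} {α β L δ₀ D₀ cLo cHi lLo : ℝ} {l : ℕ → ℝ}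
    (hα : 0 < α) (hβ : 0 < β) (hL : 0 < L) (hδ₀ : 0 < δ₀) (hD₀ : 0 < D₀)
    (hcLo : 0 < cLo) (hlLo : 0 < lLo) (hM : 1 ≤ M) (hT : 2 ≤ T)
    (hf : ∀ k, Measurable (f k)) (hf01 : ∀ k x, f k x ∈ Set.Icc (0 : ℝ) 1)
    (hg : ∀ j, 0 < g j) (hlaw : IsBanditLaw α β L δ₀ D₀ cLo cHi μ f) (hΓ : IsGrid T M Γ)
    (hsz : HasBatchSizes d β T M Γ g l) (hcal : IsCalibrated β L T M Γ g μ)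
    (hl : ∀ i ∈ Finset.Icc 1 (M - 1), lLo ≤ l i) (hπ : IsBaSEDB M Γ g π)
    (hTw : ∀ i ∈ Finset.Icc 1 (M - 1), 2 ≤ T * width g i ^ d)
    (hw : ∀ i ∈ Finset.Icc 1 (M - 1), 32 ≤ lLo * cLo * width g i ^ (-(2 * β))) {b r : ℝ}
    (htrade : ∀ i, width g (i + 1) ^ (-(2 * β + d)) * width g i ^ (β * (1 + α)) ≤ b)
    (hlast : T * width g (M - 1) ^ (β * (1 + α)) ≤ r) :
    ∫ w, ∑ t, regretAt π f t w ∂(Measure.pi fun _ : Fin T => μ)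
      ≤ (D₀ + δ₀ ^ (-α)) * (1 + 3 / 2 * (16 / √(lLo * cLo)) + 2 * (L * (d : ℝ) ^ (β / 2))) ^ (1 + α)
        * ((4 / cLo + 34) * (M * Real.log T * b) + r) := by
  have := hlaw.isProb
  set K := 16 / √(lLo * cLo) with hK
  -- The summand 1 ensures `Δ 0` ≥ 1, the trivial gap bound before any test, since the root has
  -- width 1.
  set K' := 1 + 3 / 2 * K + 2 * (L * (d : ℝ) ^ (β / 2)) with hK'
  have hK0 : 0 < K := by rw [hK]; positivity
  have hLd : 0 ≤ L * (d : ℝ) ^ (β / 2) := by positivity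
  have hK'1 : 1 ≤ K' := by rw [hK']; linarith
  set E := (D₀ + δ₀ ^ (-α)) * K' ^ (1 + α) with hE
  have hE0 : 0 ≤ E := by positivity
  set q : ℝ := 2 * β + d with hq
  have hwpos := width_pos hg
  have hT0 : (0 : ℝ) < T := by exact_mod_cast (by omega : 0 < T)
  have hT2 : (2 : ℝ) ≤ T := by exact_mod_cast hT
  have hlogT : 0 < Real.log T := Real.log_pos (by linarith)
  set Δ : ℕ → ℝ := fun i => K' * width g i ^ β with hΔ
  set H : ℕ → ℝ := fun i => E * width g i ^ (β * (1 + α)) with hH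
  -- From 17m e^{-Λ} with e^{-Λ} = 1/(2Tw^d) and m ≤ 2Λw^{-2β} ≤ 4 log T · w^{-2β}: 17 · 4 / 2 = 34.
  set p : ℕ → ℝ := fun i => 34 * Real.log T * width g (i + 1) ^ (-q) / T with hp
  have hH0 : ∀ i, 0 ≤ H i := fun i => mul_nonneg hE0 (Real.rpow_nonneg (hwpos i).le _)
  have hp0 : ∀ i, 0 ≤ p i := fun i => by
    have := Real.rpow_nonneg (hwpos (i + 1)).le (-q)
    simp only [hp]; positivity
  have hbounds := fun i hi {C : Node d} (hC : C ∈ layerNodes d g i) =>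
    expected_visits_bounds hL hcLo hlLo hg hlaw hΓ hsz hcal hi (hl i hi) (hTw i hi) (hw i hi) hC
  have hlogge : ∀ i ∈ Finset.Icc 1 (M - 1), 1 ≤ Real.log (2 * T * width g i ^ d) := by
    intro i hi
    rw [Real.le_log_iff_exp_le (by have := pow_pos (hwpos i) d; positivity), mul_assoc]
    have := Real.exp_one_lt_d9
    have := hTw i hi
    linarith
  have hlogle : ∀ i, Real.log (2 * T * width g i ^ d) ≤ 2 * Real.log T := by
    intro i
    refine le_trans (Real.log_le_log (by have := pow_pos (hwpos i) d; positivity) ?_)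
      (log_two_mul_le hT2)
    have := pow_le_one₀ (hwpos i).le (width_le_one hg i) (n := d)
    exact mul_le_of_le_one_right (by positivity) this
  have hsc : BatchScale d T M β L K Γ g μ :=
    ⟨hlogge, fun i hi C hC => (hbounds i hi hC).1, fun i hi C hC => (hbounds i hi hC).2.1⟩
  have hqpow : ∀ i, width g i ^ (-q) * width g i ^ d = width g i ^ (-(2 * β)) := fun i => by
    rw [← Real.rpow_natCast (width g i) d, ← Real.rpow_add (hwpos i), hq]
    congr 1; ring
  have hHint : ∀ i, ∫⁻ v, ENNReal.ofReal (clippedGap f (Δ i) v.1) ∂μ ≤ ENNReal.ofReal (H i) := by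
    intro i
    have hwb := Real.rpow_pos_of_pos (hwpos i) β
    refine (lintegral_clippedGap_le hα hδ₀ hD₀ hf hlaw.margin
      (show 0 ≤ Δ i by simp only [hΔ]; positivity)).trans (le_of_eq ?_)
    simp only [hΔ, hH, hE]
    rw [Real.mul_rpow (by linarith) hwb.le, ← Real.rpow_mul (hwpos i).le]
    congr 1; ring
  have hprob : ∀ i < M - 1, ∀ z, (Measure.pi fun _ : Fin T => μ) (badAt Γ g π μ f (i + 1) z)
      ≤ ENNReal.ofReal (p i) := by
    intro i hi z
    have hi1 : i + 1 ∈ Finset.Icc 1 (M - 1) := Finset.mem_Icc.2 ⟨by omega, by omega⟩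
    obtain ⟨h1, -, h3⟩ := hbounds (i + 1) hi1 (nodeAt_mem_layerNodes hg (i + 1) z)
    refine (measure_badEvent_le hΓ hπ.1 hf hf01 hlaw.reward_mem hlaw.mean_reward _
      (measurableSet_bin _) (by rw [batch_card hΓ (by omega)]) (hlogge _ hi1) h1).trans
      (ENNReal.ofReal_le_ofReal ?_)
    have hwd := pow_pos (hwpos (i + 1)) d
    have hwq := Real.rpow_pos_of_pos (hwpos (i + 1)) (-q)
    rw [Real.exp_neg, Real.exp_log (by positivity), ← div_eq_mul_inv, div_le_iff₀ (by positivity)]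
    simp only [hp]
    rw [← hqpow] at h3
    calc _ ≤ 17 * (2 * Real.log (2 * T * width g (i + 1) ^ d)
          * (width g (i + 1) ^ (-q) * width g (i + 1) ^ d)) := by
          exact mul_le_mul_of_nonneg_left h3 (by norm_num)
      _ ≤ 17 * (2 * (2 * Real.log T) * (width g (i + 1) ^ (-q) * width g (i + 1) ^ d)) := by
          have := hlogle (i + 1)
          gcongr
      _ = _ := by field_simp; ring
  have hsize : ∀ i < M - 1, ((Γ (i + 1) : ℝ) - Γ i) ≤ 4 / cLo * Real.log T
      * width g (i + 1) ^ (-q) := by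
    intro i hi
    have hi1 : i + 1 ∈ Finset.Icc 1 (M - 1) := Finset.mem_Icc.2 ⟨by omega, by omega⟩
    -- Any bin of the layer serves: dividing its bound on expected visits by P_X(C) ≥ cLo w^d bounds
    -- the batch size.
    have hC := nodeAt_mem_layerNodes hg (i + 1) (0 : Cov d)
    obtain ⟨-, -, h3⟩ := hbounds (i + 1) hi1 hC
    have hge := hlaw.measure_bin_ge hcLo hg hC
    have hwd := pow_pos (hwpos (i + 1)) d
    have hwq := Real.rpow_pos_of_pos (hwpos (i + 1)) (-q)
    have hn0 : (0 : ℝ) ≤ (Γ (i + 1) : ℝ) - Γ i := by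
      have := hΓ.2.2 i (by omega)
      have h2 : (Γ i : ℝ) ≤ Γ (i + 1) := by exact_mod_cast this.le
      linarith
    rw [Nat.add_sub_cancel, ← hqpow] at h3
    have h4 : ((Γ (i + 1) : ℝ) - Γ i) * (cLo * width g (i + 1) ^ d)
        ≤ 2 * (2 * Real.log T) * (width g (i + 1) ^ (-q) * width g (i + 1) ^ d) := by
      refine (mul_le_mul_of_nonneg_left hge hn0).trans (h3.trans ?_)
      have := hlogle (i + 1)
      gcongr
    have h5 : 4 / cLo * Real.log T * width g (i + 1) ^ (-q) * (cLo * width g (i + 1) ^ d)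
        = 2 * (2 * Real.log T) * (width g (i + 1) ^ (-q) * width g (i + 1) ^ d) := by
      field_simp; norm_num
    rw [← h5] at h4
    exact le_of_mul_le_mul_right h4 (by positivity)
  have hsum0 : 0 ≤ ∑ j ∈ Finset.range (M - 1), p j * H j :=
    Finset.sum_nonneg fun j _ => mul_nonneg (hp0 j) (hH0 j)
  have hmain := integral_sum_regretAt_le (μ := μ) hπ.1 hf hf01 hΓ hH0 hsum0 fun i hi t ht =>
    lintegral_regretAt_le hL hβ hg hf hlaw.smooth hf01 hlaw.ae_mem_unitCube hΓ hπ hsc hcal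
      (Δ := Δ) (by simp [hΔ, width, hK'1])
      (fun i => by
        have hwb := Real.rpow_pos_of_pos (hwpos i) β
        simp only [hΔ]
        exact mul_le_mul_of_nonneg_right (by rw [hK']; linarith) hwb.le) hH0 hp0 hHint hprob i hi t ht
  refine hmain.trans ?_
  have hH' : ∀ i, width g (i + 1) ^ (-q) * H i ≤ E * b := fun i => by
    have := mul_le_mul_of_nonneg_left (htrade i) hE0
    simp only [hH]
    calc _ = E * (width g (i + 1) ^ (-q) * width g i ^ (β * (1 + α))) := by ring
      _ ≤ _ := this
  have hb0 : 0 ≤ b := le_trans (mul_nonneg (Real.rpow_nonneg (hwpos 1).le _)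
    (Real.rpow_nonneg (hwpos 0).le _)) (htrade 0)
  obtain ⟨m, rfl⟩ : ∃ m, M = m + 1 := ⟨M - 1, by omega⟩
  rw [Nat.add_sub_cancel] at *
  have hA : ∑ i ∈ Finset.range m, ((Γ (i + 1) : ℝ) - Γ i) * H i
      ≤ m * (4 / cLo * Real.log T * (E * b)) := by
    refine (Finset.sum_le_card_nsmul _ _ (4 / cLo * Real.log T * (E * b)) fun i hi => ?_).trans
      (by simp)
    calc _ ≤ (4 / cLo * Real.log T * width g (i + 1) ^ (-q)) * H i :=
          mul_le_mul_of_nonneg_right (hsize i (Finset.mem_range.1 hi)) (hH0 i)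
      _ = 4 / cLo * Real.log T * (width g (i + 1) ^ (-q) * H i) := by ring
      _ ≤ _ := mul_le_mul_of_nonneg_left (hH' i) (by positivity)
  have hB : ∑ j ∈ Finset.range m, p j * H j ≤ m * (34 * Real.log T * (E * b) / T) := by
    refine (Finset.sum_le_card_nsmul _ _ (34 * Real.log T * (E * b) / T) fun i hi => ?_).trans
      (by simp)
    calc p i * H i = 34 * Real.log T * (width g (i + 1) ^ (-q) * H i) / T := by
          simp only [hp]; ring
      _ ≤ _ := by
          have := hH' i
          gcongr
  have hC : ((Γ (m + 1) : ℝ) - Γ m) * H m ≤ E * r := by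
    have h1 : ((Γ (m + 1) : ℝ) - Γ m) ≤ T := by
      rw [hΓ.2.1]
      have : (0 : ℝ) ≤ Γ m := Nat.cast_nonneg _
      linarith
    calc _ ≤ T * H m := mul_le_mul_of_nonneg_right h1 (hH0 m)
      _ = E * (T * width g m ^ (β * (1 + α))) := by simp only [hH]; ring
      _ ≤ _ := mul_le_mul_of_nonneg_left hlast hE0
  rw [Finset.sum_range_succ]
  have hB' := mul_le_mul_of_nonneg_left hB hT0.le
  have e1 : T * (m * (34 * Real.log T * (E * b) / T)) = m * (34 * Real.log T * (E * b)) := by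
    field_simp
  rw [e1] at hB'
  calc _ ≤ m * (4 / cLo * Real.log T * (E * b)) + E * r + m * (34 * Real.log T * (E * b)) :=
        add_le_add (add_le_add hA hC) hB'
    _ = E * ((4 / cLo + 34) * (m * Real.log T * b) + r) := by ring
    _ ≤ _ := by
        refine mul_le_mul_of_nonneg_left (add_le_add ?_ le_rfl) hE0
        have : (m : ℝ) ≤ ((m + 1 : ℕ) : ℝ) := by push_cast; linarith
        gcongr

/-- From some horizon on, the first split factor is large and all bins are visited often. -/
theorem exists_large_horizon {γ q e B N bLo : ℝ} (hγ1 : γ < 1) (he : e < q)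
    (hq : 0 < q) (hB : 0 < B) (hN : 0 < N) (hbLo : 0 < bLo) :
    ∃ T₀ : ℕ, ∀ T : ℕ, T₀ ≤ T → 1 ≤ Real.log T ∧ 2 * (B * T) ^ (e / q) ≤ T ∧
      N ^ q ≤ bLo * (T : ℝ) ^ (1 - γ) / Real.log T ^ (2 * (1 - γ)) := by
  have h1 : ∀ᶠ x : ℝ in Filter.atTop, 1 ≤ Real.log x :=
    Real.tendsto_log_atTop.eventually_ge_atTop 1
  have h2 : ∀ᶠ x : ℝ in Filter.atTop, 2 * (B * x) ^ (e / q) ≤ x := by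
    have hs : 0 < 1 - e / q := by
      rw [sub_pos, div_lt_one hq]; exact he
    have := (tendsto_rpow_atTop hs).eventually_ge_atTop (2 * B ^ (e / q))
    filter_upwards [this, Filter.eventually_gt_atTop (0 : ℝ)] with x hx hx0
    rw [Real.mul_rpow hB.le hx0.le, ← mul_assoc]
    calc _ ≤ x ^ (1 - e / q) * x ^ (e / q) :=
          mul_le_mul_of_nonneg_right hx (Real.rpow_nonneg hx0.le _)
      _ = x := by rw [← Real.rpow_add hx0]; simp
  have h3 : ∀ᶠ x : ℝ in Filter.atTop,
      N ^ q ≤ bLo * x ^ (1 - γ) / Real.log x ^ (2 * (1 - γ)) := by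
    have := (isLittleO_log_rpow_rpow_atTop (2 * (1 - γ)) (sub_pos.2 hγ1)).def
      (c := bLo / N ^ q) (by positivity)
    filter_upwards [this, h1, Filter.eventually_gt_atTop (0 : ℝ)] with x hx hl hx0
    have hl0 : 0 < Real.log x := by linarith
    have hlp := Real.rpow_pos_of_pos hl0 (2 * (1 - γ))
    have hxp := Real.rpow_pos_of_pos hx0 (1 - γ)
    have hNq := Real.rpow_pos_of_pos hN q
    rw [Real.norm_of_nonneg hlp.le, Real.norm_of_nonneg hxp.le, div_mul_eq_mul_div,
      le_div_iff₀ hNq] at hx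
    rw [le_div_iff₀ hlp]; linarith
  obtain ⟨x₀, hx₀⟩ := Filter.eventually_atTop.1 (h1.and (h2.and h3))
  exact ⟨⌈x₀⌉₊, fun T hT => hx₀ T (Nat.ceil_le.1 hT)⟩

/-- The regret bound on the product space for large horizons. -/
theorem exists_regret_bound (d : ℕ) (hd : 0 < d) (α β L δ₀ D₀ cLo cHi D₁ bLo bHi lLo : ℝ)
    (hα : 0 < α) (hβ : 0 < β) (hαβ : α * β ≤ 1) (hL : 0 < L)
    (hδ₀ : 0 < δ₀) (hD₀ : 0 < D₀) (hcLo : 0 < cLo)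
    (hD₁ : 0 < D₁) (hbLo : 0 < bLo) (hbHi : 0 < bHi) (hlLo : 0 < lLo) :
    ∃ (C : ℝ) (T₀ : ℕ), 0 ≤ C ∧ ∀ (T M : ℕ), T₀ ≤ T → 1 ≤ M → (M : ℝ) ≤ D₁ * Real.log T →
      ∀ (b : ℝ),
        bLo * (T : ℝ) ^ rateExp d α β M / Real.log T ^ (2 * (1 - gammaExp d α β)) ≤ b →
        b ≤ bHi * (T : ℝ) ^ rateExp d α β M →
      ∀ (l : ℕ → ℝ), (∀ i ∈ Finset.Icc 1 (M - 1), lLo ≤ l i) →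
      ∀ (Γ : ℕ → ℕ), IsGrid T M Γ →
        HasBatchSizes d β T M Γ (splitFactor d α β b M) l →
      ∀ (π : Policy d T), IsBaSEDB M Γ (splitFactor d α β b M) π →
      ∀ (μ : Measure (Obs d)) (f : Arm → Cov d → ℝ), (∀ k, Measurable (f k)) →
        (∀ k x, f k x ∈ Set.Icc (0 : ℝ) 1) →
        IsBanditLaw α β L δ₀ D₀ cLo cHi μ f →
        IsCalibrated β L T M Γ (splitFactor d α β b M) μ →
        ∫ w, ∑ t, regretAt π f t w ∂(Measure.pi fun _ : Fin T => μ)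
          ≤ C * (Real.log T ^ 2 * (T : ℝ) ^ rateExp d α β M) := by
  have hγ : 0 < gammaExp d α β := gammaExp_pos hα hβ
  have hγ1 : gammaExp d α β < 1 := gammaExp_lt_one hd hβ hαβ
  have hq : (0 : ℝ) < 2 * β + d := by positivity
  set γ := gammaExp d α β with hγd
  -- Once g₀ ≥ N, every tested bin has width at most 1/N, which secures the factor 32 required by
  -- `expected_visits_bounds`.
  set N : ℝ := max 1 ((32 / (lLo * cLo)) ^ (1 / (2 * β))) with hN
  have hlc : 0 < lLo * cLo := mul_pos hlLo hcLo
  have hN1 : 1 ≤ N := le_max_left _ _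
  have hN32 : 32 ≤ lLo * cLo * N ^ (2 * β) := by
    have h1 : ((32 / (lLo * cLo)) ^ (1 / (2 * β))) ^ (2 * β) ≤ N ^ (2 * β) :=
      Real.rpow_le_rpow (by positivity) (le_max_right _ _) (by positivity)
    rw [← Real.rpow_mul (by positivity), one_div_mul_cancel (by positivity), Real.rpow_one,
      div_le_iff₀ hlc] at h1
    linarith
  set B := max 1 bHi ^ (1 / (1 - γ)) with hB
  have hB0 : 0 < B := Real.rpow_pos_of_pos (lt_of_lt_of_le one_pos (le_max_left _ _)) _
  -- the first split factor has to be at least `⌈N⌉`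
  have hceil : (0 : ℝ) < ⌈N⌉₊ := by
    exact_mod_cast Nat.ceil_pos.2 (by linarith)
  obtain ⟨T₀, hT₀⟩ := exists_large_horizon (γ := γ) (q := 2 * β + d) (e := d) (N := ⌈N⌉₊)
    hγ1 (by linarith) hq hB0 hceil hbLo
  set E := (D₀ + δ₀ ^ (-α)) *
    (1 + 3 / 2 * (16 / √(lLo * cLo)) + 2 * (L * (d : ℝ) ^ (β / 2))) ^ (1 + α) with hE
  set R := Real.exp (β * (1 + α) / ((1 - γ) * (1 - 2 ^ (γ - 1))))
        * 2 ^ (β * (1 + α) / (1 - γ)) * (min 1 bLo)⁻¹ ^ (1 / (1 - γ)) with hR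
  have hE0 : 0 ≤ E := by positivity
  have hmin0 : 0 < min 1 bLo := lt_min one_pos hbLo
  have hR0 : 0 ≤ R := by positivity
  refine ⟨E * ((4 / cLo + 34) * (D₁ * bHi) + R), max 2 T₀, by positivity, ?_⟩
  intro T M hT hM hMlog b hbl hbu l hl Γ hΓ hsz π hπ μ f hf hf01 hlaw hcal
  obtain ⟨hlog, hbig, hNq⟩ := hT₀ T ((le_max_right _ _).trans hT)
  have hT2 : 2 ≤ T := (le_max_left _ _).trans hT
  have hT1 : (1 : ℝ) ≤ T := by exact_mod_cast (by omega : 1 ≤ T)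
  have hT0 : (0 : ℝ) < T := by linarith
  have hlog0 : 0 < Real.log T := by linarith
  have hpM := pow_lt_one₀ hγ.le hγ1 (by omega : M ≠ 0)
  have hpM0 := pow_pos hγ M
  -- A lower bound uniform in `M`, so that a single `T₀` serves all numbers of batches.
  have hrate : 1 - γ ≤ rateExp d α β M := by
    rw [rateExp, ← hγd, le_div_iff₀ (by linarith)]
    nlinarith
  have hbN : (⌈N⌉₊ : ℝ) ^ (2 * β + d) ≤ b := by
    refine hNq.trans (le_trans ?_ hbl)
    have := Real.rpow_le_rpow_of_exponent_le hT1 hrate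
    gcongr
  have hb0 : 0 ≤ b := le_trans (by positivity) hbN
  have hg0 : ⌈N⌉₊ ≤ splitFactor d α β b M 0 := by
    rw [splitFactor]
    refine Nat.le_floor ?_
    calc (⌈N⌉₊ : ℝ) = ((⌈N⌉₊ : ℝ) ^ (2 * β + d)) ^ (1 / (2 * β + d)) := by
          rw [← Real.rpow_mul hceil.le, mul_one_div_cancel hq.ne', Real.rpow_one]
      _ ≤ _ := Real.rpow_le_rpow (by positivity) hbN (by positivity)
  have hg1 : 1 ≤ splitFactor d α β b M 0 := le_trans (by exact_mod_cast hceil) hg0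
  have hgpos := splitFactor_pos hγ hg1
  set g := splitFactor d α β b M with hg
  have hGpos : ∀ i, (0 : ℝ) < binCount g i := fun i => by exact_mod_cast binCount_pos hgpos i
  have hTw : ∀ i ∈ Finset.Icc 1 (M - 1), 2 ≤ T * width g i ^ d := by
    intro i hi
    have hi' := Finset.mem_Icc.1 hi
    have h1 := binCount_rpow_le hα hβ hγ1 hg1 hT1 hb0 hbu hM (show i ≤ M by omega)
    have h2 : (binCount g i : ℝ) ^ d ≤ (B * T) ^ ((d : ℝ) / (2 * β + d)) := by
      calc (binCount g i : ℝ) ^ d = ((binCount g i : ℝ) ^ (2 * β + d)) ^ ((d : ℝ) / (2 * β + d)) := by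
            rw [← Real.rpow_mul (hGpos i).le, mul_div_cancel₀ _ hq.ne', Real.rpow_natCast]
        _ ≤ _ := Real.rpow_le_rpow (by positivity) h1 (by positivity)
    -- The number of bins is at most (BT)^{d/(2β+d)}, with exponent below 1, hence at most T/2 for
    -- large T.
    rw [width_eq, inv_pow, ← div_eq_mul_inv, le_div_iff₀ (pow_pos (hGpos i) d)]
    linarith
  have hw : ∀ i ∈ Finset.Icc 1 (M - 1), 32 ≤ lLo * cLo * width g i ^ (-(2 * β)) := by
    intro i hi
    obtain ⟨j, rfl⟩ : ∃ j, i = j + 1 := ⟨i - 1, by have := (Finset.mem_Icc.1 hi).1; omega⟩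
    have h1 : g 0 ≤ binCount g (j + 1) := by
      rw [binCount, Finset.prod_range_succ']
      exact Nat.le_mul_of_pos_left _ (Finset.prod_pos fun l _ => hgpos _)
    have h2 : N ≤ binCount g (j + 1) :=
      (Nat.le_ceil N).trans (by exact_mod_cast hg0.trans h1)
    rw [width_eq, Real.rpow_neg (inv_nonneg.2 (hGpos _).le), Real.inv_rpow (hGpos _).le, inv_inv]
    refine hN32.trans ?_
    gcongr
  have hlast := last_batch_le hα hβ hγ1 hg1 hbLo hT1 hlog hbl hM
  refine (integral_sum_regretAt_le_of_widths hα hβ hL hδ₀ hD₀ hcLo hlLo hM hT2 hf hf01 hgpos hlaw hΓ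
    hsz hcal hl hπ hTw hw (width_trade_off hα hβ hb0 hg1) hlast).trans ?_
  rw [← hγd, ← hR, ← hE, mul_assoc E]
  refine mul_le_mul_of_nonneg_left ?_ hE0
  have hTr : 0 ≤ (T : ℝ) ^ rateExp d α β M := Real.rpow_nonneg hT0.le _
  have h1 : M * Real.log T * b ≤ (D₁ * Real.log T) * Real.log T * (bHi * (T : ℝ) ^ rateExp d α β M) := by
    gcongr
  have h2 : 0 ≤ 4 / cLo + 34 := by positivity
  have h3 := mul_le_mul_of_nonneg_left h1 h2
  calc _ ≤ _ := add_le_add h3 le_rfl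
    _ = _ := by ring

end Main

/-! ### Reduction to measurable mean rewards on the product space -/

section Reduction

variable {d : ℕ}

open Classical in
/-- The mean rewards clamped to `[0,1]` on the cube, and `0` outside of it. -/
def clampReward (f : Arm → Cov d → ℝ) (k : Arm) : Cov d → ℝ :=
  (unitCube d).piecewise (fun x => max 0 (min 1 (f k x))) fun _ => 0

theorem clampReward_mem (f : Arm → Cov d → ℝ) (k : Arm) (x : Cov d) :
    clampReward f k x ∈ Set.Icc (0 : ℝ) 1 := by
  classical
  by_cases hx : x ∈ unitCube d
  · rw [clampReward, Set.piecewise_eq_of_mem _ _ _ hx]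
    exact ⟨le_max_left _ _, max_le zero_le_one (min_le_left _ _)⟩
  · rw [clampReward, Set.piecewise_eq_of_notMem _ _ _ hx]
    exact ⟨le_rfl, zero_le_one⟩

theorem clampReward_eq {f : Arm → Cov d → ℝ} {k : Arm} {x : Cov d} (hx : x ∈ unitCube d)
    (hf : f k x ∈ Set.Icc (0 : ℝ) 1) : clampReward f k x = f k x := by
  classical
  rw [clampReward, Set.piecewise_eq_of_mem _ _ _ hx, min_eq_right hf.2, max_eq_right hf.1]

/-- Hölder continuity gives continuity on the cube only; off the cube nothing is known about `f`, so
it is replaced by a constant there. -/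
theorem measurable_clampReward {L β : ℝ} (hβ : 0 < β) {f : Arm → Cov d → ℝ}
    (hsm : ∀ k, ∀ x ∈ unitCube d, ∀ x' ∈ unitCube d, |f k x - f k x'| ≤ L * ‖x - x'‖ ^ β)
    (k : Arm) : Measurable (clampReward f k) := by
  classical
  have hc : ContinuousOn (f k) (unitCube d) := by
    intro x hx
    rw [ContinuousWithinAt, tendsto_iff_norm_sub_tendsto_zero]
    have hlim : Filter.Tendsto (fun y : Cov d => L * ‖y - x‖ ^ β) (nhdsWithin x (unitCube d))
        (nhds 0) := by
      have h1 : Continuous fun y : Cov d => L * ‖y - x‖ ^ β :=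
        ((continuous_id.sub continuous_const).norm.rpow_const fun _ => Or.inr hβ.le).const_mul L
      have h2 := h1.tendsto x
      simp only [sub_self, norm_zero, Real.zero_rpow hβ.ne', mul_zero] at h2
      exact h2.mono_left nhdsWithin_le_nhds
    refine squeeze_zero' (Filter.Eventually.of_forall fun _ => norm_nonneg _) ?_ hlim
    filter_upwards [self_mem_nhdsWithin] with y hy
    exact hsm k y hy x hx
  exact ContinuousOn.measurable_piecewise (continuousOn_const.sup (continuousOn_const.inf hc))
    continuousOn_const measurableSet_unitCube

variable {α β L δ₀ D₀ cLo cHi : ℝ} {μ : Measure (Obs d)} {f : Arm → Cov d → ℝ}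

/-- A conditional mean of a `[0,1]`-valued reward lies in `[0,1]` almost surely, and the covariate
lies in the cube almost surely. -/
theorem IsBanditLaw.ae_clampReward_eq (h : IsBanditLaw α β L δ₀ D₀ cLo cHi μ f) :
    ∀ᵐ z ∂μ, ∀ k, clampReward f k z.1 = f k z.1 := by
  have := h.isProb
  rw [ae_all_iff]
  intro k
  have hmy : Measurable fun z : Obs d => z.2 k := (measurable_pi_apply k).comp measurable_snd
  have hy : ∀ᵐ z ∂μ, z.2 k ∈ Set.Icc (0 : ℝ) 1 := h.reward_mem.mono fun z hz => hz k
  have hyint : Integrable (fun z : Obs d => z.2 k) μ := by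
    refine Integrable.of_bound hmy.aestronglyMeasurable 1 ?_
    filter_upwards [hy] with z hz
    rw [Real.norm_eq_abs, abs_of_nonneg hz.1]; exact hz.2
  have hm : MeasurableSpace.comap Prod.fst inferInstance
      ≤ (inferInstance : MeasurableSpace (Obs d)) := measurable_fst.comap_le
  have h1 := condExp_nonneg (m := MeasurableSpace.comap Prod.fst inferInstance)
    (f := fun z : Obs d => z.2 k) (hy.mono fun z hz => hz.1)
  have h2 := condExp_mono (m := MeasurableSpace.comap Prod.fst inferInstance) hyint
    (integrable_const (1 : ℝ)) (hy.mono fun z hz => hz.2)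
  rw [condExp_const hm] at h2
  filter_upwards [h1, h2, h.mean_reward k, h.ae_mem_unitCube] with z h1 h2 h3 h4
  rw [h3] at h1 h2
  exact clampReward_eq h4 ⟨h1, h2⟩

/-- Truncation to `[0,1]` is 1-Lipschitz, which preserves smoothness; the clauses about the law see
`f` only almost everywhere. So the mean rewards may be assumed measurable and bounded everywhere. -/
theorem IsBanditLaw.clamp (h : IsBanditLaw α β L δ₀ D₀ cLo cHi μ f) :
    IsBanditLaw α β L δ₀ D₀ cLo cHi μ (clampReward f) where
  isProb := h.isProb
  density := h.density
  reward_mem := h.reward_mem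
  mean_reward k := by
    filter_upwards [h.mean_reward k, h.ae_clampReward_eq] with z h1 h2
    rw [h1, h2 k]
  smooth k x hx x' hx' := by
    classical
    refine le_trans ?_ (h.smooth k x hx x' hx')
    rw [clampReward, Set.piecewise_eq_of_mem _ _ _ hx, Set.piecewise_eq_of_mem _ _ _ hx']
    have h1 := abs_max_sub_max_le_max 0 (min 1 (f k x)) 0 (min 1 (f k x'))
    have h2 := abs_min_sub_min_le_max 1 (f k x) 1 (f k x')
    simp only [sub_self, abs_zero, abs_nonneg, sup_of_le_right] at h1 h2
    exact h1.trans h2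
  margin δ hδ := by
    refine le_trans (le_of_eq (measureReal_congr (Filter.eventuallyEq_set.2 ?_)))
      (h.margin δ hδ)
    filter_upwards [h.ae_clampReward_eq] with z hz
    simp only [hz]

variable {T M : ℕ} {Γ : ℕ → ℕ} {π : Policy d T} {Ω : Type*} [MeasurableSpace Ω] {P : Measure Ω}
  {X : Fin T → Ω → Cov d} {Y : Fin T → Ω → Arm → ℝ}

/-- The regret of a batch policy is integrable, and it is an integral over a product space. -/
theorem IsSample.regret_eq [IsProbabilityMeasure P] (hS : IsSample P μ X Y) (hβ : 0 < β)
    (hπ : IsBatchPolicy M Γ π) (h : IsBanditLaw α β L δ₀ D₀ cLo cHi μ f) :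
    Integrable (regretSum X Y f π) P ∧
      regret P X Y f π
        = ∫ w, ∑ t, regretAt π (clampReward f) t w ∂(Measure.pi fun _ : Fin T => μ) := by
  have hm : ∀ t, Measurable fun ω => (X t ω, Y t ω) := fun t =>
    (hS.measurable_X t).prodMk (hS.measurable_Y t)
  set W : Ω → Fin T → Obs d := fun ω t => (X t ω, Y t ω) with hW
  have hWm : Measurable W := measurable_pi_lambda _ hm
  have hmap : P.map W = Measure.pi fun _ : Fin T => μ := by
    rw [(iIndepFun_iff_map_fun_eq_pi_map fun t => (hm t).aemeasurable).1 hS.indep]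
    congr 1
    funext t
    exact hS.law t
  have hfm := measurable_clampReward hβ h.smooth
  have hF : Measurable fun w : Fin T → Obs d => ∑ t, regretAt π (clampReward f) t w :=
    Finset.measurable_sum _ fun t _ => measurable_regretAt hπ hfm t
  have hae : ∀ᵐ ω ∂P, ∀ t k, clampReward f k (X t ω) = f k (X t ω) := by
    rw [ae_all_iff]
    intro t
    have h1 := h.ae_clampReward_eq
    rw [← hS.law t] at h1
    exact ae_of_ae_map (hm t).aemeasurable h1
  have hsum : (fun ω => ∑ t, regretAt π (clampReward f) t (W ω)) =ᵐ[P] regretSum X Y f π := by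
    filter_upwards [hae] with ω hω
    refine Finset.sum_congr rfl fun t _ => ?_
    simp only [regretAt, hW, hω]
    rfl
  have hFi : Integrable (fun ω => ∑ t, regretAt π (clampReward f) t (W ω)) P := by
    refine Integrable.of_bound (hF.comp hWm).aestronglyMeasurable T
      (Filter.Eventually.of_forall fun ω => ?_)
    refine (norm_sum_le _ _).trans ((Finset.sum_le_card_nsmul _ _ 1 fun t _ => ?_).trans (by simp))
    have := regretAt_mem (π := π) (clampReward_mem f) t (W ω)
    rw [Real.norm_eq_abs, abs_of_nonneg this.1]; exact this.2
  refine ⟨hFi.congr hsum, ?_⟩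
  rw [regret, ← integral_congr_ae hsum, ← hmap,
    integral_map hWm.aemeasurable hF.aestronglyMeasurable]

theorem integral_sum_regretAt_le_horizon [IsProbabilityMeasure μ]
    (hf01 : ∀ k x, f k x ∈ Set.Icc (0 : ℝ) 1) :
    ∫ w, ∑ t, regretAt π f t w ∂(Measure.pi fun _ : Fin T => μ) ≤ T := by
  have h1 : ∀ w, ∑ t, regretAt π f t w ≤ (T : ℝ) := fun w =>
    (Finset.sum_le_card_nsmul _ _ 1 fun t _ => (regretAt_mem hf01 t w).2).trans (by simp)
  have h0 : ∀ w, 0 ≤ ∑ t, regretAt π f t w := fun w =>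
    Finset.sum_nonneg fun t _ => (regretAt_mem hf01 t w).1
  refine (integral_mono_of_nonneg (Filter.Eventually.of_forall h0) (integrable_const (T : ℝ))
    (Filter.Eventually.of_forall h1)).trans (by simp)

end Reduction

end

/-! ### Conclusion: all horizons -/

theorem theorem3 (d : ℕ) (hd : 0 < d) (α β L δ₀ D₀ cLo cHi D₁ bLo bHi lLo : ℝ)
    (hα : 0 < α) (hβ : 0 < β) (hβ1 : β ≤ 1) (hαβ : α * β ≤ 1) (hL : 0 < L)
    (hδ₀ : 0 < δ₀) (hδ₀1 : δ₀ < 1) (hD₀ : 0 < D₀) (hcLo : 0 < cLo) (hcHi : 0 < cHi)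
    (hD₁ : 0 < D₁) (hbLo : 0 < bLo) (hbHi : 0 < bHi) (hlLo : 0 < lLo) :
    ∃ Ctil : ℝ, 0 < Ctil ∧
      ∀ (T M : ℕ), 1 ≤ M → (M : ℝ) ≤ D₁ * Real.log T →
      ∀ (b : ℝ),
        bLo * (T : ℝ) ^ rateExp d α β M / Real.log T ^ (2 * (1 - gammaExp d α β)) ≤ b →
        b ≤ bHi * (T : ℝ) ^ rateExp d α β M →
      ∀ (l : ℕ → ℝ), (∀ i ∈ Finset.Icc 1 (M - 1), lLo ≤ l i) →
      ∀ (Γ : ℕ → ℕ), IsGrid T M Γ →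
        HasBatchSizes d β T M Γ (splitFactor d α β b M) l →
      ∀ (π : Policy d T), IsBaSEDB M Γ (splitFactor d α β b M) π →
      ∀ (μ : Measure (Cov d × (Arm → ℝ))) (f : Arm → Cov d → ℝ),
        IsBanditLaw α β L δ₀ D₀ cLo cHi μ f →
        IsCalibrated β L T M Γ (splitFactor d α β b M) μ →
      ∀ (Ω : Type*) [MeasurableSpace Ω] (P : Measure Ω) [IsProbabilityMeasure P]
        (X : Fin T → Ω → Cov d) (Y : Fin T → Ω → Arm → ℝ), IsSample P μ X Y →
        Integrable (regretSum X Y f π) P ∧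
        regret P X Y f π ≤ Ctil * Real.log T ^ 2 * (T : ℝ) ^ rateExp d α β M := by
  obtain ⟨C, T₀, hC0, hC⟩ := exists_regret_bound d hd α β L δ₀ D₀ cLo cHi D₁ bLo bHi lLo hα hβ hαβ hL
    hδ₀ hD₀ hcLo hD₁ hbLo hbHi hlLo
  have hγ : 0 < gammaExp d α β := gammaExp_pos hα hβ
  have hγ1 : gammaExp d α β < 1 := gammaExp_lt_one hd hβ hαβ
  -- The second term handles `T < T₀`, where the regret is at most `T`: since 1 ≤ M ≤ D₁ log T, the
  -- factor D₁²(log T)² is at least 1.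
  refine ⟨C + (T₀ + 1) * D₁ ^ 2, by positivity, ?_⟩
  intro T M hM hMlog b hbl hbu l hl Γ hΓ hsz π hπ μ f hlaw hcal Ω _ P _ X Y hS
  obtain ⟨hint, hreg⟩ := hS.regret_eq hβ hπ.1 hlaw
  refine ⟨hint, ?_⟩
  have := hlaw.isProb
  have hM1 : (1 : ℝ) ≤ M := by exact_mod_cast hM
  have hDlog : 1 ≤ D₁ * Real.log T := hM1.trans hMlog
  have hlog : 0 < Real.log T := by
    by_contra hc
    nlinarith [not_lt.1 hc]
  have hT1 : (1 : ℝ) ≤ T := by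
    have : T ≠ 0 := by rintro rfl; simp at hlog
    exact_mod_cast Nat.one_le_iff_ne_zero.2 this
  have hpM := pow_lt_one₀ hγ.le hγ1 (by omega : M ≠ 0)
  have hrate0 : 0 ≤ rateExp d α β M := div_nonneg (by linarith) (by linarith)
  have hTr : 1 ≤ (T : ℝ) ^ rateExp d α β M := Real.one_le_rpow hT1 hrate0
  have hD : 1 ≤ D₁ ^ 2 * Real.log T ^ 2 := by
    rw [← mul_pow]; exact one_le_pow₀ hDlog
  have hle := integral_sum_regretAt_le_horizon (T := T) (π := π) (μ := μ) (clampReward_mem f)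
  rw [← hreg] at hle
  rcases lt_or_ge T T₀ with hsmall | hlarge
  · have hTT₀ : (T : ℝ) ≤ T₀ := by exact_mod_cast hsmall.le
    refine (hle.trans (le_mul_of_one_le_right (by linarith) hTr)).trans
      (mul_le_mul_of_nonneg_right ?_ (by linarith))
    calc (T : ℝ) ≤ T₀ + 1 := by linarith
      _ ≤ (T₀ + 1) * (D₁ ^ 2 * Real.log T ^ 2) := le_mul_of_one_le_right (by positivity) hD
      _ ≤ (T₀ + 1) * (D₁ ^ 2 * Real.log T ^ 2) + C * Real.log T ^ 2 :=
          le_add_of_nonneg_right (by positivity)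
      _ = _ := by ring
  · rw [hreg]
    refine (hC T M hlarge hM hMlog b hbl hbu l hl Γ hΓ hsz π hπ μ (clampReward f)
      (measurable_clampReward hβ hlaw.smooth) (clampReward_mem f) hlaw.clamp hcal).trans ?_
    rw [← mul_assoc]
    have : 0 ≤ (T₀ + 1 : ℝ) * D₁ ^ 2 := by positivity
    gcongr
    linarith
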